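/- Let $N\in\mathbb N$, let $\Omega\subset\mathbb R^N$ be a bounded domain (open, connected, non-empty) with boundary $\Gamma=\partial\Omega$, let $\Gamma_t\subset\Gamma$ be relatively open and $\Gamma_n:=\Gamma\setminus\overline{\Gamma_t}$. If $\Gamma_t\neq\emptyset$, assume that some point of $\Gamma_t$ is a limit of points of the exterior $\mathbb R^N\setminus\overline\Omega$ (this holds, for instance, whenever $\Gamma$ is Lipschitz). **Spaces.** All norms $\|\cdot\|$, scalar products and orthogonal complements $\perp$ are those of $L^2(\Omega)$, and Euclidean (Frobenius) norms are used pointwise. For relatively open $\Sigma\subset\Gamma$ let $C^\infty(\Sigma,\Omega)$ be the set of restrictions to $\Omega$ of smooth compactly supported fields on $\mathbb R^N$ such that the support of the restriction has positive distance to $\Sigma$. With the exterior derivative $\mathrm d$ and the co-derivative $\delta=(-1)^{(q-1)N}{*}\,\mathrm d\,{*}$ on $q$-forms, taken in the weak sense, let $\mathring D^q(\Sigma,\Omega)$ and $\mathring\Delta^q(\Sigma,\Omega)$ be the closures of the $q$-forms in $C^\infty(\Sigma,\Omega)$ with respect to the norms $(\|E\|^2+\|\mathrm dE\|^2)^{1/2}$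 and $(\|H\|^2+\|\delta H\|^2)^{1/2}$; an additional index $0$ means $\mathrm dE=0$, respectively $\delta H=0$. For tensor fields $T:\Omega\to\mathbb R^{N\times N}$ let $\operatorname{Curl}T$ be the $N\times\frac{N(N-1)}2$ field with the entries $\partial_iT_{nj}-\partial_jT_{ni}$ ($1\le n\le N$, $i<j$) in the sense of distributions, $H(\operatorname{Curl};\Omega)=\{T\in L^2:\operatorname{Curl}T\in L^2\}$ with the norm $(\|T\|^2+\|\operatorname{Curl}T\|^2)^{1/2}$, and let $\mathring H(\operatorname{Curl};\Gamma_t,\Omega)$ be the closure of the tensor fields in $C^\infty(\Gamma_t,\Omega)$ in this norm (vanishing row-wise tangential trace on $\Gamma_t$). Further, $\operatorname{sym}T=\frac12(T+T^{\mathsf T})$, $\operatorname{skew}T=T-\operatorname{sym}T$, and $\mathfrak{so}(N)$ is the set of constant skew-symmetric tensor fields. **Admissible pairs.** $(\Omega,\Gamma_t)$ has the *Maxwell compactness property* if for all $q$ the embedding of $\mathring D^q(\Gamma_t,\Omega)\cap\mathring\Delta^q(\Gamma_n,\Omega)$, with its graph norm, into $L^2$ is compact. It has the *Maxwell approximation property*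 if for all $q$, with orthogonal complements taken in the square-integrable $q$-forms, $\mathring D^q_0(\Gamma_t,\Omega)=(\delta\mathring\Delta^{q+1}(\Gamma_n,\Omega))^\perp$ and $\mathring\Delta^q_0(\Gamma_n,\Omega)=(\mathrm d\mathring D^{q-1}(\Gamma_t,\Omega))^\perp$. A domain has the *Korn property* if $c\|\nabla v\|\le\|v\|+\|\operatorname{sym}\nabla v\|$ for some $c>0$ and all $H^1$ vector fields $v$, and $H^1\hookrightarrow L^2$ is compact. A *slicing* of $(\Omega,\Gamma_t)$ is a finite family $\Omega_1,\dots,\Omega_J$ of disjoint, simply connected subdomains of $\Omega$ with the Korn property, covering $\Omega$ up to a Lebesgue null set, such that, if $\Gamma_t\ne\emptyset$, each $\overline{\Omega_j}\cap\Gamma_t$ has non-empty interior relative to $\Gamma$; the pair is *sliceable* if it has a slicing. It is *admissible* if it has both Maxwell properties and is sliceable. **Theorem.** Let $(\Omega,\Gamma_t)$ be admissible. Then there is a constant $c_1>0$ such that the following holds. (i) If $\Gamma_t\ne\emptyset$, then $\|T\|\le c_1(\|\operatorname{sym}T\|+\|\operatorname{Curl}T\|)$ for all $T\in\mathring H(\operatorname{Curl};\Gamma_t,\Omega)$.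 In other words, the right-hand side defines on $\mathring H(\operatorname{Curl};\Gamma_t,\Omega)$ a norm equivalent to the standard norm of $H(\operatorname{Curl};\Omega)$. (ii) If $\Gamma_t=\emptyset$, then for every slicing $\Omega_1,\dots,\Omega_J$ there is a constant $c_2\ge c_1$ such that for each $T\in H(\operatorname{Curl};\Omega)$ there is a piecewise constant skew-symmetric tensor field $S$, constant on each $\Omega_j$, with $\|T-S\|\le c_2(\|\operatorname{sym}T\|+\|\operatorname{Curl}T\|)$. (ii') If $\Gamma_t=\emptyset$ and $\Omega$ is simply connected, then for every $T\in H(\operatorname{Curl};\Omega)$ the constant skew-symmetric tensor $S_T=\operatorname{skew}\big(\lambda(\Omega)^{-1}\int_\Omega T\,d\lambda\big)$ satisfies $\|T-S_T\|\le c_1(\|\operatorname{sym}T\|+\|\operatorname{Curl}T\|)$. Here $\operatorname{Curl}S_T=0$, $T-S_T\in H(\operatorname{Curl};\Omega)\cap\mathfrak{so}(N)^\perp$ with $\operatorname{Curl}(T-S_T)=\operatorname{Curl}T$, $S_T$ is the only element $S$ of $\mathfrak{so}(N)$ with $T-S\perp\mathfrak{so}(N)$, and $S_T=0$ if and only if $T\perp\mathfrak{so}(N)$.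 Consequently the inequality in (i) holds for all $T\in H(\operatorname{Curl};\Omega)\cap\mathfrak{so}(N)^\perp$, and on this space its right-hand side defines a norm equivalent to the standard norm of $H(\operatorname{Curl};\Omega)$. -/

import Mathlib

open MeasureTheory Set

namespace KornMaxwell

noncomputable section

/-- Euclidean space `ℝ^N`. -/
abbrev Pt (N : ℕ) : Type := EuclideanSpace ℝ (Fin N)

/-- Exterior algebra of `ℝ^N`: the component of `E` at `I = {i₁ < … < i_q}` is the coefficient of
`dx_{i₁} ∧ … ∧ dx_{i_q}`; the basis of these monomials is orthonormal. -/
abbrev Form (N : ℕ) : Type := EuclideanSpace ℝ (Finset (Fin N))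

/-- `(N × N)`-matrices with the Frobenius norm; the entry in row `i` and column `j` is `A (i, j)`. -/
abbrev Ten (N : ℕ) : Type := EuclideanSpace ℝ (Fin N × Fin N)

/-- `(N × N(N-1)/2)`-matrices with the Frobenius norm; the columns are indexed by the pairs
`i < j`. -/
abbrev Rot (N : ℕ) : Type :=
  EuclideanSpace ℝ (Fin N × {p : Fin N × Fin N // p.1 < p.2})

/-- The Hilbert space of square-integrable `V`-valued fields on `Ω`. -/
abbrev L2 {N : ℕ} (Ω : Set (Pt N)) (V : Type) [NormedAddCommGroup V] : Type :=
  Lp V 2 (volume.restrict Ω)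

variable {N : ℕ}

/-- The `k`-th partial derivative. -/
def pd {V : Type} [NormedAddCommGroup V] [NormedSpace ℝ V] (k : Fin N) (Φ : Pt N → V) (x : Pt N) :
    V :=
  fderiv ℝ Φ x (EuclideanSpace.single k 1)

/-- Smooth fields with compact support in `Ω`. -/
def IsTest {V : Type} [NormedAddCommGroup V] [NormedSpace ℝ V] (Ω : Set (Pt N)) (φ : Pt N → V) :
    Prop :=
  ContDiff ℝ (⊤ : ℕ∞) φ ∧ HasCompactSupport φ ∧ tsupport φ ⊆ Ω

/-- The smooth compactly supported fields `Φ` on `ℝ^N` whose restriction to `Ω` has a support with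
positive distance to `Γ`. -/
def IsSmoothAway {V : Type} [NormedAddCommGroup V] [NormedSpace ℝ V] (Ω Γ : Set (Pt N))
    (Φ : Pt N → V) : Prop :=
  ContDiff ℝ (⊤ : ℕ∞) Φ ∧ HasCompactSupport Φ ∧
    ∃ δ > 0, ∀ x ∈ Ω, Φ x ≠ 0 → ∀ y ∈ Γ, δ ≤ dist x y

/-! ### Differential forms -/

/-- The sign with `dx_k ∧ dx_J = sgn k J • dx_{J ∪ {k}}` for `k ∉ J`. -/
def sgn (k : Fin N) (I : Finset (Fin N)) : ℝ := (-1) ^ (I.filter (fun j => j < k)).card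

/-- The exterior derivative of a smooth form: `d E = ∑ₖ dx_k ∧ ∂ₖ E`. -/
def extD (Φ : Pt N → Form N) (x : Pt N) : Form N :=
  WithLp.toLp 2 fun K => ∑ k ∈ K, sgn k K * pd k Φ x (K.erase k)

/-- The co-derivative `δ = (-1)^{(q-1)N} * d *` on smooth `q`-forms: `δ E = ∑ₖ e_k ⌟ ∂ₖ E`.
For `q = 1` this is the divergence. -/
def coD (Φ : Pt N → Form N) (x : Pt N) : Form N :=
  WithLp.toLp 2 fun J => ∑ k ∈ Jᶜ, sgn k J * pd k Φ x (insert k J)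

/-- `E` is a `q`-form: only components of degree `q` occur. -/
def IsQForm {Ω : Set (Pt N)} (q : ℕ) (E : L2 Ω (Form N)) : Prop :=
  ∀ᵐ x ∂volume.restrict Ω, ∀ I : Finset (Fin N), I.card ≠ q → E x I = 0

/-- `F` is the weak exterior derivative of `E` in `Ω`. -/
def HasWeakD {Ω : Set (Pt N)} (E F : L2 Ω (Form N)) : Prop :=
  ∀ φ : Pt N → Form N, IsTest Ω φ →
    ∫ x in Ω, inner ℝ (E x) (coD φ x) = - ∫ x in Ω, inner ℝ (F x) (φ x)

/-- `G` is the weak co-derivative of `H` in `Ω`. -/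
def HasWeakCoD {Ω : Set (Pt N)} (H G : L2 Ω (Form N)) : Prop :=
  ∀ φ : Pt N → Form N, IsTest Ω φ →
    ∫ x in Ω, inner ℝ (H x) (extD φ x) = - ∫ x in Ω, inner ℝ (G x) (φ x)

/-- The pairs `(E, d E)` with `E` in the space of `q`-forms with square-integrable exterior
derivative and vanishing tangential trace on `Γ`, i.e. in the closure, with respect to the graph
norm, of the smooth `q`-forms on the closure of `Ω` that vanish near `Γ`. -/
def DSpace (Ω Γ : Set (Pt N)) (q : ℕ) : Set (L2 Ω (Form N) × L2 Ω (Form N)) :=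
  {w | IsQForm q w.1 ∧ HasWeakD w.1 w.2 ∧
    w ∈ closure {u : L2 Ω (Form N) × L2 Ω (Form N) |
      ∃ Φ : Pt N → Form N, IsSmoothAway Ω Γ Φ ∧ (∀ x I, I.card ≠ q → Φ x I = 0) ∧
        u.1 =ᵐ[volume.restrict Ω] Φ ∧ u.2 =ᵐ[volume.restrict Ω] extD Φ}}

/-- The pairs `(H, δ H)` with `H` in the space of `q`-forms with square-integrable co-derivative and
vanishing normal trace on `Γ`. -/
def CoDSpace (Ω Γ : Set (Pt N)) (q : ℕ) : Set (L2 Ω (Form N) × L2 Ω (Form N)) :=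
  {w | IsQForm q w.1 ∧ HasWeakCoD w.1 w.2 ∧
    w ∈ closure {u : L2 Ω (Form N) × L2 Ω (Form N) |
      ∃ Φ : Pt N → Form N, IsSmoothAway Ω Γ Φ ∧ (∀ x I, I.card ≠ q → Φ x I = 0) ∧
        u.1 =ᵐ[volume.restrict Ω] Φ ∧ u.2 =ᵐ[volume.restrict Ω] coD Φ}}

/-- The complementary boundary part `Γ_n = ∂Ω \ closure Γ_t`. -/
def gammaN (Ω Γt : Set (Pt N)) : Set (Pt N) := frontier Ω \ closure Γt

/-- Maxwell compactness property: for all `q`, the unit ball (in the graph norm) of the `q`-forms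
with square-integrable `d` and `δ`, vanishing tangential trace on `Γ_t` and vanishing normal trace
on `Γ_n` is relatively compact in `L²`. -/
def MCP (Ω Γt : Set (Pt N)) : Prop :=
  ∀ q : ℕ, IsCompact (closure {E : L2 Ω (Form N) | ∃ F G : L2 Ω (Form N),
    (E, F) ∈ DSpace Ω Γt q ∧ (E, G) ∈ CoDSpace Ω (gammaN Ω Γt) q ∧
      ‖E‖ ^ 2 + ‖F‖ ^ 2 + ‖G‖ ^ 2 ≤ 1})

/-- Maxwell approximation property: for all `q`, the `d`-free `q`-forms with vanishing tangential
trace on `Γ_t` are the orthogonal complement (in the square-integrable `q`-forms) of the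
co-derivatives of the `(q+1)`-forms with vanishing normal trace on `Γ_n`, and the `δ`-free `q`-forms
with vanishing normal trace on `Γ_n` are the orthogonal complement of the exterior derivatives of
the `(q-1)`-forms with vanishing tangential trace on `Γ_t` (there are no `(-1)`-forms). -/
def MAP (Ω Γt : Set (Pt N)) : Prop :=
  ∀ q : ℕ,
    {E : L2 Ω (Form N) | (E, 0) ∈ DSpace Ω Γt q} =
      {E | IsQForm q E ∧ ∀ w ∈ CoDSpace Ω (gammaN Ω Γt) (q + 1), inner ℝ E w.2 = 0} ∧
    {H : L2 Ω (Form N) | (H, 0) ∈ CoDSpace Ω (gammaN Ω Γt) q} =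
      {H | IsQForm q H ∧ ∀ r : ℕ, r + 1 = q → ∀ w ∈ DSpace Ω Γt r, inner ℝ H w.2 = 0}

/-! ### Tensor fields -/

/-- `A ↦ sym A = (A + Aᵀ) / 2`. -/
def symL (N : ℕ) : Ten N →L[ℝ] Ten N :=
  LinearMap.toContinuousLinearMap
    { toFun := fun A => WithLp.toLp 2 fun p => (A p + A p.swap) / 2
      map_add' := fun A B => by ext p; simp; ring
      map_smul' := fun a A => by ext p; simp; ring }

/-- `A ↦ skew A = A - sym A`. -/
def skewL (N : ℕ) : Ten N →L[ℝ] Ten N := ContinuousLinearMap.id ℝ (Ten N) - symL N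

/-- Skew-symmetric matrices. -/
def IsSkew (A : Ten N) : Prop := ∀ i j, A (i, j) = - A (j, i)

/-- The field `sym T`. -/
def symF {Ω : Set (Pt N)} (T : L2 Ω (Ten N)) : L2 Ω (Ten N) := (symL N).compLp T

/-- The row-wise rotation of a smooth tensor field:
`(Curl T)_{n,(i,j)} = ∂ᵢ T_{n j} - ∂ⱼ T_{n i}` for `i < j`. -/
def curlS (Φ : Pt N → Ten N) (x : Pt N) : Rot N :=
  WithLp.toLp 2 fun p => pd p.2.1.1 Φ x (p.1, p.2.1.2) - pd p.2.1.2 Φ x (p.1, p.2.1.1)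

/-- `C = Curl T` in the sense of distributions in `Ω`. As `T` and `C` are square-integrable, this
says that `T` belongs to `H(Curl; Ω)` and has the rotation `C`. -/
def HasWeakCurl {Ω : Set (Pt N)} (T : L2 Ω (Ten N)) (C : L2 Ω (Rot N)) : Prop :=
  ∀ (n : Fin N) (p : {p : Fin N × Fin N // p.1 < p.2}) (φ : Pt N → ℝ), IsTest Ω φ →
    ∫ x in Ω, C x (n, p) * φ x =
      - ∫ x in Ω, (T x (n, p.1.2) * pd p.1.1 φ x - T x (n, p.1.1) * pd p.1.2 φ x)

/-- The pairs `(T, Curl T)` with `T` in `H(Curl; Ω)`. -/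
def HCurl (Ω : Set (Pt N)) : Set (L2 Ω (Ten N) × L2 Ω (Rot N)) :=
  {w | HasWeakCurl w.1 w.2}

/-- The pairs `(T, Curl T)` with `T` in `H(Curl; Ω)` and vanishing row-wise tangential trace on `Γ`,
i.e. in the closure, with respect to the graph norm, of the smooth tensor fields on the closure of
`Ω` that vanish near `Γ`. -/
def HCurlVanish (Ω Γ : Set (Pt N)) : Set (L2 Ω (Ten N) × L2 Ω (Rot N)) :=
  {w | w ∈ HCurl Ω ∧
    w ∈ closure {u : L2 Ω (Ten N) × L2 Ω (Rot N) |
      ∃ Φ : Pt N → Ten N, IsSmoothAway Ω Γ Φ ∧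
        u.1 =ᵐ[volume.restrict Ω] Φ ∧ u.2 =ᵐ[volume.restrict Ω] curlS Φ}}

/-- The standard norm of `H(Curl; Ω)`. -/
def hCurlNorm {Ω : Set (Pt N)} (w : L2 Ω (Ten N) × L2 Ω (Rot N)) : ℝ :=
  √(‖w.1‖ ^ 2 + ‖w.2‖ ^ 2)

/-- `‖sym T‖ + ‖Curl T‖`. -/
def symCurlNorm {Ω : Set (Pt N)} (w : L2 Ω (Ten N) × L2 Ω (Rot N)) : ℝ :=
  ‖symF w.1‖ + ‖w.2‖

/-- The set `so(N)` of constant skew-symmetric tensor fields on `Ω`. -/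
def soN (Ω : Set (Pt N)) : Set (L2 Ω (Ten N)) :=
  {S | ∃ A : Ten N, IsSkew A ∧ S =ᵐ[volume.restrict Ω] fun _ => A}

/-- `T` is orthogonal in `L²` to all constant skew-symmetric tensor fields. -/
def PerpSoN {Ω : Set (Pt N)} (T : L2 Ω (Ten N)) : Prop :=
  ∀ S ∈ soN Ω, inner ℝ T S = 0

/-- On the linear subspace `W` the function `p` is a norm, and it is equivalent to `r`. -/
structure IsEquivNormOn {V : Type} [AddCommGroup V] [Module ℝ V] (W : Set V) (p r : V → ℝ) :
    Prop where
  nonneg : ∀ w ∈ W, 0 ≤ p w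
  definite : ∀ w ∈ W, p w = 0 → w = 0
  smul : ∀ (a : ℝ), ∀ w ∈ W, p (a • w) = |a| * p w
  add : ∀ v ∈ W, ∀ w ∈ W, p (v + w) ≤ p v + p w
  equiv : ∃ k K : ℝ, 0 < k ∧ 0 < K ∧ ∀ w ∈ W, k * r w ≤ p w ∧ p w ≤ K * r w

/-! ### Korn property, slicings, admissible pairs -/

/-- `g` is the weak gradient of the function `u` in `Ω`. -/
def HasWeakGrad {Ω : Set (Pt N)} (u : L2 Ω ℝ) (g : L2 Ω (Pt N)) : Prop :=
  ∀ (k : Fin N) (φ : Pt N → ℝ), IsTest Ω φ →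
    ∫ x in Ω, g x k * φ x = - ∫ x in Ω, u x * pd k φ x

/-- `G` is the weak Jacobian of the vector field `v` in `Ω`. -/
def HasWeakJac {Ω : Set (Pt N)} (v : L2 Ω (Pt N)) (G : L2 Ω (Ten N)) : Prop :=
  ∀ (n k : Fin N) (φ : Pt N → ℝ), IsTest Ω φ →
    ∫ x in Ω, G x (n, k) * φ x = - ∫ x in Ω, v x n * pd k φ x

/-- Korn property: Korn's second inequality holds on `Ω`, and the embedding of the Sobolev space
`H¹(Ω)` of functions into `L²(Ω)` is compact. -/
def KP (Ω : Set (Pt N)) : Prop :=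
  (∃ c > 0, ∀ (v : L2 Ω (Pt N)) (G : L2 Ω (Ten N)), HasWeakJac v G →
    c * ‖G‖ ≤ ‖v‖ + ‖symF G‖) ∧
  IsCompact (closure {u : L2 Ω ℝ | ∃ g : L2 Ω (Pt N),
    HasWeakGrad u g ∧ ‖u‖ ^ 2 + ‖g‖ ^ 2 ≤ 1})

/-- Interior of a set `A ⊆ Γ` with respect to the relative topology of `Γ`. -/
def relInterior (Γ A : Set (Pt N)) : Set (Pt N) :=
  {x ∈ Γ | ∃ U, IsOpen U ∧ x ∈ U ∧ U ∩ Γ ⊆ A}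

/-- `Ω₁, …, Ω_J` is a slicing of the pair `(Ω, Γ_t)`. -/
structure IsSlicing (Ω Γt : Set (Pt N)) {J : ℕ} (P : Fin J → Set (Pt N)) : Prop where
  subset : ∀ j, P j ⊆ Ω
  isOpen : ∀ j, IsOpen (P j)
  disjoint : ∀ i j, i ≠ j → Disjoint (P i) (P j)
  simplyConnected : ∀ j, IsSimplyConnected (P j)
  korn : ∀ j, KP (P j)
  null : volume (Ω \ ⋃ j, P j) = 0
  boundary : Γt.Nonempty →
    ∀ j, (relInterior (frontier Ω) (closure (P j) ∩ Γt)).Nonempty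

/-- The pair `(Ω, Γ_t)` is sliceable. -/
def Sliceable (Ω Γt : Set (Pt N)) : Prop :=
  ∃ (J : ℕ) (P : Fin J → Set (Pt N)), IsSlicing Ω Γt P

/-- The pair `(Ω, Γ_t)` is admissible. -/
structure Admissible (Ω Γt : Set (Pt N)) : Prop where
  mcp : MCP Ω Γt
  map : MAP Ω Γt
  sliceable : Sliceable Ω Γt

end

end KornMaxwell

open Filter Topology
open scoped ENNReal Convolution

namespace KornMaxwell

noncomputable section

variable {N : ℕ}

/-! ### Mollification -/

/-! The estimate is a compactness argument by contradiction, carried out once in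
`exists_norm_le_symCurlNorm` for every closed subspace of pairs `(T, Curl T)` whose rows lie in
`DSpace Ω Γt 1` and in which `sym T = 0` and `Curl T = 0` force `T = 0`. Take `T_n` of norm one with
`sym T_n → 0` and `Curl T_n → 0`. The Maxwell estimate `exists_curlFree_part` gives curl-free `R_n`
with `‖T_n - R_n‖ ≤ C ‖Curl T_n‖`. On each slice the rows of `R_n` are gradients of functions
bounded in `H¹`; the compact embedding makes these potentials converge along a subsequence, and
Korn's inequality together with `sym R_n → 0` turns this into convergence of `R_n`
(`KP.exists_subseq`). The slices fill `Ω` up to a null set, so `R_n` and hence `T_n` converge in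
`L²(Ω)` (`IsSlicing.exists_subseq`). The limit has norm one and lies in the kernel, a contradiction.
Nothing has to match across the interfaces of the slices.

The kernel consists of constants: `∂_i T_{nj}` is symmetric in `i, j` and antisymmetric in `n, j`,
hence zero (`exists_ae_const_of_isSkew_of_curlFree`). If `Γt` is non-empty, the extension by zero
across `Γt` is still curl-free and skew near a boundary point approached from the exterior, so it is
constant there and the constant is zero. If `Γt` is empty, the kernel is `so(N)`, which
orthogonality to `so(N)` removes.

The Maxwell estimate is a second compactness argument. A 1-form orthogonal to the closed forms is
orthogonal to the exact ones, so the approximation property makes it co-closed, and the compactness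
property applies. The resulting closed range of `d` also shows, for empty `Γt`, that weak exterior
derivatives are limits of smooth ones (`HasWeakD.mem_DSpace`), so that all of `H(Curl; Ω)` is
covered.

Potentials on a slice are found on balls by mollification and the smooth Poincaré lemma. They differ
by constants on overlaps, and these constants form a Čech cocycle, which is trivial because a
covering of a simply connected space has a section (`exists_cocycle_primitive`). Global
square-integrability of the glued potential follows from smooth truncation, Poincaré's inequality
and Fatou's lemma (`memLp_of_gradApprox`). -/

theorem eLpNorm_two_sq {α V : Type*} [MeasurableSpace α] [NormedAddCommGroup V] (f : α → V)
    (μ : Measure α) : eLpNorm f 2 μ ^ 2 = ∫⁻ x, ‖f x‖ₑ ^ 2 ∂μ := by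
  rw [eLpNorm_eq_lintegral_rpow_enorm_toReal (by norm_num) (by norm_num)]
  simp only [ENNReal.toReal_ofNat, one_div]
  rw [← ENNReal.rpow_natCast, ← ENNReal.rpow_mul]
  simp

/-- Translations act continuously on `Lp` for finite exponents; this is that continuity at the
origin. -/
theorem tendsto_translation {g : Pt N → ℝ} (hg : MemLp g 2 volume) :
    Tendsto (fun z => eLpNorm (fun x => g (x - z) - g x) 2 volume) (𝓝 (0 : Pt N)) (𝓝 0) := by
  have : Fact ((2 : ℝ≥0∞) ≠ ⊤) := ⟨by norm_num⟩
  have hc : Continuous fun z : Pt N => (DomAddAct.mk (-z) +ᵥ hg.toLp g) - hg.toLp g := by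
    refine Continuous.sub ?_ continuous_const
    have h1 : Continuous fun z : Pt N => DomAddAct.mk (-z) :=
      DomAddAct.continuous_mk.comp continuous_neg
    exact h1.vadd continuous_const
  have h0 := (hc.tendsto 0).enorm
  simp only [neg_zero, DomAddAct.mk_zero, zero_vadd, sub_self, enorm_zero] at h0
  refine h0.congr fun z => ?_
  rw [DomAddAct.mk_vadd_toLp, ← MemLp.toLp_sub, Lp.enorm_toLp]
  refine eLpNorm_congr_ae (ae_of_all _ fun x => ?_)
  simp [neg_add_eq_sub]

/-- A standard sequence of bump functions shrinking to the origin. -/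
def moll (N n : ℕ) : ContDiffBump (0 : Pt N) where
  rIn := 1 / (2 * (n + 1))
  rOut := 1 / (n + 1)
  rIn_pos := by positivity
  rIn_lt_rOut := by
    apply one_div_lt_one_div_of_lt <;> [positivity; skip]
    have : (0 : ℝ) < n + 1 := by positivity
    linarith

/-- The mollifications of a function. -/
def mollify (n : ℕ) (g : Pt N → ℝ) : Pt N → ℝ :=
  g ⋆[ContinuousLinearMap.mul ℝ ℝ, volume] (moll N n).normed volume

theorem contDiff_normed (n : ℕ) : ContDiff ℝ (⊤ : ℕ∞) ((moll N n).normed volume) :=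
  (moll N n).contDiff_normed

theorem contDiff_mollify (n : ℕ) {g : Pt N → ℝ} (hg : LocallyIntegrable g volume) :
    ContDiff ℝ (⊤ : ℕ∞) (mollify n g) :=
  (moll N n).hasCompactSupport_normed.contDiff_convolution_right _ hg (contDiff_normed n)

theorem pd_mollify (n : ℕ) {g : Pt N → ℝ} (hg : LocallyIntegrable g volume) (k : Fin N)
    (x : Pt N) :
    pd k (mollify n g) x = ∫ y, g y * pd k ((moll N n).normed volume) (x - y) := by
  have h1 : ContDiff ℝ 1 ((moll N n).normed (volume : Measure (Pt N))) :=
    (contDiff_normed n).of_le (by exact_mod_cast le_top)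
  rw [pd, mollify, ((moll N n).hasCompactSupport_normed.hasFDerivAt_convolution_right
    (ContinuousLinearMap.mul ℝ ℝ) hg h1 x).fderiv]
  rw [convolution_precompR_apply _ hg ((moll N n).hasCompactSupport_normed.fderiv (𝕜 := ℝ))
    (h1.continuous_fderiv one_ne_zero)]
  rfl

theorem mollify_sub_eq (n : ℕ) {g : Pt N → ℝ} (hg : LocallyIntegrable g volume) (x : Pt N) :
    mollify n g x - g x = ∫ z, (g (x - z) - g x) * (moll N n).normed volume z := by
  have h1 : mollify n g x = ∫ z, g (x - z) * (moll N n).normed volume z := by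
    rw [mollify, convolution_eq_swap]
    rfl
  have h2 : g x = ∫ z, g x * (moll N n).normed volume z := by
    rw [integral_const_mul, (moll N n).integral_normed, mul_one]
  have h3 : Integrable (fun z => g (x - z) * (moll N n).normed volume z) volume :=
    (((moll N n).hasCompactSupport_normed (μ := volume)).convolutionExists_right
      (ContinuousLinearMap.mul ℝ ℝ) hg (contDiff_normed n).continuous x).integrable_swap
  have h4 : Integrable (fun z => g x * (moll N n).normed volume z) volume :=
    ((moll N n).integrable_normed).const_mul _
  calc mollify n g x - g x
      = (∫ z, g (x - z) * (moll N n).normed volume z) - ∫ z, g x * (moll N n).normed volume z := by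
        rw [← h1, ← h2]
    _ = _ := by
        rw [← integral_sub h3 h4]
        simp_rw [sub_mul]

/-- Jensen's inequality: the kernel is the density of a probability measure, for which the `L¹` norm
is at most the `L²` norm. -/
theorem enorm_mollify_sub_sq_le (n : ℕ) {g : Pt N → ℝ} (hg : LocallyIntegrable g volume)
    (x : Pt N) :
    ‖mollify n g x - g x‖ₑ ^ 2 ≤
      ∫⁻ z, ‖g (x - z) - g x‖ₑ ^ 2 * ENNReal.ofReal ((moll N n).normed volume z) := by
  set η := (moll N n).normed (volume : Measure (Pt N)) with hη
  have hη0 : ∀ z, 0 ≤ η z := (moll N n).nonneg_normed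
  have hηm : Measurable fun z => ENNReal.ofReal (η z) :=
    (contDiff_normed n).continuous.measurable.ennreal_ofReal
  have hone : ∫⁻ z, ENNReal.ofReal (η z) = 1 := by
    rw [← ofReal_integral_eq_lintegral_ofReal (moll N n).integrable_normed (ae_of_all _ hη0),
      (moll N n).integral_normed, ENNReal.ofReal_one]
  let μ : Measure (Pt N) := volume.withDensity fun z => ENNReal.ofReal (η z)
  have : IsProbabilityMeasure μ := ⟨by simp [μ, hone]⟩
  have hm : AEStronglyMeasurable (fun z => g (x - z) - g x) volume :=
    (hg.aestronglyMeasurable.comp_quasiMeasurePreserving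
      (quasiMeasurePreserving_sub_left volume x)).sub aestronglyMeasurable_const
  have hm' : AEStronglyMeasurable (fun z => g (x - z) - g x) μ :=
    hm.mono_ac (withDensity_absolutelyContinuous _ _)
  have key := eLpNorm_le_eLpNorm_of_exponent_le (p := 1) (q := 2) (by norm_num) hm'
  have h1 : ‖mollify n g x - g x‖ₑ ≤ eLpNorm (fun z => g (x - z) - g x) 1 μ := by
    rw [mollify_sub_eq n hg x, eLpNorm_one_eq_lintegral_enorm]
    refine (enorm_integral_le_lintegral_enorm _).trans ?_
    rw [lintegral_withDensity_eq_lintegral_mul_non_measurable _ hηm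
      (ae_of_all _ fun _ => ENNReal.ofReal_lt_top)]
    refine lintegral_mono fun z => ?_
    rw [enorm_mul, Pi.mul_apply, mul_comm, Real.enorm_of_nonneg (hη0 z)]
  calc _ ≤ eLpNorm (fun z => g (x - z) - g x) 2 μ ^ 2 := by gcongr; exact h1.trans key
    _ = _ := by
      rw [eLpNorm_two_sq, lintegral_withDensity_eq_lintegral_mul_non_measurable _ hηm
        (ae_of_all _ fun _ => ENNReal.ofReal_lt_top)]
      simp_rw [Pi.mul_apply, mul_comm]

/-- After integrating the pointwise bound and exchanging the integrals, the squared error is an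
average, over `z` in the support of the kernel, of the squared `L²` distances between the function
and its translate by `z`. -/
theorem tendsto_mollify {g : Pt N → ℝ} (hg : MemLp g 2 volume) :
    Tendsto (fun n => eLpNorm (fun x => mollify n g x - g x) 2 volume) atTop (𝓝 0) := by
  have hloc : LocallyIntegrable g volume := hg.locallyIntegrable (by norm_num)
  rw [ENNReal.tendsto_nhds_zero]
  intro ε hε
  have h := (tendsto_translation hg)
  rw [ENNReal.tendsto_nhds_zero] at h
  obtain ⟨δ, hδ, hb⟩ := Metric.eventually_nhds_iff.1 (h ε hε)
  have hev : ∀ᶠ n : ℕ in atTop, 1 / ((n : ℝ) + 1) < δ :=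
    (tendsto_one_div_add_atTop_nhds_zero_nat (𝕜 := ℝ)).eventually (gt_mem_nhds hδ)
  filter_upwards [hev] with n hn
  set η := (moll N n).normed (volume : Measure (Pt N)) with hη
  have hη0 : ∀ z, 0 ≤ η z := (moll N n).nonneg_normed
  have hηm : Measurable fun z => ENNReal.ofReal (η z) :=
    (contDiff_normed n).continuous.measurable.ennreal_ofReal
  have hone : ∫⁻ z, ENNReal.ofReal (η z) = 1 := by
    rw [← ofReal_integral_eq_lintegral_ofReal (moll N n).integrable_normed (ae_of_all _ hη0),
      (moll N n).integral_normed, ENNReal.ofReal_one]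
  have hmeas : AEMeasurable (fun p : Pt N × Pt N => ‖g (p.1 - p.2) - g p.1‖ₑ ^ 2 *
      ENNReal.ofReal (η p.2)) (volume.prod volume) := by
    have h1 : AEStronglyMeasurable (fun p : Pt N × Pt N => g (p.1 - p.2))
        (volume.prod volume) :=
      hg.1.comp_quasiMeasurePreserving (quasiMeasurePreserving_sub volume volume)
    have h2 : AEStronglyMeasurable (fun p : Pt N × Pt N => g p.1) (volume.prod volume) :=
      hg.1.comp_quasiMeasurePreserving Measure.quasiMeasurePreserving_fst
    exact ((h1.sub h2).enorm.pow_const 2).mul (hηm.comp measurable_snd).aemeasurable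
  have hsq : eLpNorm (fun x => mollify n g x - g x) 2 volume ^ 2 ≤ ε ^ 2 := by
    rw [eLpNorm_two_sq]
    calc _ ≤ ∫⁻ x, ∫⁻ z, ‖g (x - z) - g x‖ₑ ^ 2 * ENNReal.ofReal (η z) :=
          lintegral_mono fun x => enorm_mollify_sub_sq_le n hloc x
      _ = ∫⁻ z, ∫⁻ x, ‖g (x - z) - g x‖ₑ ^ 2 * ENNReal.ofReal (η z) :=
          lintegral_lintegral_swap hmeas
      _ ≤ ∫⁻ z, ε ^ 2 * ENNReal.ofReal (η z) := by
          refine lintegral_mono fun z => ?_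
          simp only
          rw [lintegral_mul_const' _ _ ENNReal.ofReal_ne_top, ← eLpNorm_two_sq]
          by_cases hz : η z = 0
          · simp [hz]
          · have : z ∈ Metric.ball (0 : Pt N) (moll N n).rOut := by
              rw [← (moll N n).support_normed_eq (μ := volume)]
              exact hz
            gcongr
            exact hb ((Metric.mem_ball.1 this).trans hn)
      _ = ε ^ 2 := by
          rw [lintegral_const_mul _ hηm, hone, mul_one]
  exact (ENNReal.pow_le_pow_left_iff (by norm_num)).1 hsq

/-! ### Poincaré's inequality on convex sets -/

/-- The Jacobian factor is `t⁻ᴺ`; the threshold `1/2` suits the later case distinction, where one of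
`t` and `1 - t` exceeds it. -/
theorem lintegral_comp_affine_le {f : Pt N → ℝ≥0∞} (hf : Measurable f) (a : Pt N) {t : ℝ}
    (ht : 1 / 2 ≤ t) : ∫⁻ x, f (a + t • x) ≤ 2 ^ N * ∫⁻ x, f x := by
  have ht0 : t ≠ 0 := by linarith
  have h1 : ∫⁻ x, f (a + t • x) = ENNReal.ofReal |(t ^ N)⁻¹| * ∫⁻ x, f x := by
    have h2 : ∫⁻ x, f (a + t • x) =
        ∫⁻ y, f (a + y) ∂(Measure.map (fun x : Pt N => t • x) volume) := by
      exact (lintegral_map (hf.comp (measurable_const_add a)) (measurable_const_smul t)).symm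
    rw [h2, Measure.map_addHaar_smul volume ht0, lintegral_smul_measure,
      lintegral_add_left_eq_self f a]
    simp
  rw [h1]
  gcongr
  have h3 : |(t ^ N)⁻¹| ≤ 2 ^ N := by
    rw [abs_of_nonneg (by positivity), ← inv_pow]
    gcongr
    rw [inv_le_comm₀ (by linarith) (by norm_num)]
    linarith
  calc ENNReal.ofReal |(t ^ N)⁻¹| ≤ ENNReal.ofReal (2 ^ N) := ENNReal.ofReal_le_ofReal h3
    _ = 2 ^ N := by rw [ENNReal.ofReal_pow (by norm_num)]; simp

theorem enorm_sub_sq_le_lintegral_segment {B : Set (Pt N)} (hB : Convex ℝ B) {v : Pt N → ℝ}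
    {ω : Pt N → Pt N →L[ℝ] ℝ} (hω : Continuous ω) (hv : ∀ x ∈ B, HasFDerivAt v (ω x) x)
    {x y : Pt N} (hx : x ∈ B) (hy : y ∈ B) :
    ‖v x - v y‖ₑ ^ 2 ≤
      ‖x - y‖ₑ ^ 2 * ∫⁻ t in Ioc (0 : ℝ) 1, ‖ω (y + t • (x - y))‖ₑ ^ 2 := by
  have hline : ∀ t : ℝ, HasDerivAt (fun t : ℝ => y + t • (x - y)) (x - y) t := fun t => by
    simpa using ((hasDerivAt_id t).smul_const (x - y)).const_add y
  have hd : ∀ t ∈ uIcc (0 : ℝ) 1,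
      HasDerivAt (fun t : ℝ => v (y + t • (x - y))) (ω (y + t • (x - y)) (x - y)) t := by
    intro t ht
    rw [uIcc_of_le zero_le_one] at ht
    exact (hv _ (hB.add_smul_sub_mem hy hx ht)).comp_hasDerivAt t (hline t)
  have hcont : Continuous fun t : ℝ => ω (y + t • (x - y)) := by fun_prop
  have hcont' : Continuous fun t : ℝ => ω (y + t • (x - y)) (x - y) := by fun_prop
  have hftc := intervalIntegral.integral_eq_sub_of_hasDerivAt hd
    (hcont'.intervalIntegrable 0 1)
  simp only [one_smul, zero_smul, add_zero, add_sub_cancel] at hftc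
  have hprob : IsProbabilityMeasure (volume.restrict (Ioc (0 : ℝ) 1)) := ⟨by simp⟩
  have h1 : ‖v x - v y‖ₑ ≤
      eLpNorm (fun t : ℝ => ω (y + t • (x - y)) (x - y)) 1 (volume.restrict (Ioc (0 : ℝ) 1)) := by
    rw [← hftc, intervalIntegral.integral_of_le zero_le_one, eLpNorm_one_eq_lintegral_enorm]
    exact enorm_integral_le_lintegral_enorm _
  have h2 := h1.trans (eLpNorm_le_eLpNorm_of_exponent_le (p := 1) (q := 2) (by norm_num)
    hcont'.aestronglyMeasurable)
  calc ‖v x - v y‖ₑ ^ 2 ≤ _ := by gcongr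
    _ = ∫⁻ t in Ioc (0 : ℝ) 1, ‖ω (y + t • (x - y)) (x - y)‖ₑ ^ 2 := eLpNorm_two_sq _ _
    _ ≤ ∫⁻ t in Ioc (0 : ℝ) 1, ‖x - y‖ₑ ^ 2 * ‖ω (y + t • (x - y))‖ₑ ^ 2 := by
        refine lintegral_mono fun t => ?_
        rw [← mul_pow, mul_comm]
        gcongr
        exact ContinuousLinearMap.le_opENorm _ _
    _ = _ := lintegral_const_mul _ (hcont.enorm.measurable.pow_const 2)

/-- Both points are joined by a segment, the fundamental theorem of calculus is applied along it,
and the integral over the segment parameter is moved outermost. -/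
theorem lintegral_lintegral_enorm_sub_sq_le {B : Set (Pt N)} (hB : Convex ℝ B)
    (hBm : MeasurableSet B) {d : ℝ} (hd : ∀ x ∈ B, ∀ y ∈ B, ‖x - y‖ ≤ d) {v : Pt N → ℝ}
    {ω : Pt N → Pt N →L[ℝ] ℝ} (hω : Continuous ω) (hv : ∀ x ∈ B, HasFDerivAt v (ω x) x) :
    ∫⁻ x in B, ∫⁻ y in B, ‖v x - v y‖ₑ ^ 2 ≤
      ENNReal.ofReal d ^ 2 * (2 ^ N * volume B * ∫⁻ x in B, ‖ω x‖ₑ ^ 2) := by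
  -- The cut-off to `B` allows the substitution to run over the whole space while counting only the
  -- points of `B`; by convexity nothing is lost on segments.
  set f : Pt N → ℝ≥0∞ := B.indicator fun x => ‖ω x‖ₑ ^ 2 with hf
  have hfm : Measurable f := (hω.enorm.measurable.pow_const 2).indicator hBm
  have hfint : ∫⁻ x, f x = ∫⁻ x in B, ‖ω x‖ₑ ^ 2 := lintegral_indicator hBm _
  have hmeas1 : Measurable fun p : (Pt N × Pt N) × ℝ => f (p.1.2 + p.2 • (p.1.1 - p.1.2)) :=
    hfm.comp (by fun_prop)
  have key : ∀ t ∈ Ioc (0 : ℝ) 1, ∫⁻ x in B, ∫⁻ y in B, f (y + t • (x - y)) ≤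
      2 ^ N * volume B * ∫⁻ x, f x := by
    intro t ht
    -- The point `y + t (x - y)` has Jacobian `tᴺ` in `x` and `(1 - t)ᴺ` in `y`; the substitution is
    -- made in the variable whose factor is bounded below.
    rcases le_total (1 / 2) t with h | h
    · calc _ = ∫⁻ y in B, ∫⁻ x in B, f (y + t • (x - y)) := by
            rw [lintegral_lintegral_swap]
            exact (hfm.comp (by fun_prop :
              Measurable fun p : Pt N × Pt N => p.2 + t • (p.1 - p.2))).aemeasurable
        _ ≤ ∫⁻ y in B, 2 ^ N * ∫⁻ x, f x := by
            refine lintegral_mono fun y => ?_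
            calc _ ≤ ∫⁻ x, f (y + t • (x - y)) := setLIntegral_le_lintegral _ _
              _ = ∫⁻ x, f ((y - t • y) + t • x) := by
                  congr 1; ext x; congr 1; rw [smul_sub]; abel
              _ ≤ _ := lintegral_comp_affine_le hfm _ h
        _ = _ := by rw [setLIntegral_const]; ring
    · calc _ ≤ ∫⁻ x in B, 2 ^ N * ∫⁻ x, f x := by
            refine lintegral_mono fun x => ?_
            calc _ ≤ ∫⁻ y, f (y + t • (x - y)) := setLIntegral_le_lintegral _ _
              _ = ∫⁻ y, f (t • x + (1 - t) • y) := by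
                  congr 1; ext y; congr 1; rw [smul_sub, sub_smul, one_smul]; abel
              _ ≤ _ := lintegral_comp_affine_le hfm _ (by linarith)
        _ = _ := by rw [setLIntegral_const]; ring
  have hpt : ∀ x ∈ B, ∀ y ∈ B, ‖v x - v y‖ₑ ^ 2 ≤
      ENNReal.ofReal d ^ 2 * ∫⁻ t in Ioc (0 : ℝ) 1, f (y + t • (x - y)) := by
    intro x hx y hy
    refine (enorm_sub_sq_le_lintegral_segment hB hω hv hx hy).trans ?_
    gcongr ?_ ^ 2 * ?_
    · rw [← ofReal_norm]
      exact ENNReal.ofReal_le_ofReal (hd x hx y hy)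
    · refine (setLIntegral_congr_fun measurableSet_Ioc fun t ht => ?_).le
      rw [hf, indicator_of_mem (hB.add_smul_sub_mem hy hx ⟨ht.1.le, ht.2⟩)]
  calc ∫⁻ x in B, ∫⁻ y in B, ‖v x - v y‖ₑ ^ 2
      ≤ ∫⁻ x in B, ∫⁻ y in B, ENNReal.ofReal d ^ 2 *
          ∫⁻ t in Ioc (0 : ℝ) 1, f (y + t • (x - y)) :=
        setLIntegral_mono' hBm fun x hx => setLIntegral_mono' hBm fun y hy => hpt x hx y hy
    _ = ENNReal.ofReal d ^ 2 * ∫⁻ x in B, ∫⁻ y in B,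
          ∫⁻ t in Ioc (0 : ℝ) 1, f (y + t • (x - y)) := by
        rw [← lintegral_const_mul' _ _ (by finiteness)]
        refine lintegral_congr fun x => ?_
        rw [lintegral_const_mul' _ _ (by finiteness)]
    _ = ENNReal.ofReal d ^ 2 * ∫⁻ t in Ioc (0 : ℝ) 1, ∫⁻ x in B, ∫⁻ y in B,
          f (y + t • (x - y)) := by
        congr 1
        have hA : ∀ x : Pt N, ∫⁻ y in B, ∫⁻ t in Ioc (0 : ℝ) 1, f (y + t • (x - y)) =
            ∫⁻ t in Ioc (0 : ℝ) 1, ∫⁻ y in B, f (y + t • (x - y)) := fun x =>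
          lintegral_lintegral_swap (hfm.comp (by fun_prop :
            Measurable fun p : Pt N × ℝ => p.1 + p.2 • (x - p.1))).aemeasurable
        simp_rw [hA]
        refine lintegral_lintegral_swap (Measurable.aemeasurable ?_)
        have : Measurable fun q : (Pt N × ℝ) × Pt N => f (q.2 + q.1.2 • (q.1.1 - q.2)) :=
          hfm.comp (by fun_prop)
        exact this.lintegral_prod_right'
    _ ≤ ENNReal.ofReal d ^ 2 * ∫⁻ t in Ioc (0 : ℝ) 1, 2 ^ N * volume B * ∫⁻ x, f x := by
        exact mul_le_mul_right (setLIntegral_mono' measurableSet_Ioc key) _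
    _ = _ := by rw [setLIntegral_const, hfint]; simp

/-- The deviation from the mean is an average of differences `v x - v y`, so Jensen's inequality
reduces the claim to the double integral. -/
theorem eLpNorm_sub_average_le {B : Set (Pt N)} (hB : Convex ℝ B)
    (hBm : MeasurableSet B) (hB0 : volume B ≠ 0) (hBt : volume B ≠ ⊤)
    {d : ℝ} (hd : ∀ x ∈ B, ∀ y ∈ B, ‖x - y‖ ≤ d) {v : Pt N → ℝ}
    {ω : Pt N → Pt N →L[ℝ] ℝ} (hω : Continuous ω) (hv : ∀ x ∈ B, HasFDerivAt v (ω x) x)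
    (hint : IntegrableOn v B) :
    eLpNorm (fun x => v x - ⨍ y in B, v y) 2 (volume.restrict B) ≤
      ENNReal.ofReal d * 2 ^ N * eLpNorm ω 2 (volume.restrict B) := by
  let μ : Measure (Pt N) := (volume B)⁻¹ • volume.restrict B
  have hμ : IsProbabilityMeasure μ := ⟨by
    simp only [μ, Measure.smul_apply, Measure.restrict_apply_univ, smul_eq_mul]
    exact ENNReal.inv_mul_cancel hB0 hBt⟩
  have hav : ⨍ y in B, v y = ∫ y, v y ∂μ := by
    simp [average, μ]
  have hintμ : Integrable v μ := hint.smul_measure (by simp [hB0])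
  have hpt : ∀ x, ‖v x - ⨍ y in B, v y‖ₑ ^ 2 ≤ (volume B)⁻¹ * ∫⁻ y in B, ‖v x - v y‖ₑ ^ 2 := by
    intro x
    have h1 : v x - ⨍ y in B, v y = ∫ y, (v x - v y) ∂μ := by
      rw [integral_sub (integrable_const _) hintμ, hav]; simp
    have h2 : ‖v x - ⨍ y in B, v y‖ₑ ≤ eLpNorm (fun y => v x - v y) 1 μ := by
      rw [h1, eLpNorm_one_eq_lintegral_enorm]
      exact enorm_integral_le_lintegral_enorm _
    have h3 := h2.trans (eLpNorm_le_eLpNorm_of_exponent_le (p := 1) (q := 2) (by norm_num)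
      (aestronglyMeasurable_const.sub hintμ.1))
    calc _ ≤ eLpNorm (fun y => v x - v y) 2 μ ^ 2 := by gcongr
      _ = _ := by rw [eLpNorm_two_sq, lintegral_smul_measure, smul_eq_mul]
  have hsq : eLpNorm (fun x => v x - ⨍ y in B, v y) 2 (volume.restrict B) ^ 2 ≤
      (ENNReal.ofReal d * 2 ^ N * eLpNorm ω 2 (volume.restrict B)) ^ 2 := by
    rw [eLpNorm_two_sq]
    calc _ ≤ ∫⁻ x in B, (volume B)⁻¹ * ∫⁻ y in B, ‖v x - v y‖ₑ ^ 2 := lintegral_mono hpt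
      _ = (volume B)⁻¹ * ∫⁻ x in B, ∫⁻ y in B, ‖v x - v y‖ₑ ^ 2 :=
          lintegral_const_mul' _ _ (by simp [hB0])
      _ ≤ (volume B)⁻¹ *
          (ENNReal.ofReal d ^ 2 * (2 ^ N * volume B * ∫⁻ x in B, ‖ω x‖ₑ ^ 2)) := by
          gcongr
          exact lintegral_lintegral_enorm_sub_sq_le hB hBm hd hω hv
      _ = ((volume B)⁻¹ * volume B) *
          (ENNReal.ofReal d ^ 2 * (2 ^ N * ∫⁻ x in B, ‖ω x‖ₑ ^ 2)) := by ring
      _ = ENNReal.ofReal d ^ 2 * (2 ^ N * eLpNorm ω 2 (volume.restrict B) ^ 2) := by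
          rw [ENNReal.inv_mul_cancel hB0 hBt, one_mul, eLpNorm_two_sq]
      -- The factor `2 ^ N` is enlarged to its square only to obtain a perfect square.
      _ ≤ ENNReal.ofReal d ^ 2 * ((2 ^ N) ^ 2 * eLpNorm ω 2 (volume.restrict B) ^ 2) := by
          refine mul_le_mul_right (mul_le_mul_left (le_self_pow ?_ two_ne_zero) _) _
          exact one_le_pow₀ (by norm_num)
      _ = _ := by ring
  exact (ENNReal.pow_le_pow_left_iff (by norm_num)).1 hsq

/-! ### Weak gradients and curl-free fields of functions -/

/-- `g` is the weak gradient of `u` in `U`. -/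
def WGrad (U : Set (Pt N)) (u : Pt N → ℝ) (g : Pt N → Pt N) : Prop :=
  ∀ (k : Fin N) (φ : Pt N → ℝ), IsTest U φ →
    ∫ x in U, g x k * φ x = - ∫ x in U, u x * pd k φ x

/-- The vector field `g` is weakly curl-free in `U`. -/
def CurlFree (U : Set (Pt N)) (g : Pt N → Pt N) : Prop :=
  ∀ (i j : Fin N) (φ : Pt N → ℝ), IsTest U φ →
    ∫ x in U, g x j * pd i φ x = ∫ x in U, g x i * pd j φ x

/-- `u` and `g` are limits in `L²(B)` of `C¹` functions and their gradients. -/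
def GradApprox (B : Set (Pt N)) (u : Pt N → ℝ) (g : Pt N → Pt N) : Prop :=
  ∃ v : ℕ → Pt N → ℝ, (∀ n, ContDiff ℝ 1 (v n)) ∧
    Tendsto (fun n => eLpNorm (fun x => v n x - u x) 2 (volume.restrict B)) atTop (𝓝 0) ∧
    ∀ k, Tendsto (fun n => eLpNorm (fun x => pd k (v n) x - g x k) 2 (volume.restrict B))
      atTop (𝓝 0)

theorem IsTest.mono {V : Type} [NormedAddCommGroup V] [NormedSpace ℝ V] {U W : Set (Pt N)}
    {φ : Pt N → V} (h : IsTest U φ) (hUW : U ⊆ W) : IsTest W φ :=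
  ⟨h.1, h.2.1, h.2.2.trans hUW⟩

theorem IsTest.eq_zero {V : Type} [NormedAddCommGroup V] [NormedSpace ℝ V] {U : Set (Pt N)}
    {φ : Pt N → V} (h : IsTest U φ) {x : Pt N} (hx : x ∉ U) : φ x = 0 :=
  image_eq_zero_of_notMem_tsupport fun h' => hx (h.2.2 h')

theorem tsupport_pd_subset {V : Type} [NormedAddCommGroup V] [NormedSpace ℝ V] (k : Fin N)
    (φ : Pt N → V) : tsupport (pd k φ) ⊆ tsupport φ :=
  tsupport_fderiv_apply_subset ℝ _

theorem contDiff_pd {V : Type} [NormedAddCommGroup V] [NormedSpace ℝ V] {k : Fin N}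
    {φ : Pt N → V} (h : ContDiff ℝ (⊤ : ℕ∞) φ) : ContDiff ℝ (⊤ : ℕ∞) (pd k φ) :=
  (h.fderiv_right (m := (⊤ : ℕ∞)) (by simp)).clm_apply contDiff_const

theorem IsTest.pd {V : Type} [NormedAddCommGroup V] [NormedSpace ℝ V] {U : Set (Pt N)}
    {φ : Pt N → V} (h : IsTest U φ) (k : Fin N) : IsTest U (pd k φ) :=
  ⟨contDiff_pd h.1, h.2.1.mono' ((subset_tsupport _).trans (tsupport_pd_subset k φ)),
    (tsupport_pd_subset k φ).trans h.2.2⟩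

theorem IsTest.memLp {V : Type} [NormedAddCommGroup V] [NormedSpace ℝ V] {U : Set (Pt N)}
    {φ : Pt N → V} (h : IsTest U φ) (p : ℝ≥0∞) (s : Set (Pt N)) :
    MemLp φ p (volume.restrict s) :=
  (h.1.continuous.memLp_of_hasCompactSupport h.2.1).restrict s

theorem setIntegral_eq_of_eq_zero {U W : Set (Pt N)} (hUW : U ⊆ W)
    {f : Pt N → ℝ} (hf : ∀ x, x ∉ U → f x = 0) : ∫ x in W, f x = ∫ x in U, f x := by
  rw [setIntegral_eq_integral_of_forall_compl_eq_zero hf,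
    setIntegral_eq_integral_of_forall_compl_eq_zero fun x hx => hf x fun h => hx (hUW h)]

theorem WGrad.mono {U W : Set (Pt N)} {u : Pt N → ℝ} {g : Pt N → Pt N} (h : WGrad W u g)
    (hUW : U ⊆ W) : WGrad U u g := by
  intro k φ hφ
  have := h k φ (hφ.mono hUW)
  rwa [setIntegral_eq_of_eq_zero hUW fun x hx => by rw [hφ.eq_zero hx, mul_zero],
    setIntegral_eq_of_eq_zero hUW fun x hx => by rw [(hφ.pd k).eq_zero hx, mul_zero]] at this

theorem CurlFree.mono {U W : Set (Pt N)} {g : Pt N → Pt N} (h : CurlFree W g)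
    (hUW : U ⊆ W) : CurlFree U g := by
  intro i j φ hφ
  have := h i j φ (hφ.mono hUW)
  rwa [setIntegral_eq_of_eq_zero hUW fun x hx => by rw [(hφ.pd i).eq_zero hx, mul_zero],
    setIntegral_eq_of_eq_zero hUW fun x hx => by rw [(hφ.pd j).eq_zero hx, mul_zero]] at this

/-- The reflected and translated mollifier. -/
def mollAt (n : ℕ) (x : Pt N) (y : Pt N) : ℝ := (moll N n).normed volume (x - y)

/-- The kernel around `x` has radius `1/(n+1)`, so it fits into the larger ball. Weak identities
tested with it therefore become exact identities for mollifications on the smaller ball. -/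
theorem isTest_mollAt {n : ℕ} {a x : Pt N} {r r' : ℝ} (hx : x ∈ Metric.ball a r)
    (hn : 1 / ((n : ℝ) + 1) ≤ r' - r) : IsTest (Metric.ball a r') (mollAt n x) := by
  have hts : tsupport (mollAt n x) ⊆ Metric.closedBall x (1 / ((n : ℝ) + 1)) := by
    refine closure_minimal ?_ Metric.isClosed_closedBall
    intro y hy
    have : x - y ∈ Function.support ((moll N n).normed (volume : Measure (Pt N))) := hy
    rw [(moll N n).support_normed_eq, mem_ball_zero_iff] at this
    rw [Metric.mem_closedBall, dist_comm, dist_eq_norm]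
    exact this.le
  refine ⟨(contDiff_normed n).comp (contDiff_const.sub contDiff_id),
    HasCompactSupport.of_support_subset_isCompact (isCompact_closedBall x _)
      ((subset_tsupport _).trans hts), hts.trans fun y hy => ?_⟩
  rw [Metric.mem_closedBall] at hy
  rw [Metric.mem_ball] at hx ⊢
  linarith [dist_triangle y x a]

theorem pd_mollAt (n : ℕ) (x y : Pt N) (k : Fin N) :
    pd k (mollAt n x) y = - pd k ((moll N n).normed volume) (x - y) := by
  have h1 : DifferentiableAt ℝ ((moll N n).normed (volume : Measure (Pt N))) (x - y) :=
    (contDiff_normed n).contDiffAt.differentiableAt (by simp)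
  have h2 : HasFDerivAt (fun y : Pt N => x - y) (-ContinuousLinearMap.id ℝ (Pt N)) y := by
    simpa using (hasFDerivAt_id y).const_sub x
  have := (h1.hasFDerivAt.comp y h2).fderiv
  rw [pd, pd]
  change fderiv ℝ ((moll N n).normed volume ∘ fun y => x - y) y _ = _
  rw [this]
  simp

theorem mollify_indicator {B : Set (Pt N)} (hB : MeasurableSet B) (n : ℕ) (g : Pt N → ℝ)
    (x : Pt N) : mollify n (B.indicator g) x = ∫ y in B, g y * mollAt n x y := by
  rw [← integral_indicator hB]
  change ∫ y, B.indicator g y * mollAt n x y = _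
  congr 1; ext y
  by_cases hy : y ∈ B <;> simp [hy]

theorem pd_mollify_indicator {B : Set (Pt N)} (hB : MeasurableSet B) (n : ℕ) {g : Pt N → ℝ}
    (hg : MemLp g 2 (volume.restrict B)) (k : Fin N) (x : Pt N) :
    pd k (mollify n (B.indicator g)) x = - ∫ y in B, g y * pd k (mollAt n x) y := by
  have hG : MemLp (B.indicator g) 2 volume := (memLp_indicator_iff_restrict hB).2 hg
  rw [pd_mollify n (hG.locallyIntegrable (by norm_num)), ← integral_neg, ← integral_indicator hB]
  congr 1; ext y
  by_cases hy : y ∈ B <;> simp [hy, pd_mollAt]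

theorem tendsto_mollify_indicator {B B' : Set (Pt N)} (hB : MeasurableSet B) (hBB : B' ⊆ B)
    {g : Pt N → ℝ} (hg : MemLp g 2 (volume.restrict B)) :
    Tendsto (fun n => eLpNorm (fun x => mollify n (B.indicator g) x - g x) 2 (volume.restrict B'))
      atTop (𝓝 0) := by
  have hG : MemLp (B.indicator g) 2 volume := (memLp_indicator_iff_restrict hB).2 hg
  refine tendsto_of_tendsto_of_tendsto_of_le_of_le tendsto_const_nhds (tendsto_mollify hG)
    (fun n => zero_le) fun n => ?_
  calc _ ≤ eLpNorm (fun x => mollify n (B.indicator g) x - g x) 2 (volume.restrict B) :=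
        eLpNorm_mono_measure _ (Measure.restrict_mono hBB le_rfl)
    _ = eLpNorm (fun x => mollify n (B.indicator g) x - B.indicator g x) 2 (volume.restrict B) := by
        refine eLpNorm_congr_ae ?_
        filter_upwards [ae_restrict_mem hB] with x hx
        simp [hx]
    _ ≤ _ := eLpNorm_mono_measure _ Measure.restrict_le_self

theorem eventually_one_div_le {δ : ℝ} (hδ : 0 < δ) : ∀ᶠ n : ℕ in atTop, 1 / ((n : ℝ) + 1) ≤ δ :=
  ((tendsto_one_div_add_atTop_nhds_zero_nat (𝕜 := ℝ)).eventually (gt_mem_nhds hδ)).mono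
    fun _ h => h.le

theorem MemLp.coord {ι α : Type*} [Fintype ι] [MeasurableSpace α] {μ : Measure α} {p : ℝ≥0∞}
    {g : α → EuclideanSpace ℝ ι} (hg : MemLp g p μ) (k : ι) : MemLp (fun x => g x k) p μ :=
  (EuclideanSpace.proj k : EuclideanSpace ℝ ι →L[ℝ] ℝ).comp_memLp' hg

/-- For large `n` the gradient of the mollification equals the mollification of the weak gradient on
the smaller ball. -/
theorem WGrad.gradApprox {a : Pt N} {r r' : ℝ} (hr : r < r') {u : Pt N → ℝ} {g : Pt N → Pt N}
    (hu : MemLp u 2 (volume.restrict (Metric.ball a r')))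
    (hg : MemLp g 2 (volume.restrict (Metric.ball a r')))
    (h : WGrad (Metric.ball a r') u g) : GradApprox (Metric.ball a r) u g := by
  set B := Metric.ball a r'
  have hB : MeasurableSet B := measurableSet_ball
  have hsub : Metric.ball a r ⊆ B := Metric.ball_subset_ball hr.le
  have hU : LocallyIntegrable (B.indicator u) volume :=
    ((memLp_indicator_iff_restrict hB).2 hu).locallyIntegrable (by norm_num)
  refine ⟨fun n => mollify n (B.indicator u), fun n => (contDiff_mollify n hU).of_le
    (by exact_mod_cast le_top), tendsto_mollify_indicator hB hsub hu, fun k => ?_⟩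
  refine (tendsto_mollify_indicator hB hsub (MemLp.coord hg k)).congr' ?_
  filter_upwards [eventually_one_div_le (sub_pos.2 hr)] with n hn
  refine eLpNorm_congr_ae ?_
  filter_upwards [ae_restrict_mem measurableSet_ball] with x hx
  rw [pd_mollify_indicator hB n hu, mollify_indicator hB, h k _ (isTest_mollAt hx hn)]

theorem CurlFree.pd_mollify_eq {a : Pt N} {r r' : ℝ} {g : Pt N → Pt N}
    (hg : MemLp g 2 (volume.restrict (Metric.ball a r')))
    (h : CurlFree (Metric.ball a r') g) {n : ℕ} (hn : 1 / ((n : ℝ) + 1) ≤ r' - r) {x : Pt N}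
    (hx : x ∈ Metric.ball a r) (i j : Fin N) :
    pd i (mollify n ((Metric.ball a r').indicator fun y => g y j)) x =
      pd j (mollify n ((Metric.ball a r').indicator fun y => g y i)) x := by
  rw [pd_mollify_indicator measurableSet_ball n (MemLp.coord hg j),
    pd_mollify_indicator measurableSet_ball n (MemLp.coord hg i),
    h i j _ (isTest_mollAt hx hn)]

theorem enorm_clm_le_sum (L : Pt N →L[ℝ] ℝ) :
    ‖L‖ₑ ≤ ∑ k, ‖L (EuclideanSpace.single k 1)‖ₑ := by
  have h : ‖L‖ ≤ ∑ k, ‖L (EuclideanSpace.single k 1)‖ := by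
    refine L.opNorm_le_bound (by positivity) fun x => ?_
    have hx : L x = ∑ k, x k * L (EuclideanSpace.single k 1) := by
      conv_lhs => rw [← (EuclideanSpace.basisFun (Fin N) ℝ).sum_repr x]
      simp
    rw [hx, Finset.sum_mul]
    refine (norm_sum_le _ _).trans (Finset.sum_le_sum fun k _ => ?_)
    rw [norm_mul, mul_comm]
    gcongr
    exact PiLp.norm_apply_le x k
  simp_rw [← ofReal_norm]
  rw [← ENNReal.ofReal_sum_of_nonneg fun _ _ => norm_nonneg _]
  exact ENNReal.ofReal_le_ofReal h

theorem eLpNorm_clm_le_sum {ω : Pt N → Pt N →L[ℝ] ℝ} {μ : Measure (Pt N)}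
    (hω : Continuous ω) : eLpNorm ω 2 μ ≤
      ∑ k, eLpNorm (fun x => ω x (EuclideanSpace.single k 1)) 2 μ := by
  calc eLpNorm ω 2 μ ≤ eLpNorm (fun x => ∑ k, ‖ω x (EuclideanSpace.single k 1)‖) 2 μ := by
        refine eLpNorm_mono_enorm fun x => (enorm_clm_le_sum (ω x)).trans_eq ?_
        rw [Real.enorm_of_nonneg (by positivity),
          ENNReal.ofReal_sum_of_nonneg fun _ _ => norm_nonneg _]
        simp_rw [ofReal_norm]
    _ ≤ ∑ k, eLpNorm (fun x => ‖ω x (EuclideanSpace.single k 1)‖) 2 μ := by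
        have := eLpNorm_sum_le (μ := μ) (p := 2) (s := Finset.univ)
          (f := fun (k : Fin N) x => ‖ω x (EuclideanSpace.single k 1)‖)
          (fun k _ => ((hω.clm_apply continuous_const).norm).aestronglyMeasurable) (by norm_num)
        convert this using 2
        ext x; simp
    _ = _ := by simp_rw [eLpNorm_norm]

theorem eLpNorm_sub_average_ball_le {a : Pt N} {r : ℝ} (hr : 0 < r) {v : Pt N → ℝ}
    {ω : Pt N → Pt N →L[ℝ] ℝ} (hω : Continuous ω)
    (hv : ∀ x ∈ Metric.ball a r, HasFDerivAt v (ω x) x) (hint : IntegrableOn v (Metric.ball a r)) :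
    eLpNorm (fun x => v x - ⨍ y in Metric.ball a r, v y) 2 (volume.restrict (Metric.ball a r)) ≤
      ENNReal.ofReal (2 * r) * 2 ^ N * ∑ k, eLpNorm (fun x => ω x (EuclideanSpace.single k 1)) 2
        (volume.restrict (Metric.ball a r)) := by
  refine (eLpNorm_sub_average_le (d := 2 * r) (convex_ball a r) measurableSet_ball
    (Metric.measure_ball_pos _ _ hr).ne' measure_ball_lt_top.ne (fun x hx y hy => ?_) hω hv
    hint).trans ?_
  · rw [Metric.mem_ball] at hx hy
    rw [← dist_eq_norm]
    linarith [dist_triangle_right x y a]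
  · gcongr
    exact eLpNorm_clm_le_sum hω

theorem memLp_ball_of_continuousOn {a : Pt N} {r : ℝ} {v : Pt N → ℝ}
    (hv : ContinuousOn v (Metric.closedBall a r)) (p : ℝ≥0∞) :
    MemLp v p (volume.restrict (Metric.ball a r)) := by
  have hfin : IsFiniteMeasure (volume.restrict (Metric.ball a r)) :=
    ⟨by simpa using measure_ball_lt_top⟩
  obtain ⟨C, hC⟩ := (isCompact_closedBall a r).exists_bound_of_continuousOn hv
  refine MemLp.of_bound ((hv.mono Metric.ball_subset_closedBall).aestronglyMeasurable
    measurableSet_ball) C ?_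
  filter_upwards [ae_restrict_mem measurableSet_ball] with x hx
  exact hC x (Metric.ball_subset_closedBall hx)

/-- By Poincaré's inequality the approximants minus their means tend to zero. The means, as constant
functions, thus converge to `u` in `L²`, and the constants form a finite-dimensional, hence closed,
subspace. -/
theorem GradApprox.ae_const {a : Pt N} {r : ℝ} (hr : 0 < r) {u : Pt N → ℝ}
    (hu : MemLp u 2 (volume.restrict (Metric.ball a r)))
    (h : GradApprox (Metric.ball a r) u 0) :
    ∃ c : ℝ, ∀ᵐ x ∂volume.restrict (Metric.ball a r), u x = c := by
  obtain ⟨v, hv, hvu, hg⟩ := h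
  set μ := volume.restrict (Metric.ball a r) with hμ
  have hfin : IsFiniteMeasure μ := ⟨by simpa [μ] using measure_ball_lt_top⟩
  have hvm : ∀ n, MemLp (v n) 2 μ := fun n =>
    memLp_ball_of_continuousOn (hv n).continuous.continuousOn 2
  let c : ℕ → ℝ := fun n => ⨍ y in Metric.ball a r, v n y
  have h1 : Tendsto (fun n => eLpNorm (fun x => v n x - c n) 2 μ) atTop (𝓝 0) := by
    have h2 : Tendsto (fun n => ENNReal.ofReal (2 * r) * 2 ^ N *
        ∑ k, eLpNorm (fun x => pd k (v n) x - (0 : Pt N → Pt N) x k) 2 μ) atTop (𝓝 0) := by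
      have := ENNReal.Tendsto.const_mul (a := ENNReal.ofReal (2 * r) * 2 ^ N)
        (tendsto_finsetSum Finset.univ fun k _ => hg k)
        (Or.inr (by finiteness))
      simpa using this
    refine tendsto_of_tendsto_of_tendsto_of_le_of_le tendsto_const_nhds h2
      (fun n => zero_le) fun n => ?_
    simp only [Pi.zero_apply, PiLp.zero_apply, sub_zero]
    exact eLpNorm_sub_average_ball_le hr ((hv n).continuous_fderiv one_ne_zero)
      (fun x _ => ((hv n).differentiable one_ne_zero x).hasFDerivAt)
      ((hvm n).integrable (by norm_num))
  have h3 : Tendsto (fun n => Lp.const 2 μ (c n)) atTop (𝓝 (hu.toLp u)) := by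
    rw [tendsto_iff_edist_tendsto_0]
    refine tendsto_of_tendsto_of_tendsto_of_le_of_le tendsto_const_nhds
      (by simpa using h1.add hvu) (fun n => zero_le) fun n => ?_
    have hcl : Lp.const 2 μ (c n) = (memLp_const (c n)).toLp (fun _ => c n) := rfl
    rw [hcl, Lp.edist_toLp_toLp]
    calc eLpNorm ((fun _ => c n) - u) 2 μ
        = eLpNorm ((fun x => v n x - u x) - fun x => v n x - c n) 2 μ := by
          congr 1; ext x; simp
      _ ≤ _ := (eLpNorm_sub_le ((hvm n).sub hu).1 ((hvm n).sub (memLp_const _)).1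
          (by norm_num)).trans_eq (add_comm _ _)
  have hclosed : IsClosed ((LinearMap.range (Lp.constL 2 μ ℝ : ℝ →L[ℝ] Lp ℝ 2 μ).toLinearMap :
      Submodule ℝ (Lp ℝ 2 μ)) : Set (Lp ℝ 2 μ)) := Submodule.closed_of_finiteDimensional _
  obtain ⟨d, hd⟩ := hclosed.mem_of_tendsto h3 (Eventually.of_forall fun n => ⟨c n, rfl⟩)
  refine ⟨d, ?_⟩
  have h5 : hu.toLp u = Lp.const 2 μ d := hd.symm
  have h6 := hu.coeFn_toLp
  rw [h5] at h6
  filter_upwards [h6, Lp.coeFn_const 2 μ d] with x hx hx'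
  rw [← hx, hx', Function.const_apply]

/-- The mollified field is smooth with symmetric derivative, so it has a primitive on a convex set.
Primitives normalised to mean zero are a Cauchy sequence in `L²` by Poincaré's inequality, because
their gradients converge. -/
theorem exists_gradApprox {a : Pt N} {r r' : ℝ} (hr0 : 0 < r) (hr : r < r') {g : Pt N → Pt N}
    (hg : MemLp g 2 (volume.restrict (Metric.ball a r')))
    (h : CurlFree (Metric.ball a r') g) :
    ∃ u, MemLp u 2 (volume.restrict (Metric.ball a r)) ∧ GradApprox (Metric.ball a r) u g := by
  -- Radii `r < r₂ < r₁ < r'`: mollification is exact and primitives exist on the ball of radius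
  -- `r₁`, and a cut-off will live inside radius `r₂`.
  obtain ⟨r₁, hr₁, hr₁'⟩ := exists_between hr
  obtain ⟨r₂, hr₂, hr₂'⟩ := exists_between hr₁
  set B := Metric.ball a r
  set B' := Metric.ball a r'
  set μ := volume.restrict B with hμ
  have hfin : IsFiniteMeasure μ := ⟨by simpa [μ] using measure_ball_lt_top⟩
  have hsub : B ⊆ B' := Metric.ball_subset_ball hr.le
  let m : ℕ → Fin N → Pt N → ℝ := fun n k => mollify n (B'.indicator fun y => g y k)
  have hm : ∀ n k, ContDiff ℝ (⊤ : ℕ∞) (m n k) := fun n k => contDiff_mollify n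
    (((memLp_indicator_iff_restrict measurableSet_ball).2 (MemLp.coord hg k)).locallyIntegrable
      (by norm_num))
  let ω : ℕ → Pt N → Pt N →L[ℝ] ℝ := fun n x =>
    ∑ k, m n k x • (EuclideanSpace.proj k : Pt N →L[ℝ] ℝ)
  have hω : ∀ n, ContDiff ℝ (⊤ : ℕ∞) (ω n) := fun n =>
    ContDiff.sum fun k _ => (hm n k).smul contDiff_const
  have hω1 : ∀ n x k, ω n x (EuclideanSpace.single k 1) = m n k x := by
    intro n x k
    simp [ω]
  have hωd : ∀ n x (y z : Pt N), fderiv ℝ (ω n) x y z = ∑ k, ∑ l, y l * z k * pd l (m n k) x := by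
    intro n x y z
    have h1 : HasFDerivAt (ω n) (∑ k, (fderiv ℝ (m n k) x).smulRight
        (EuclideanSpace.proj k : Pt N →L[ℝ] ℝ)) x :=
      HasFDerivAt.fun_sum fun k _ =>
        HasFDerivAt.smul_const ((hm n k).differentiable (by simp) x).hasFDerivAt
          (EuclideanSpace.proj k : Pt N →L[ℝ] ℝ)
    have hy : ∀ k, fderiv ℝ (m n k) x y = ∑ l, y l * pd l (m n k) x := by
      intro k
      conv_lhs => rw [← (EuclideanSpace.basisFun (Fin N) ℝ).sum_repr y]
      simp [pd]
    rw [h1.fderiv]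
    simp only [sum_apply, ContinuousLinearMap.smulRight_apply,
      smul_apply, PiLp.proj_apply, smul_eq_mul, hy, Finset.sum_mul]
    exact Finset.sum_congr rfl fun k _ => Finset.sum_congr rfl fun l _ => by ring
  -- From `n₀` on the kernels are small enough; the sequences are shifted by `n₀` so that every term
  -- has a primitive.
  obtain ⟨n₀, hn₀⟩ := eventually_atTop.1 (eventually_one_div_le (sub_pos.2 hr₁'))
  have hpot : ∀ n, ∃ f : Pt N → ℝ, ∀ x ∈ Metric.ball a r₁, HasFDerivAt f (ω (n + n₀) x) x := by
    intro n
    refine (convex_ball a r₁).exists_forall_hasFDerivAt_of_fderiv_symmetric Metric.isOpen_ball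
      ((hω _).differentiable (by simp)).differentiableOn fun x hx y z => ?_
    rw [hωd, hωd, Finset.sum_comm]
    refine Finset.sum_congr rfl fun k _ => Finset.sum_congr rfl fun l _ => ?_
    rw [h.pd_mollify_eq hg (hn₀ (n + n₀) (by omega)) hx k l]
    ring
  choose f hf using hpot
  have hBsub : Metric.closedBall a r ⊆ Metric.ball a r₁ := Metric.closedBall_subset_ball hr₁
  have hBsub' : B ⊆ Metric.ball a r₁ := Metric.ball_subset_closedBall.trans hBsub
  have hfm : ∀ n, MemLp (f n) 2 μ := fun n => memLp_ball_of_continuousOn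
    (fun x hx => (hf n x (hBsub hx)).continuousAt.continuousWithinAt) 2
  let w : ℕ → Pt N → ℝ := fun n x => f n x - ⨍ y in B, f n y
  have hwm : ∀ n, MemLp (w n) 2 μ := fun n => (hfm n).sub (memLp_const _)
  let e : ℕ → ℝ≥0∞ := fun n => ENNReal.ofReal (2 * r) * 2 ^ N *
    ∑ k, eLpNorm (fun x => m (n + n₀) k x - g x k) 2 μ
  have hmt : ∀ k, Tendsto (fun n => eLpNorm (fun x => m (n + n₀) k x - g x k) 2 μ) atTop (𝓝 0) :=
    fun k => (tendsto_mollify_indicator measurableSet_ball hsub (MemLp.coord hg k)).comp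
      (tendsto_add_atTop_nat n₀)
  have he : Tendsto e atTop (𝓝 0) := by
    have := ENNReal.Tendsto.const_mul (a := ENNReal.ofReal (2 * r) * 2 ^ N)
      (tendsto_finsetSum Finset.univ fun k _ => hmt k) (Or.inr (by finiteness))
    simpa only [Finset.sum_const_zero, mul_zero] using this
  have hgm : ∀ k, AEStronglyMeasurable (fun x => g x k) μ := fun k =>
    ((MemLp.coord hg k).mono_measure (Measure.restrict_mono hsub le_rfl)).1
  have hww : ∀ n p, eLpNorm (w n - w p) 2 μ ≤ e n + e p := by
    intro n p
    have h1 := eLpNorm_sub_average_ball_le hr0 (v := fun x => f n x - f p x)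
      (ω := fun x => ω (n + n₀) x - ω (p + n₀) x)
      ((hω _).continuous.sub (hω _).continuous)
      (fun x hx => (hf n x (hBsub' hx)).sub (hf p x (hBsub' hx)))
      (((hfm n).sub (hfm p)).integrable (by norm_num))
    have h2 : (w n - w p) = fun x => (f n x - f p x) - ⨍ y in B, (f n y - f p y) := by
      ext x
      have : ⨍ y in B, (f n y - f p y) = (⨍ y in B, f n y) - ⨍ y in B, f p y := by
        simp only [setAverage_eq]
        rw [integral_sub ((hfm n).integrable (by norm_num)) ((hfm p).integrable (by norm_num)),
          smul_sub]
      simp only [Pi.sub_apply, w, this]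
      ring
    rw [h2]
    refine h1.trans ?_
    simp only [e]
    rw [← mul_add, ← Finset.sum_add_distrib]
    gcongr with k
    simp only [sub_apply, hω1]
    calc _ = eLpNorm ((fun x => m (n + n₀) k x - g x k) - fun x => m (p + n₀) k x - g x k) 2 μ := by
          congr 1; ext x; simp
      _ ≤ _ := eLpNorm_sub_le ((hm _ k).continuous.aestronglyMeasurable.sub (hgm k))
          ((hm _ k).continuous.aestronglyMeasurable.sub (hgm k)) (by norm_num)
  have hcau : CauchySeq fun n => (hwm n).toLp (w n) := by
    rw [EMetric.cauchySeq_iff]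
    intro ε hε
    obtain ⟨M, hM⟩ := eventually_atTop.1 (he.eventually (gt_mem_nhds (ENNReal.half_pos hε.ne')))
    refine ⟨M, fun n hn p hp => ?_⟩
    rw [Lp.edist_toLp_toLp]
    calc _ ≤ e n + e p := hww n p
      _ < ε / 2 + ε / 2 := ENNReal.add_lt_add (hM n hn) (hM p hp)
      _ = ε := ENNReal.add_halves ε
  obtain ⟨u, hu⟩ := cauchySeq_tendsto_of_complete hcau
  -- The primitives are controlled only near the ball, whereas `GradApprox` asks for functions of
  -- class `C¹` everywhere; the cut-off equals one on the ball and leaves values and gradients there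
  -- unchanged.
  let χ : ContDiffBump a := ⟨r, r₂, hr0, hr₂⟩
  refine ⟨u, Lp.memLp u, fun n x => χ x * w n x, fun n => ?_, ?_, fun k => ?_⟩
  · rw [contDiff_iff_contDiffAt]
    intro x
    by_cases hx : x ∈ Metric.ball a r₁
    · refine χ.contDiff.contDiffAt.mul (ContDiffAt.sub ?_ contDiffAt_const)
      have : ContDiffOn ℝ 1 (f n) (Metric.ball a r₁) := by
        rw [show (1 : WithTop ℕ∞) = 0 + 1 by rfl, contDiffOn_succ_iff_fderiv_of_isOpen
          Metric.isOpen_ball]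
        refine ⟨fun x hx => (hf n x hx).differentiableAt.differentiableWithinAt, by simp, ?_⟩
        rw [contDiffOn_zero]
        exact (hω (n + n₀)).continuous.continuousOn.congr fun x hx => (hf n x hx).fderiv
      exact this.contDiffAt (Metric.isOpen_ball.mem_nhds hx)
    · have hz : (fun x => χ x * w n x) =ᶠ[𝓝 x] fun _ => 0 := by
        have : x ∈ (Metric.closedBall a r₂)ᶜ := fun h' =>
          hx (Metric.closedBall_subset_ball hr₂' h')
        filter_upwards [Metric.isClosed_closedBall.isOpen_compl.mem_nhds this] with y hy
        rw [χ.zero_of_le_dist, zero_mul]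
        simp only [mem_compl_iff, Metric.mem_closedBall, not_le] at hy
        exact hy.le
      exact contDiffAt_const.congr_of_eventuallyEq hz
  · rw [tendsto_iff_edist_tendsto_0] at hu
    refine hu.congr fun n => ?_
    rw [Lp.edist_def]
    refine eLpNorm_congr_ae ?_
    filter_upwards [(hwm n).coeFn_toLp, ae_restrict_mem measurableSet_ball] with x hx hxB
    rw [Pi.sub_apply, hx, χ.one_of_mem_closedBall (Metric.ball_subset_closedBall hxB), one_mul]
  · refine (hmt k).congr fun n => eLpNorm_congr_ae ?_
    filter_upwards [ae_restrict_mem measurableSet_ball] with x hx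
    congr 1
    have hloc : (fun x => χ x * w n x) =ᶠ[𝓝 x] w n := by
      filter_upwards [Metric.isOpen_ball.mem_nhds hx] with y hy
      rw [χ.one_of_mem_closedBall (Metric.ball_subset_closedBall hy), one_mul]
    rw [pd, hloc.fderiv_eq, ((hf n x (hBsub' hx)).sub_const _).fderiv, hω1]

/-! ### Chain rule, locality and uniqueness for weak gradients -/

theorem integral_mul_pd {f φ : Pt N → ℝ} (hf : ContDiff ℝ 1 f) (hφ : ContDiff ℝ 1 φ)
    (hc : HasCompactSupport φ) (k : Fin N) :
    ∫ x, f x * pd k φ x = - ∫ x, pd k f x * φ x := by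
  have hpf : Continuous (pd k f) := (hf.continuous_fderiv one_ne_zero).clm_apply continuous_const
  have hpφ : Continuous (pd k φ) := (hφ.continuous_fderiv one_ne_zero).clm_apply continuous_const
  have hpc : HasCompactSupport (pd k φ) :=
    hc.mono' ((subset_tsupport _).trans (tsupport_pd_subset k φ))
  exact integral_mul_fderiv_eq_neg_fderiv_mul_of_integrable
    ((hpf.mul hφ.continuous).integrable_of_hasCompactSupport hc.mul_left)
    ((hf.continuous.mul hpφ).integrable_of_hasCompactSupport hpc.mul_left)
    ((hf.continuous.mul hφ.continuous).integrable_of_hasCompactSupport hc.mul_left)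
    (fun x _ => hf.differentiable one_ne_zero x) (fun x _ => hφ.differentiable one_ne_zero x)

theorem eLpNorm_one_mul_le {α : Type*} [MeasurableSpace α] {μ : Measure α} {f g : α → ℝ}
    (hf : AEStronglyMeasurable f μ) (hg : AEStronglyMeasurable g μ) :
    eLpNorm (fun x => f x * g x) 1 μ ≤ eLpNorm f 2 μ * eLpNorm g 2 μ := by
  have := eLpNorm_smul_le_mul_eLpNorm (p := 2) (q := 2) (r := 1) hg hf
  exact this

/-- The classical chain rule holds for the approximants. In the limit the error splits into a
bounded factor times the error of the gradients, and a Lipschitz-controlled factor times a fixed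
square-integrable function; this is where the two bounds on `deriv f` enter. -/
theorem GradApprox.wGrad_comp {B : Set (Pt N)} {u : Pt N → ℝ}
    {g : Pt N → Pt N} (hu : MemLp u 2 (volume.restrict B)) (hg : MemLp g 2 (volume.restrict B))
    (h : GradApprox B u g) {f : ℝ → ℝ} (hf : ContDiff ℝ 1 f) (h1 : ∀ t, |deriv f t| ≤ 1)
    (hL : ∀ s t, |deriv f s - deriv f t| ≤ |s - t|) :
    WGrad B (fun x => f (u x)) (fun x => deriv f (u x) • g x) := by
  intro k φ hφ
  obtain ⟨v, hv, hvu, hvg⟩ := h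
  set μ := volume.restrict B with hμ
  have hdf : Continuous (deriv f) := hf.continuous_deriv (le_refl _)
  have hfL : ∀ s t, |f s - f t| ≤ |s - t| := by
    intro s t
    have := Convex.norm_image_sub_le_of_norm_deriv_le (f := f) (s := univ) (x := t) (y := s) (C := 1)
      (fun x _ => hf.differentiable one_ne_zero x) (fun x _ => h1 x) convex_univ trivial trivial
    simpa using this
  have hpv : ∀ n, Continuous (pd k (v n)) := fun n =>
    ((hv n).continuous_fderiv one_ne_zero).clm_apply continuous_const
  have hgk : MemLp (fun x => g x k) 2 μ := MemLp.coord hg k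
  have hφ2 : MemLp φ 2 μ := hφ.memLp 2 B
  have hφ2' : MemLp (pd k φ) 2 μ := (hφ.pd k).memLp 2 B
  have hchain : ∀ n x, pd k (fun x => f (v n x)) x = deriv f (v n x) * pd k (v n) x := by
    intro n x
    have := (hf.differentiable one_ne_zero (v n x)).hasDerivAt.comp_hasFDerivAt x
      ((hv n).differentiable one_ne_zero x).hasFDerivAt
    rw [pd]
    change fderiv ℝ (f ∘ v n) x _ = _
    rw [this.fderiv]
    simp [pd]
  have hn : ∀ n, ∫ x in B, f (v n x) * pd k φ x =
      - ∫ x in B, deriv f (v n x) * pd k (v n) x * φ x := by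
    intro n
    have := integral_mul_pd (hf.comp (hv n)) (hφ.1.of_le (by exact_mod_cast le_top)) hφ.2.1 k
    rw [setIntegral_eq_integral_of_forall_compl_eq_zero
        (fun x hx => by rw [(hφ.pd k).eq_zero hx, mul_zero]),
      setIntegral_eq_integral_of_forall_compl_eq_zero
        (fun x hx => by rw [hφ.eq_zero hx, mul_zero])]
    simp_rw [← hchain]
    exact this
  have hlim1 : Tendsto (fun n => ∫ x in B, f (v n x) * pd k φ x) atTop
      (𝓝 (∫ x in B, f (u x) * pd k φ x)) := by
    have hfu : AEStronglyMeasurable (fun x => f (u x)) μ :=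
      hf.continuous.comp_aestronglyMeasurable hu.1
    refine tendsto_integral_of_L1' (fun x => f (u x) * pd k φ x) (hfu.mul hφ2'.1)
      (Eventually.of_forall fun n => ?_) ?_
    · exact (((hf.comp (hv n)).continuous.mul (hφ.pd k).1.continuous).integrable_of_hasCompactSupport
        (hφ.pd k).2.1.mul_left).restrict
    · have h0 : Tendsto (fun n => eLpNorm (fun x => v n x - u x) 2 μ * eLpNorm (pd k φ) 2 μ)
          atTop (𝓝 0) := by
        simpa using ENNReal.Tendsto.mul_const hvu (Or.inr hφ2'.2.ne)
      refine tendsto_of_tendsto_of_tendsto_of_le_of_le tendsto_const_nhds h0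
        (fun n => zero_le) fun n => ?_
      refine le_trans ?_ (eLpNorm_one_mul_le ((hv n).continuous.aestronglyMeasurable.sub hu.1)
        hφ2'.1)
      refine eLpNorm_mono fun x => ?_
      simp only [Pi.sub_apply, Real.norm_eq_abs]
      rw [← sub_mul, abs_mul, abs_mul]
      exact mul_le_mul_of_nonneg_right (hfL _ _) (abs_nonneg _)
  have hlim2 : Tendsto (fun n => ∫ x in B, deriv f (v n x) * pd k (v n) x * φ x) atTop
      (𝓝 (∫ x in B, deriv f (u x) * g x k * φ x)) := by
    have hdu : AEStronglyMeasurable (fun x => deriv f (u x)) μ :=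
      hdf.comp_aestronglyMeasurable hu.1
    obtain ⟨C, hC⟩ := hφ.2.1.exists_bound_of_continuous hφ.1.continuous
    have hgφ : MemLp (fun x => g x k * φ x) 2 μ :=
      (hgk.const_mul C).mono (hgk.1.mul hφ2.1) (ae_of_all _ fun x => by
        rw [norm_mul, norm_mul, mul_comm]
        gcongr
        exact (hC x).trans (le_abs_self C))
    refine tendsto_integral_of_L1' (fun x => deriv f (u x) * g x k * φ x)
      ((hdu.mul hgk.1).mul hφ2.1)
      (Eventually.of_forall fun n => ?_) ?_
    · exact (((hdf.comp (hv n).continuous).mul (hpv n)).mul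
        hφ.1.continuous |>.integrable_of_hasCompactSupport hφ.2.1.mul_left).restrict
    · have h0 : Tendsto (fun n =>
          eLpNorm (fun x => pd k (v n) x - g x k) 2 μ * eLpNorm φ 2 μ +
          eLpNorm (fun x => v n x - u x) 2 μ * eLpNorm (fun x => g x k * φ x) 2 μ)
          atTop (𝓝 0) := by
        simpa using (ENNReal.Tendsto.mul_const (hvg k) (Or.inr hφ2.2.ne)).add
          (ENNReal.Tendsto.mul_const hvu (Or.inr hgφ.2.ne))
      refine tendsto_of_tendsto_of_tendsto_of_le_of_le tendsto_const_nhds h0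
        (fun n => zero_le) fun n => ?_
      have hm1 : AEStronglyMeasurable (fun x => pd k (v n) x - g x k) μ :=
        (hpv n).aestronglyMeasurable.sub hgk.1
      have hm2 : AEStronglyMeasurable (fun x => v n x - u x) μ :=
        (hv n).continuous.aestronglyMeasurable.sub hu.1
      have hdv : AEStronglyMeasurable (fun x => deriv f (v n x)) μ :=
        (hdf.comp (hv n).continuous).aestronglyMeasurable
      have hsplit : ((fun x => deriv f (v n x) * pd k (v n) x * φ x) - fun x =>
          deriv f (u x) * g x k * φ x) =
          (fun x => deriv f (v n x) * ((pd k (v n) x - g x k) * φ x)) +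
          fun x => (deriv f (v n x) - deriv f (u x)) * (g x k * φ x) := by
        ext x; simp only [Pi.sub_apply, Pi.add_apply]; ring
      rw [hsplit]
      refine (eLpNorm_add_le (hdv.mul (hm1.mul hφ2.1)) ((hdv.sub hdu).mul hgφ.1) le_rfl).trans ?_
      refine add_le_add ?_ ?_
      · refine le_trans (eLpNorm_mono fun x => ?_) (eLpNorm_one_mul_le hm1 hφ2.1)
        change ‖deriv f (v n x) * ((pd k (v n) x - g x k) * φ x)‖ ≤ ‖(pd k (v n) x - g x k) * φ x‖
        rw [norm_mul]
        exact mul_le_of_le_one_left (norm_nonneg _) (h1 _)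
      · refine le_trans (eLpNorm_mono fun x => ?_) (eLpNorm_one_mul_le hm2 hgφ.1)
        change ‖(deriv f (v n x) - deriv f (u x)) * (g x k * φ x)‖ ≤
          ‖(v n x - u x) * (g x k * φ x)‖
        rw [norm_mul, norm_mul (v n x - u x)]
        exact mul_le_mul_of_nonneg_right (hL _ _) (norm_nonneg _)
  have := tendsto_nhds_unique hlim1 ((hlim2.neg).congr fun n => (hn n).symm)
  simp only [PiLp.smul_apply, smul_eq_mul]
  rw [this, neg_neg]

theorem GradApprox.wGrad {B : Set (Pt N)} {u : Pt N → ℝ}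
    {g : Pt N → Pt N} (hu : MemLp u 2 (volume.restrict B)) (hg : MemLp g 2 (volume.restrict B))
    (h : GradApprox B u g) : WGrad B u g := by
  have := h.wGrad_comp hu hg (f := fun t => t) contDiff_id (by simp) (by simp)
  simpa using this

theorem GradApprox.mono {B B' : Set (Pt N)} (hB : B ⊆ B') {u : Pt N → ℝ}
    {g : Pt N → Pt N} (h : GradApprox B' u g) : GradApprox B u g := by
  obtain ⟨v, hv, hvu, hvg⟩ := h
  exact ⟨v, hv, tendsto_of_tendsto_of_tendsto_of_le_of_le tendsto_const_nhds hvu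
      (fun n => zero_le) fun n => eLpNorm_mono_measure _ (Measure.restrict_mono hB le_rfl),
    fun k => tendsto_of_tendsto_of_tendsto_of_le_of_le tendsto_const_nhds (hvg k)
      (fun n => zero_le) fun n => eLpNorm_mono_measure _ (Measure.restrict_mono hB le_rfl)⟩

theorem GradApprox.congr_add_const {B : Set (Pt N)} {u w : Pt N → ℝ} {c : ℝ}
    {g : Pt N → Pt N} (h : GradApprox B u g) (hw : ∀ᵐ x ∂volume.restrict B, w x = u x + c) :
    GradApprox B w g := by
  obtain ⟨v, hv, hvu, hvg⟩ := h
  refine ⟨fun n x => v n x + c, fun n => (hv n).add contDiff_const, hvu.congr fun n => ?_,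
    fun k => (hvg k).congr fun n => ?_⟩
  · refine eLpNorm_congr_ae ?_
    filter_upwards [hw] with x hx
    rw [hx]; ring
  · simp [pd]

/-- A smooth partition of unity, subordinate to finitely many balls covering the support, writes
each test function as a sum of test functions supported in single balls. -/
theorem WGrad.of_local {U : Set (Pt N)} (hU : IsOpen U) {u : Pt N → ℝ} {g : Pt N → Pt N}
    (h : ∀ x ∈ U, ∃ r > 0, Metric.ball x r ⊆ U ∧ MemLp u 2 (volume.restrict (Metric.ball x r)) ∧
      MemLp g 2 (volume.restrict (Metric.ball x r)) ∧ WGrad (Metric.ball x r) u g) :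
    WGrad U u g := by
  intro k φ hφ
  choose! r hr hrU hu hg hw using h
  have hcov : tsupport φ ⊆ ⋃ x : U, Metric.ball (x : Pt N) (r x) := fun x hx =>
    mem_iUnion.2 ⟨⟨x, hφ.2.2 hx⟩, Metric.mem_ball_self (hr x (hφ.2.2 hx))⟩
  obtain ⟨t, ht⟩ := hφ.2.1.isCompact.elim_finite_subcover _ (fun _ => Metric.isOpen_ball) hcov
  obtain ⟨ρ, hρ⟩ := SmoothPartitionOfUnity.exists_isSubordinate (modelWithCornersSelf ℝ (Pt N))
    (isClosed_tsupport φ) (fun i : t => Metric.ball ((i : U) : Pt N) (r (i : U)))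
    (fun _ => Metric.isOpen_ball) (fun x hx => by
      obtain ⟨i, hi, hxi⟩ := mem_iUnion₂.1 (ht hx)
      exact mem_iUnion.2 ⟨⟨i, hi⟩, hxi⟩)
  let ψ : t → Pt N → ℝ := fun i x => ρ i x * φ x
  have hψ : ∀ i : t, IsTest (Metric.ball ((i : U) : Pt N) (r (i : U))) (ψ i) := fun i =>
    ⟨(ρ i).contMDiff.contDiff.mul hφ.1, hφ.2.1.mul_left,
      (tsupport_mul_subset_left).trans (hρ i)⟩
  have hsum : ∀ x, φ x = ∑ i, ψ i x := by
    intro x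
    by_cases hx : x ∈ tsupport φ
    · have := ρ.sum_eq_one hx
      rw [finsum_eq_sum_of_fintype] at this
      simp only [ψ]
      rw [← Finset.sum_mul, this, one_mul]
    · simp [ψ, image_eq_zero_of_notMem_tsupport hx]
  have hpd : ∀ x, pd k φ x = ∑ i, pd k (ψ i) x := by
    intro x
    have h1 : φ = fun x => ∑ i, ψ i x := funext hsum
    rw [pd, h1, fderiv_fun_sum fun i _ => (hψ i).1.differentiable (by simp) x]
    simp [pd]
  have hint : ∀ (i : t) (f θ : Pt N → ℝ),
      MemLp f 2 (volume.restrict (Metric.ball ((i : U) : Pt N) (r (i : U)))) →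
      IsTest (Metric.ball ((i : U) : Pt N) (r (i : U))) θ →
      IntegrableOn (fun x => f x * θ x) U := by
    intro i f θ hf hθ
    refine IntegrableOn.of_forall_sdiff_eq_zero (s := Metric.ball ((i : U) : Pt N) (r (i : U)))
      ?_ hU.measurableSet fun x hx => by rw [hθ.eq_zero hx.2, mul_zero]
    exact hf.integrable_mul (hθ.memLp 2 _)
  have hL : ∫ x in U, g x k * φ x = ∑ i, ∫ x in U, g x k * ψ i x := by
    simp_rw [hsum, Finset.mul_sum]
    exact integral_finsetSum _ fun i _ => hint i _ _ (MemLp.coord (hg _ i.1.2) k) (hψ i)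
  have hR : ∫ x in U, u x * pd k φ x = ∑ i, ∫ x in U, u x * pd k (ψ i) x := by
    simp_rw [hpd, Finset.mul_sum]
    exact integral_finsetSum _ fun i _ => hint i _ _ (hu _ i.1.2) ((hψ i).pd k)
  rw [hL, hR, ← Finset.sum_neg_distrib]
  refine Finset.sum_congr rfl fun i _ => ?_
  have := hw _ i.1.2 k _ (hψ i)
  rwa [← setIntegral_eq_of_eq_zero (hrU _ i.1.2) fun x hx => by rw [(hψ i).eq_zero hx, mul_zero],
    ← setIntegral_eq_of_eq_zero (hrU _ i.1.2) fun x hx => by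
      rw [((hψ i).pd k).eq_zero hx, mul_zero]] at this

/-- The function is a.e. constant on small balls. The constants of two overlapping balls agree,
since the overlap is open and non-empty and so has positive measure; this gives a locally constant
function on a preconnected set. -/
theorem ae_const_of_wGrad_zero {U : Set (Pt N)} (hU : IsOpen U) (hUc : IsPreconnected U)
    {u : Pt N → ℝ}
    (hu : ∀ x ∈ U, ∃ r > 0, Metric.ball x r ⊆ U ∧ MemLp u 2 (volume.restrict (Metric.ball x r)))
    (h : WGrad U u 0) : ∃ c : ℝ, ∀ᵐ x ∂volume.restrict U, u x = c := by
  rcases U.eq_empty_or_nonempty with rfl | ⟨x₀, hx₀⟩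
  · exact ⟨0, by simp⟩
  have hball : ∀ x ∈ U, ∃ r > 0, ∃ c : ℝ, Metric.ball x r ⊆ U ∧
      ∀ᵐ y ∂volume.restrict (Metric.ball x r), u y = c := by
    intro x hx
    obtain ⟨r, hr, hrU, hur⟩ := hu x hx
    have h1 := (h.mono hrU).gradApprox (half_lt_self hr) hur MemLp.zero'
    have hsub : Metric.ball x (r / 2) ⊆ Metric.ball x r := Metric.ball_subset_ball (by linarith)
    obtain ⟨c, hc⟩ := h1.ae_const (half_pos hr)
      (hur.mono_measure (Measure.restrict_mono hsub le_rfl))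
    exact ⟨r / 2, half_pos hr, c, hsub.trans hrU, hc⟩
  choose! r hr c hrU hc using hball
  have hov : ∀ x ∈ U, ∀ y ∈ U, y ∈ Metric.ball x (r x) → c y = c x := by
    intro x hx y hy hyx
    have hopen : IsOpen (Metric.ball x (r x) ∩ Metric.ball y (r y)) :=
      Metric.isOpen_ball.inter Metric.isOpen_ball
    have hpos := hopen.measure_pos volume ⟨y, hyx, Metric.mem_ball_self (hr y hy)⟩
    have h1 : ∀ᵐ z ∂volume.restrict (Metric.ball x (r x) ∩ Metric.ball y (r y)), c y = c x := by
      filter_upwards [ae_restrict_of_ae_restrict_of_subset inter_subset_left (hc x hx),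
        ae_restrict_of_ae_restrict_of_subset inter_subset_right (hc y hy)] with z h1 h2
      rw [← h1, ← h2]
    have hne : (ae (volume.restrict (Metric.ball x (r x) ∩ Metric.ball y (r y)))).NeBot := by
      rw [ae_neBot, Ne, Measure.restrict_eq_zero]
      exact hpos.ne'
    exact h1.exists.choose_spec
  have hlc : IsLocallyConstant fun x : U => c x := by
    rw [IsLocallyConstant.iff_eventually_eq]
    intro x
    have : ∀ᶠ y : U in 𝓝 x, (y : Pt N) ∈ Metric.ball (x : Pt N) (r x) :=
      continuous_subtype_val.continuousAt.eventually_mem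
        (Metric.isOpen_ball.mem_nhds (Metric.mem_ball_self (hr x x.2)))
    exact this.mono fun y hy => hov x x.2 y y.2 hy
  have : PreconnectedSpace U := isPreconnected_iff_preconnectedSpace.1 hUc
  have hcc : ∀ x ∈ U, c x = c x₀ := fun x hx =>
    hlc.apply_eq_of_preconnectedSpace ⟨x, hx⟩ ⟨x₀, hx₀⟩
  refine ⟨c x₀, ?_⟩
  -- The exceptional set is null near each of its points, which suffices for it to be null.
  rw [ae_restrict_iff' hU.measurableSet, ae_iff]
  refine measure_null_of_locally_null _ fun x hx => ?_
  have hxU : x ∈ U := by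
    by_contra hxU
    exact hx fun h => absurd h hxU
  refine ⟨{y | ¬(y ∈ U → u y = c x₀)} ∩ Metric.ball x (r x),
    inter_mem self_mem_nhdsWithin (mem_nhdsWithin_of_mem_nhds
      (Metric.isOpen_ball.mem_nhds (Metric.mem_ball_self (hr x hxU)))), ?_⟩
  have h2 := hc x hxU
  rw [ae_restrict_iff' measurableSet_ball, ae_iff] at h2
  refine measure_mono_null (fun y hy => ?_) h2
  simp only [mem_inter_iff, mem_ofPred_eq, not_forall] at hy ⊢
  obtain ⟨⟨_, hy1⟩, hy2⟩ := hy
  exact ⟨hy2, by rwa [hcc x hxU]⟩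

/-! ### Global potentials on simply connected domains -/

/-- The real numbers with the discrete topology. -/
structure DiscreteReal : Type where
  /-- The underlying real number. -/
  val : ℝ

instance : TopologicalSpace DiscreteReal := ⊥

instance : DiscreteTopology DiscreteReal := ⟨rfl⟩

/-- The affine bundle with discrete fibre `ℝ` given by a real Čech cocycle. -/
def cocycleBundle {X ι : Type*} [TopologicalSpace X] (B : ι → Set X) (hB : ∀ i, IsOpen (B i))
    (hcov : ∀ x, ∃ i, x ∈ B i) (c : ι → ι → ℝ)
    (hc : ∀ i j k, (B i ∩ B j ∩ B k).Nonempty → c i k = c i j + c j k) :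
    FiberBundleCore ι X DiscreteReal where
  baseSet := B
  isOpen_baseSet := hB
  indexAt x := (hcov x).choose
  mem_baseSet_at x := (hcov x).choose_spec
  coordChange i j _ t := ⟨t.val + c i j⟩
  coordChange_self i x hx t := by
    have := hc i i i ⟨x, ⟨hx, hx⟩, hx⟩
    have h0 : c i i = 0 := by linarith
    simp [h0]
  continuousOn_coordChange i j := by
    have h : Continuous fun t : DiscreteReal => (⟨t.val + c i j⟩ : DiscreteReal) :=
      continuous_of_discreteTopology
    exact (h.comp continuous_snd).continuousOn
  coordChange_comp i j k x hx t := by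
    simp [hc i j k ⟨x, hx⟩, add_assoc]

/-- A bundle with discrete fibre is a covering, so the identity of the simply connected base lifts
to a section. Read in the chart over `B i`, the section is continuous into a discrete space, hence
one constant; the transition rule for these constants is the claim. -/
theorem exists_cocycle_primitive {X ι : Type*} [TopologicalSpace X] [SimplyConnectedSpace X]
    [LocallyPathConnectedSpace X] (B : ι → Set X) (hB : ∀ i, IsOpen (B i))
    (hBc : ∀ i, IsPreconnected (B i)) (hcov : ∀ x, ∃ i, x ∈ B i) (c : ι → ι → ℝ)
    (hc : ∀ i j k, (B i ∩ B j ∩ B k).Nonempty → c i k = c i j + c j k) :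
    ∃ t : ι → ℝ, ∀ i j, (B i ∩ B j).Nonempty → t j = t i + c i j := by
  let Z := cocycleBundle B hB hcov c hc
  have hcm : IsCoveringMap Z.proj :=
    FiberBundle.isCoveringMap (F := DiscreteReal) (E := Z.Fiber)
  obtain ⟨x₀⟩ : Nonempty X := inferInstance
  obtain ⟨s, ⟨-, hs⟩, -⟩ := hcm.existsUnique_continuousMap_lifts (ContinuousMap.id X) x₀
    (⟨x₀, (⟨0⟩ : DiscreteReal)⟩ : Z.TotalSpace) rfl
  have hsx : ∀ x, (s x).proj = x := fun x => congrFun hs x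
  let τ : ι → X → DiscreteReal := fun i x => (Z.localTriv i (s x)).2
  have hτc : ∀ i, ContinuousOn (τ i) (B i) := by
    intro i
    have h1 : ContinuousOn (fun x => Z.localTriv i (s x)) (B i) :=
      (Z.localTriv i).continuousOn.comp s.continuous.continuousOn fun x hx => by
        rw [Bundle.Trivialization.mem_source]
        change (s x).proj ∈ B i
        rwa [hsx x]
    exact continuous_snd.comp_continuousOn h1
  have hτconst : ∀ i, ∀ x ∈ B i, ∀ y ∈ B i, τ i x = τ i y := fun i x hx y hy =>
    (hBc i).constant (hτc i) hx hy
  have hτ : ∀ i j, ∀ x ∈ B i ∩ B j, (τ j x).val = (τ i x).val + c i j := by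
    intro i j x hx
    have hi : (τ i x).val =
        DiscreteReal.val (s x).2 + c (Z.indexAt (s x).proj) i := by
      simp only [τ, FiberBundleCore.localTriv_apply]
      rfl
    have hj : (τ j x).val =
        DiscreteReal.val (s x).2 + c (Z.indexAt (s x).proj) j := by
      simp only [τ, FiberBundleCore.localTriv_apply]
      rfl
    have hmem : x ∈ B (Z.indexAt (s x).proj) := by
      have := Z.mem_baseSet_at (s x).proj
      rwa [hsx x] at this ⊢
    have := hc (Z.indexAt (s x).proj) i j ⟨x, ⟨hmem, hx.1⟩, hx.2⟩
    rw [hi, hj, this]; ring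
  classical
  -- An empty `B i` meets nothing, so the default value zero is harmless.
  refine ⟨fun i => if h : (B i).Nonempty then (τ i h.some).val else 0, fun i j ⟨x, hi, hj⟩ => ?_⟩
  have hin : (B i).Nonempty := ⟨x, hi⟩
  have hjn : (B j).Nonempty := ⟨x, hj⟩
  simp only [dif_pos hin, dif_pos hjn]
  rw [hτconst i _ hin.some_mem x hi, hτconst j _ hjn.some_mem x hj]
  exact hτ i j x ⟨hi, hj⟩

theorem exists_of_ae_restrict {U : Set (Pt N)} (hU : IsOpen U) (hne : U.Nonempty)
    {p : Pt N → Prop} (h : ∀ᵐ x ∂volume.restrict U, p x) : ∃ x, p x := by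
  have hne : (ae (volume.restrict U)).NeBot := by
    rw [ae_neBot, Ne, Measure.restrict_eq_zero]
    exact (hU.measure_pos volume hne).ne'
  exact h.exists

/-- A square-integrable weakly curl-free field on a simply connected open set is the gradient of
a locally square-integrable function. -/
theorem exists_potential {U : Set (Pt N)} (hU : IsOpen U) (hsc : IsSimplyConnected U)
    {g : Pt N → Pt N} (hg : MemLp g 2 (volume.restrict U)) (h : CurlFree U g) :
    ∃ v : Pt N → ℝ, ∀ x ∈ U, ∃ r > 0, Metric.ball x r ⊆ U ∧
      MemLp v 2 (volume.restrict (Metric.ball x r)) ∧ GradApprox (Metric.ball x r) v g := by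
  have hloc : ∀ x ∈ U, ∃ r > 0, ∃ u, Metric.ball x r ⊆ U ∧
      MemLp u 2 (volume.restrict (Metric.ball x r)) ∧ GradApprox (Metric.ball x r) u g := by
    intro x hx
    obtain ⟨r, hr, hrU⟩ := Metric.isOpen_iff.1 hU x hx
    obtain ⟨u, hu, hug⟩ := exists_gradApprox (half_pos hr) (half_lt_self hr)
      (hg.mono_measure (Measure.restrict_mono hrU le_rfl)) (h.mono hrU)
    exact ⟨r / 2, half_pos hr, u, (Metric.ball_subset_ball (by linarith)).trans hrU, hu, hug⟩
  choose! r hr u hrU hu hug using hloc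
  -- Countably many balls suffice, so that almost-everywhere statements can later be combined over
  -- all of them.
  obtain ⟨T, hT, hTU⟩ := TopologicalSpace.isOpen_iUnion_countable
    (fun x : U => Metric.ball (x : Pt N) (r x)) fun _ => Metric.isOpen_ball
  have : Countable T := hT.to_subtype
  let B : T → Set (Pt N) := fun i => Metric.ball ((i : U) : Pt N) (r (i : U))
  have hBU : ∀ i, B i ⊆ U := fun i => hrU _ i.1.2
  have hcov : ∀ x ∈ U, ∃ i, x ∈ B i := by
    intro x hx
    have : x ∈ ⋃ x : U, Metric.ball (x : Pt N) (r x) :=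
      mem_iUnion.2 ⟨⟨x, hx⟩, Metric.mem_ball_self (hr x hx)⟩
    rw [← hTU] at this
    obtain ⟨i, hi, hxi⟩ := mem_iUnion₂.1 this
    exact ⟨⟨i, hi⟩, hxi⟩
  have huB : ∀ i : T, MemLp (u (i : U)) 2 (volume.restrict (B i)) := fun i => hu _ i.1.2
  have hgB : ∀ {W : Set (Pt N)}, W ⊆ U → MemLp g 2 (volume.restrict W) := fun hW =>
    hg.mono_measure (Measure.restrict_mono hW le_rfl)
  -- Two local potentials have the same gradient, and the intersection of two balls is convex, hence
  -- connected.
  have hdiff : ∀ i j : T, ∃ c : ℝ, ∀ᵐ x ∂volume.restrict (B i ∩ B j),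
      u (i : U) x = u (j : U) x + c := by
    intro i j
    have hopen : IsOpen (B i ∩ B j) := Metric.isOpen_ball.inter Metric.isOpen_ball
    have h1 : ∀ {W : Set (Pt N)}, W ⊆ B i ∩ B j →
        MemLp (fun x => u (i : U) x - u (j : U) x) 2 (volume.restrict W) := fun hW =>
      ((huB i).mono_measure (Measure.restrict_mono (hW.trans inter_subset_left) le_rfl)).sub
        ((huB j).mono_measure (Measure.restrict_mono (hW.trans inter_subset_right) le_rfl))
    have h2 : WGrad (B i ∩ B j) (fun x => u (i : U) x - u (j : U) x) 0 := by
      intro k φ hφ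
      have hui := (huB i).mono_measure (Measure.restrict_mono (inter_subset_left (t := B j)) le_rfl)
      have huj := (huB j).mono_measure (Measure.restrict_mono (inter_subset_right (s := B i)) le_rfl)
      have e1 := ((hug _ i.1.2).wGrad (huB i) (hgB (hBU i))).mono inter_subset_left k φ hφ
      have e2 := ((hug _ j.1.2).wGrad (huB j) (hgB (hBU j))).mono inter_subset_right k φ hφ
      have hp := (hφ.pd k).memLp 2 (B i ∩ B j)
      have e3 : ∫ x in B i ∩ B j, (u (i : U) x - u (j : U) x) * pd k φ x =
          (∫ x in B i ∩ B j, u (i : U) x * pd k φ x) -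
            ∫ x in B i ∩ B j, u (j : U) x * pd k φ x := by
        simp_rw [sub_mul]
        exact integral_sub (hui.integrable_mul hp) (huj.integrable_mul hp)
      rw [e3]
      simp only [Pi.zero_apply, PiLp.zero_apply, zero_mul, integral_zero]
      linarith
    obtain ⟨c, hc⟩ := ae_const_of_wGrad_zero hopen
      ((convex_ball _ _).inter (convex_ball _ _)).isPreconnected (fun x hx => by
        obtain ⟨ρ, hρ, hρB⟩ := Metric.isOpen_iff.1 hopen x hx
        exact ⟨ρ, hρ, hρB, h1 hρB⟩) h2
    exact ⟨c, hc.mono fun x hx => by linarith⟩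
  choose c hc using hdiff
  have : SimplyConnectedSpace U := hsc.simplyConnectedSpace
  have : LocallyPathConnectedSpace U := hU.locallyPathConnectedSpace
  obtain ⟨t, ht⟩ := exists_cocycle_primitive (X := U) (fun i => Subtype.val ⁻¹' B i)
    (fun i => Metric.isOpen_ball.preimage continuous_subtype_val)
    (fun i => by
      rw [← Topology.IsInducing.subtypeVal.isPreconnected_image, Subtype.image_preimage_coe,
        inter_eq_self_of_subset_right (hBU i)]
      exact (convex_ball _ _).isPreconnected)
    (fun x => hcov x x.2) c (by
      rintro i j k ⟨x, ⟨hi, hj⟩, hk⟩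
      have hopen : IsOpen (B i ∩ B j ∩ B k) :=
        (Metric.isOpen_ball.inter Metric.isOpen_ball).inter Metric.isOpen_ball
      have hsub : ∀ p q, (∀ y ∈ B i ∩ B j ∩ B k, y ∈ B p ∩ B q) →
          B i ∩ B j ∩ B k ⊆ B p ∩ B q := fun p q h => h
      have hae : ∀ᵐ y ∂volume.restrict (B i ∩ B j ∩ B k), c i k = c i j + c j k := by
        filter_upwards [
          ae_restrict_of_ae_restrict_of_subset (hsub i j (fun y hy => ⟨hy.1.1, hy.1.2⟩)) (hc i j),
          ae_restrict_of_ae_restrict_of_subset (hsub j k (fun y hy => ⟨hy.1.2, hy.2⟩)) (hc j k),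
          ae_restrict_of_ae_restrict_of_subset (hsub i k (fun y hy => ⟨hy.1.1, hy.2⟩)) (hc i k)]
          with y h1 h2 h3
        linarith
      exact (exists_of_ae_restrict hopen ⟨x, ⟨hi, hj⟩, hk⟩ hae).choose_spec)
  classical
  -- An arbitrary ball through `x` is chosen; since `u i + t i = u j + t j` a.e. on overlaps, the
  -- choice does not matter almost everywhere.
  let v : Pt N → ℝ := fun x =>
    if hx : ∃ i, x ∈ B i then u (hx.choose : U) x + t hx.choose else 0
  have hv : ∀ i : T, ∀ᵐ x ∂volume.restrict (B i), v x = u (i : U) x + t i := by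
    intro i
    have h1 : ∀ j : T, ∀ᵐ x ∂volume.restrict (B i), x ∈ B j →
        u (j : U) x + t j = u (i : U) x + t i := by
      intro j
      by_cases hne : (B i ∩ B j).Nonempty
      · have h2 := hc i j
        rw [ae_restrict_iff' (measurableSet_ball.inter measurableSet_ball)] at h2
        rw [ae_restrict_iff' measurableSet_ball]
        filter_upwards [h2] with x hx hi hj
        have h3 := hx ⟨hi, hj⟩
        have h4 := ht i j (by
          obtain ⟨y, hy⟩ := hne
          exact ⟨⟨y, hBU i hy.1⟩, hy⟩)
        rw [h3, h4]; ring
      · filter_upwards [ae_restrict_mem measurableSet_ball] with x hi hj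
        exact absurd ⟨x, hi, hj⟩ hne
    filter_upwards [ae_all_iff.2 h1, ae_restrict_mem measurableSet_ball] with x hx hxi
    have hex : ∃ i, x ∈ B i := ⟨i, hxi⟩
    simp only [v, dif_pos hex]
    exact hx _ hex.choose_spec
  refine ⟨v, fun x hx => ?_⟩
  obtain ⟨i, hi⟩ := hcov x hx
  obtain ⟨ρ, hρ, hρB⟩ := Metric.isOpen_iff.1 Metric.isOpen_ball x hi
  have hfin : IsFiniteMeasure (volume.restrict (B i)) := ⟨by simpa using measure_ball_lt_top⟩
  refine ⟨ρ, hρ, hρB.trans (hBU i), ?_, ((hug _ i.1.2).congr_add_const (hv i)).mono hρB⟩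
  have h5 : MemLp v 2 (volume.restrict (B i)) :=
    ((huB i).add (memLp_const (t i))).ae_eq ((hv i).mono fun x hx => hx.symm)
  exact h5.mono_measure (Measure.restrict_mono hρB le_rfl)

/-! ### Closed linear conditions -/

/-- The set `s` is a closed linear subspace. -/
def ClosedLinear {X : Type*} [AddCommGroup X] [Module ℝ X] [TopologicalSpace X] (s : Set X) :
    Prop :=
  ∃ S : Submodule ℝ X, (S : Set X) = s ∧ IsClosed s

section ClosedLinear
variable {X : Type*} [AddCommGroup X] [Module ℝ X] [TopologicalSpace X] {s t : Set X}

theorem ClosedLinear.isClosed (h : ClosedLinear s) : IsClosed s := by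
  obtain ⟨S, -, hS⟩ := h
  exact hS

theorem ClosedLinear.add_mem (h : ClosedLinear s) {x y : X} (hx : x ∈ s) (hy : y ∈ s) :
    x + y ∈ s := by
  obtain ⟨S, rfl, -⟩ := h
  exact S.add_mem hx hy

theorem ClosedLinear.sub_mem (h : ClosedLinear s) {x y : X} (hx : x ∈ s) (hy : y ∈ s) :
    x - y ∈ s := by
  obtain ⟨S, rfl, -⟩ := h
  exact S.sub_mem hx hy

theorem ClosedLinear.smul_mem (h : ClosedLinear s) (a : ℝ) {x : X} (hx : x ∈ s) :
    a • x ∈ s := by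
  obtain ⟨S, rfl, -⟩ := h
  exact S.smul_mem a hx

theorem ClosedLinear.inter (hs : ClosedLinear s) (ht : ClosedLinear t) :
    ClosedLinear (s ∩ t) := by
  obtain ⟨S, rfl, hS⟩ := hs
  obtain ⟨T, rfl, hT⟩ := ht
  exact ⟨S ⊓ T, by simp, hS.inter hT⟩

theorem ClosedLinear.preimage {Y : Type*} [AddCommGroup Y] [Module ℝ Y] [TopologicalSpace Y]
    (hs : ClosedLinear s) (f : Y →L[ℝ] X) : ClosedLinear (f ⁻¹' s) := by
  obtain ⟨S, rfl, hS⟩ := hs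
  exact ⟨S.comap f.toLinearMap, rfl, hS.preimage f.continuous⟩

theorem closedLinear_of_forall {ι : Sort*} {p : ι → Set X} (h : ∀ i, ClosedLinear (p i)) :
    ClosedLinear (⋂ i, p i) := by
  choose S hS hc using h
  exact ⟨⨅ i, S i, by simp [hS], isClosed_iInter hc⟩

theorem closedLinear_eq_zero {f : X →L[ℝ] ℝ} : ClosedLinear {x | f x = 0} :=
  ⟨LinearMap.ker f.toLinearMap, rfl, isClosed_eq f.continuous continuous_const⟩

end ClosedLinear

theorem exists_inner_functional {V : Type} [NormedAddCommGroup V] [InnerProductSpace ℝ V]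
    {Ω : Set (Pt N)} {ψ : Pt N → V} (hψ : MemLp ψ 2 (volume.restrict Ω)) :
    ∃ ℓ : L2 Ω V →L[ℝ] ℝ, ∀ u, ℓ u = ∫ x in Ω, inner ℝ (u x) (ψ x) := by
  refine ⟨innerSL ℝ (hψ.toLp ψ), fun u => ?_⟩
  rw [innerSL_apply_apply, L2.inner_def]
  refine integral_congr_ae ?_
  filter_upwards [hψ.coeFn_toLp] with x hx
  rw [hx, real_inner_comm]

theorem exists_coord_functional {ι : Type} [Fintype ι] {Ω : Set (Pt N)} {φ : Pt N → ℝ}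
    (hφ : MemLp φ 2 (volume.restrict Ω)) (p : ι) :
    ∃ ℓ : L2 Ω (EuclideanSpace ℝ ι) →L[ℝ] ℝ, ∀ u, ℓ u = ∫ x in Ω, u x p * φ x := by
  obtain ⟨ℓ, hℓ⟩ := exists_inner_functional (Ω := Ω) hφ
  let P : EuclideanSpace ℝ ι →L[ℝ] ℝ := EuclideanSpace.proj p
  refine ⟨ℓ.comp (P.compLpL 2 _), fun u => ?_⟩
  rw [ContinuousLinearMap.comp_apply, hℓ]
  refine integral_congr_ae ?_
  filter_upwards [P.coeFn_compLpL (p := 2) u] with x hx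
  rw [hx]
  simp [P, mul_comm]

theorem exists_scalar_functional {Ω : Set (Pt N)} {φ : Pt N → ℝ}
    (hφ : MemLp φ 2 (volume.restrict Ω)) :
    ∃ ℓ : L2 Ω ℝ →L[ℝ] ℝ, ∀ u, ℓ u = ∫ x in Ω, u x * φ x := by
  obtain ⟨ℓ, hℓ⟩ := exists_inner_functional (Ω := Ω) hφ
  refine ⟨ℓ, fun u => ?_⟩
  rw [hℓ]
  simp [mul_comm]

theorem closedLinear_hasWeakGrad (Ω : Set (Pt N)) :
    ClosedLinear {w : L2 Ω ℝ × L2 Ω (Pt N) | HasWeakGrad w.1 w.2} := by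
  have : {w : L2 Ω ℝ × L2 Ω (Pt N) | HasWeakGrad w.1 w.2} =
      ⋂ (k : Fin N), ⋂ (φ : {φ : Pt N → ℝ // IsTest Ω φ}), {w |
        ∫ x in Ω, w.2 x k * φ.1 x = - ∫ x in Ω, w.1 x * pd k φ.1 x} := by
    ext w; simp [HasWeakGrad]
  rw [this]
  refine closedLinear_of_forall fun k => closedLinear_of_forall fun φ => ?_
  obtain ⟨ℓ₁, h1⟩ := exists_scalar_functional ((φ.2.pd k).memLp 2 Ω)
  obtain ⟨ℓ₂, h2⟩ := exists_coord_functional (φ.2.memLp 2 Ω) k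
  convert closedLinear_eq_zero (f := ℓ₁.comp (ContinuousLinearMap.fst ℝ _ _) +
    ℓ₂.comp (ContinuousLinearMap.snd ℝ _ _)) using 1
  ext w
  simp only [mem_ofPred_eq, add_apply, ContinuousLinearMap.comp_apply,
    ContinuousLinearMap.coe_fst', ContinuousLinearMap.coe_snd', h1, h2]
  constructor <;> intro h <;> linarith

theorem closedLinear_hasWeakJac (Ω : Set (Pt N)) :
    ClosedLinear {w : L2 Ω (Pt N) × L2 Ω (Ten N) | HasWeakJac w.1 w.2} := by
  have : {w : L2 Ω (Pt N) × L2 Ω (Ten N) | HasWeakJac w.1 w.2} =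
      ⋂ (n : Fin N), ⋂ (k : Fin N), ⋂ (φ : {φ : Pt N → ℝ // IsTest Ω φ}), {w |
        ∫ x in Ω, w.2 x (n, k) * φ.1 x = - ∫ x in Ω, w.1 x n * pd k φ.1 x} := by
    ext w; simp [HasWeakJac]
  rw [this]
  refine closedLinear_of_forall fun n => closedLinear_of_forall fun k =>
    closedLinear_of_forall fun φ => ?_
  obtain ⟨ℓ₁, h1⟩ := exists_coord_functional ((φ.2.pd k).memLp 2 Ω) n
  obtain ⟨ℓ₂, h2⟩ := exists_coord_functional (φ.2.memLp 2 Ω) (n, k)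
  convert closedLinear_eq_zero (f := ℓ₁.comp (ContinuousLinearMap.fst ℝ _ _) +
    ℓ₂.comp (ContinuousLinearMap.snd ℝ _ _)) using 1
  ext w
  simp only [mem_ofPred_eq, add_apply, ContinuousLinearMap.comp_apply,
    ContinuousLinearMap.coe_fst', ContinuousLinearMap.coe_snd', h1, h2]
  constructor <;> intro h <;> linarith

/-- Negating the bound for the constants `n + 1` and rescaling to `p = 1` yields `q ≤ 1/(n+1)`. This
is the common frame of all the compactness arguments. -/
theorem exists_le_mul_of_seq {M : Type*} [AddCommGroup M] [Module ℝ M] {s : Set M}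
    (hs : ∀ (a : ℝ), ∀ w ∈ s, a • w ∈ s) {p q : M → ℝ} (hp : ∀ (a : ℝ) w, p (a • w) = |a| * p w)
    (hq : ∀ (a : ℝ) w, q (a • w) = |a| * q w) (hq0 : ∀ w, 0 ≤ q w)
    (H : ∀ w : ℕ → M, (∀ n, w n ∈ s) → (∀ n, p (w n) = 1) →
      Tendsto (fun n => q (w n)) atTop (𝓝 0) → False) :
    ∃ c > 0, ∀ w ∈ s, p w ≤ c * q w := by
  by_contra! hcon
  have hn : ∀ n : ℕ, ∃ w ∈ s, ((n : ℝ) + 1) * q w < p w := fun n => hcon _ (by positivity)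
  choose w hws hw using hn
  have hpos : ∀ n, 0 < p (w n) := fun n =>
    lt_of_le_of_lt (mul_nonneg (by positivity) (hq0 _)) (hw n)
  refine H (fun n => (p (w n))⁻¹ • w n) (fun n => hs _ _ (hws n)) (fun n => ?_) ?_
  · rw [hp, abs_of_pos (inv_pos.2 (hpos n)), inv_mul_cancel₀ (hpos n).ne']
  · refine squeeze_zero (fun n => hq0 _) (fun n => ?_)
      (tendsto_one_div_add_atTop_nhds_zero_nat (𝕜 := ℝ))
    rw [hq, abs_of_pos (inv_pos.2 (hpos n)), le_div_iff₀ (by positivity), mul_assoc,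
      inv_mul_le_iff₀ (hpos n)]
    linarith [hw n]

/-- Bounded sequences are, up to scaling, contained in a given compact set. -/
theorem exists_subseq_tendsto_of_compact {X ι : Type*} [Fintype ι] [NormedAddCommGroup X]
    [NormedSpace ℝ X] {K : Set X} (hK : IsCompact K) {a : ℝ} (ha : a ≠ 0) {u : ℕ → ι → X}
    (hu : ∀ n i, a • u n i ∈ K) :
    ∃ (v : ι → X) (θ : ℕ → ℕ), StrictMono θ ∧ ∀ i, Tendsto (fun n => u (θ n) i) atTop (𝓝 (v i)) := by
  obtain ⟨v, -, θ, hθ, hv⟩ := (isCompact_univ_pi fun _ : ι => hK).tendsto_subseq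
    (x := fun n i => a • u n i) (fun n i _ => hu n i)
  refine ⟨fun i => a⁻¹ • v i, θ, hθ, fun i => ?_⟩
  have h1 := ((tendsto_pi_nhds.1 hv) i).const_smul a⁻¹
  refine h1.congr fun n => ?_
  simp [smul_smul, inv_mul_cancel₀ ha]

theorem exists_subseq_of_bounded_grad {U : Set (Pt N)} {ι : Type*} [Fintype ι]
    (hK : IsCompact (closure {u : L2 U ℝ | ∃ g : L2 U (Pt N),
      HasWeakGrad u g ∧ ‖u‖ ^ 2 + ‖g‖ ^ 2 ≤ 1}))
    {u : ℕ → ι → L2 U ℝ} {g : ℕ → ι → L2 U (Pt N)} (hug : ∀ n i, HasWeakGrad (u n i) (g n i))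
    {M : ℝ} (hu : ∀ n i, ‖u n i‖ ≤ M) (hg : ∀ n i, ‖g n i‖ ≤ M) :
    ∃ (v : ι → L2 U ℝ) (θ : ℕ → ℕ), StrictMono θ ∧
      ∀ i, Tendsto (fun n => u (θ n) i) atTop (𝓝 (v i)) := by
  -- The inverse of this number scales both norms to at most `1/2`, so the squares add up to at most
  -- one.
  have ha : 0 < 2 * (|M| + 1) := by positivity
  refine exists_subseq_tendsto_of_compact hK (inv_pos.2 ha).ne' fun n i => subset_closure ?_
  refine ⟨(2 * (|M| + 1))⁻¹ • g n i, (closedLinear_hasWeakGrad U).smul_mem (x := (u n i, g n i)) _ (hug n i), ?_⟩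
  have hb : ∀ t : ℝ, 0 ≤ t → t ≤ M → ((2 * (|M| + 1))⁻¹ * t) ^ 2 ≤ 1 / 4 := by
    intro t ht htM
    have h1 : (2 * (|M| + 1))⁻¹ * t ≤ 1 / 2 := by
      rw [inv_mul_le_iff₀ ha]
      linarith [le_abs_self M]
    have h0 : 0 ≤ (2 * (|M| + 1))⁻¹ * t := by positivity
    nlinarith
  rw [norm_smul, norm_smul, Real.norm_of_nonneg (inv_pos.2 ha).le]
  linarith [hb _ (norm_nonneg _) (hu n i), hb _ (norm_nonneg _) (hg n i)]

/-! ### Poincaré's inequality and square-integrable potentials -/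

/-- The expression is the difference quotient at zero of `s ↦ sin (t s)` with increment `1/(n+1)`.
-/
theorem tendsto_const_mul_sin (t : ℝ) :
    Tendsto (fun n : ℕ => ((n : ℝ) + 1) * Real.sin (t / (n + 1))) atTop (𝓝 t) := by
  have h1 : HasDerivAt (fun s : ℝ => Real.sin (t * s)) t 0 := by
    have := ((hasDerivAt_id (0 : ℝ)).const_mul t).sin
    simpa using this
  have h2 := h1.tendsto_slope_zero
  have h3 : Tendsto (fun n : ℕ => 1 / ((n : ℝ) + 1)) atTop (𝓝[≠] 0) :=
    tendsto_nhdsWithin_iff.2 ⟨tendsto_one_div_add_atTop_nhds_zero_nat,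
      Eventually.of_forall fun n => by
        have : (0 : ℝ) < 1 / ((n : ℝ) + 1) := by positivity
        exact this.ne'⟩
  refine (h2.comp h3).congr fun n => ?_
  simp [div_eq_mul_inv]

/-- A normalised counterexample sequence converges in `L²` to a function with zero gradient; by
connectedness it is constant, and its zero mean contradicts its norm one. -/
theorem exists_poincare {U : Set (Pt N)} (hU : IsOpen U) (hUc : IsConnected U)
    (hUt : volume U ≠ ⊤)
    (hK : IsCompact (closure {u : L2 U ℝ | ∃ g : L2 U (Pt N),
      HasWeakGrad u g ∧ ‖u‖ ^ 2 + ‖g‖ ^ 2 ≤ 1})) :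
    ∃ C > 0, ∀ (u : L2 U ℝ) (g : L2 U (Pt N)), HasWeakGrad u g → ∫ x in U, u x = 0 →
      ‖u‖ ≤ C * ‖g‖ := by
  have hfin : IsFiniteMeasure (volume.restrict U) := ⟨by simpa using hUt.lt_top⟩
  obtain ⟨ℓ, hℓ⟩ := exists_scalar_functional (Ω := U) (φ := fun _ => (1 : ℝ)) (memLp_const 1)
  have hcl := (closedLinear_hasWeakGrad U).inter
    (closedLinear_eq_zero (f := ℓ.comp (ContinuousLinearMap.fst ℝ _ (L2 U (Pt N)))))
  obtain ⟨C, hC, h⟩ := exists_le_mul_of_seq (p := fun w : L2 U ℝ × L2 U (Pt N) => ‖w.1‖)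
    (q := fun w => ‖w.2‖) (fun a w hw => hcl.smul_mem a hw)
    (fun a w => by simp [norm_smul]) (fun a w => by simp [norm_smul]) (fun w => norm_nonneg _)
    (by
      intro w hw hp hq
      obtain ⟨M, hM⟩ := hq.bddAbove_range
      obtain ⟨v, θ, hθ, hv⟩ := exists_subseq_of_bounded_grad hK (ι := Unit)
        (u := fun n _ => (w n).1) (g := fun n _ => (w n).2) (fun n _ => (hw n).1) (M := max 1 M)
        (fun n _ => (hp n).le.trans (le_max_left _ _))
        (fun n _ => (hM (mem_range_self n)).trans (le_max_right _ _))
      have hlim : Tendsto (fun n => w (θ n)) atTop (𝓝 (v (), 0)) :=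
        (hv ()).prodMk_nhds
          (tendsto_zero_iff_norm_tendsto_zero.2 (hq.comp hθ.tendsto_atTop))
      have hmem := hcl.isClosed.mem_of_tendsto hlim (Eventually.of_forall fun n => hw _)
      have hnorm : ‖v ()‖ = 1 :=
        tendsto_nhds_unique (hv ()).norm ((tendsto_const_nhds (x := (1 : ℝ))).congr
          fun n => (hp _).symm)
      have hz : WGrad U (v ()) 0 := by
        intro k φ hφ
        rw [← hmem.1 k φ hφ]
        refine integral_congr_ae ?_
        filter_upwards [Lp.coeFn_zero (Pt N) 2 (volume.restrict U)] with x hx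
        change _ = ((0 : L2 U (Pt N)) : Pt N → Pt N) x k * φ x
        rw [hx]
      obtain ⟨c, hc⟩ := ae_const_of_wGrad_zero hU hUc.isPreconnected (u := v ()) (fun x hx => by
        obtain ⟨r, hr, hrU⟩ := Metric.isOpen_iff.1 hU x hx
        exact ⟨r, hr, hrU, (Lp.memLp (v ())).mono_measure (Measure.restrict_mono hrU le_rfl)⟩) hz
      have hint : ℓ (v ()) = 0 := hmem.2
      rw [hℓ] at hint
      have h2 : ∫ x in U, v () x * (1 : ℝ) = ∫ x in U, c :=
        integral_congr_ae (hc.mono fun x hx => by simp [hx])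
      rw [h2] at hint
      have hpos : 0 < volume.real U :=
        ENNReal.toReal_pos (hU.measure_pos volume hUc.nonempty).ne' hUt
      have hc0 : c = 0 := by
        simpa [hpos.ne'] using hint
      have : v () = 0 := by
        rw [Lp.eq_zero_iff_ae_eq_zero]
        filter_upwards [hc] with x hx
        rw [hx, hc0]; rfl
      rw [this] at hnorm
      simp at hnorm)
  exact ⟨C, hC, fun u g hug hu => h (u, g) ⟨hug, by
    change ℓ u = 0
    rw [hℓ]; simpa using hu⟩⟩

theorem aestronglyMeasurable_of_local {U : Set (Pt N)} {v : Pt N → ℝ}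
    (h : ∀ x ∈ U, ∃ r > 0, Metric.ball x r ⊆ U ∧
      AEStronglyMeasurable v (volume.restrict (Metric.ball x r))) :
    AEStronglyMeasurable v (volume.restrict U) := by
  choose! r hr hrU hv using h
  obtain ⟨T, hT, hTU⟩ := TopologicalSpace.isOpen_iUnion_countable
    (fun x : U => Metric.ball (x : Pt N) (r x)) fun _ => Metric.isOpen_ball
  have : Countable T := hT.to_subtype
  have hU : U = ⋃ i : T, Metric.ball ((i : U) : Pt N) (r (i : U)) := by
    refine Subset.antisymm (fun x hx => ?_) (iUnion_subset fun i => hrU _ i.1.2)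
    have hx' : x ∈ ⋃ x : U, Metric.ball (x : Pt N) (r x) :=
      mem_iUnion.2 ⟨⟨x, hx⟩, Metric.mem_ball_self (hr x hx)⟩
    rw [← hTU] at hx'
    obtain ⟨i, hi, hxi⟩ := mem_iUnion₂.1 hx'
    exact mem_iUnion.2 ⟨⟨i, hi⟩, hxi⟩
  rw [hU, aestronglyMeasurable_iUnion_iff]
  exact fun i => hv _ i.1.2

theorem contDiff_const_mul_sin (n : ℕ) :
    ContDiff ℝ 1 fun t : ℝ => ((n : ℝ) + 1) * Real.sin (t / (n + 1)) :=
  contDiff_const.mul (Real.contDiff_sin.comp (contDiff_id.div_const _))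

theorem deriv_const_mul_sin (n : ℕ) (t : ℝ) :
    deriv (fun t : ℝ => ((n : ℝ) + 1) * Real.sin (t / (n + 1))) t = Real.cos (t / (n + 1)) := by
  have h0 : (n : ℝ) + 1 ≠ 0 := by positivity
  have h := (((hasDerivAt_id t).div_const ((n : ℝ) + 1)).sin).const_mul ((n : ℝ) + 1)
  refine Eq.trans h.deriv ?_
  simp only [id]
  field_simp

/-- A function with square-integrable weak gradient on a domain with compact embedding of `H¹`
into `L²` is square-integrable, provided it is locally square-integrable. -/
theorem memLp_of_gradApprox {U : Set (Pt N)} (hU : IsOpen U) (hUc : IsConnected U)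
    (hUt : volume U ≠ ⊤)
    (hK : IsCompact (closure {u : L2 U ℝ | ∃ g : L2 U (Pt N),
      HasWeakGrad u g ∧ ‖u‖ ^ 2 + ‖g‖ ^ 2 ≤ 1}))
    {v : Pt N → ℝ} {g : Pt N → Pt N} (hg : MemLp g 2 (volume.restrict U))
    (hv : ∀ x ∈ U, ∃ r > 0, Metric.ball x r ⊆ U ∧
      MemLp v 2 (volume.restrict (Metric.ball x r)) ∧ GradApprox (Metric.ball x r) v g) :
    MemLp v 2 (volume.restrict U) := by
  have hfin : IsFiniteMeasure (volume.restrict U) := ⟨by simpa using hUt.lt_top⟩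
  have hvm : AEStronglyMeasurable v (volume.restrict U) :=
    aestronglyMeasurable_of_local fun x hx => by
      obtain ⟨r, hr, hrU, h, -⟩ := hv x hx
      exact ⟨r, hr, hrU, h.1⟩
  obtain ⟨C, hC, hP⟩ := exists_poincare hU hUc hUt hK
  obtain ⟨x₀, hx₀⟩ := hUc.nonempty
  obtain ⟨r, hr, hrU, hvB, -⟩ := hv x₀ hx₀
  set B := Metric.ball x₀ r
  -- A smooth truncation: bounded for each `n`, dominated by the identity, with derivative bounded
  -- by one and 1-Lipschitz, and converging pointwise to the identity. The composition with `v` is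
  -- square-integrable without prior knowledge of `v`.
  let f : ℕ → ℝ → ℝ := fun n t => ((n : ℝ) + 1) * Real.sin (t / (n + 1))
  have hf1 : ∀ n t, |deriv (f n) t| ≤ 1 := fun n t => by
    rw [deriv_const_mul_sin]; exact Real.abs_cos_le_one _
  have hf2 : ∀ n s t, |deriv (f n) s - deriv (f n) t| ≤ |s - t| := fun n s t => by
    rw [deriv_const_mul_sin, deriv_const_mul_sin]
    refine (Real.abs_cos_sub_cos_le _ _).trans ?_
    rw [← sub_div, abs_div]
    refine div_le_self (abs_nonneg _) ?_
    rw [abs_of_pos (by positivity)]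
    linarith [(Nat.cast_nonneg n : (0 : ℝ) ≤ n)]
  have hf3 : ∀ n t, |f n t| ≤ |t| := fun n t => by
    have hp : (0 : ℝ) < n + 1 := by positivity
    simp only [f, abs_mul, abs_of_pos hp]
    have h1 := Real.abs_sin_le_abs (x := t / (n + 1))
    rw [abs_div, abs_of_pos hp, le_div_iff₀ hp] at h1
    linarith
  have hf4 : ∀ n t, |f n t| ≤ n + 1 := fun n t => by
    have hp : (0 : ℝ) < n + 1 := by positivity
    simp only [f, abs_mul, abs_of_pos hp]
    exact mul_le_of_le_one_right hp.le (Real.abs_sin_le_one _)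
  have hfc : ∀ n, Continuous (f n) := fun n => (contDiff_const_mul_sin n).continuous
  have hdc : ∀ n, Continuous (deriv (f n)) := fun n =>
    (contDiff_const_mul_sin n).continuous_deriv le_rfl
  have hfm : ∀ n, MemLp (fun x => f n (v x)) 2 (volume.restrict U) := fun n =>
    MemLp.of_bound ((hfc n).comp_aestronglyMeasurable hvm) (n + 1) (ae_of_all _ fun x => hf4 n _)
  have hgm : ∀ n, MemLp (fun x => deriv (f n) (v x) • g x) 2 (volume.restrict U) := fun n =>
    hg.mono (((hdc n).comp_aestronglyMeasurable hvm).smul hg.1) (ae_of_all _ fun x => by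
      rw [norm_smul]
      exact mul_le_of_le_one_left (norm_nonneg _) (hf1 n _))
  let a : ℕ → ℝ := fun n => ⨍ x in U, f n (v x)
  have hw : ∀ n, WGrad U (fun x => f n (v x)) (fun x => deriv (f n) (v x) • g x) := by
    intro n
    refine WGrad.of_local hU fun x hx => ?_
    obtain ⟨ρ, hρ, hρU, h1, h2⟩ := hv x hx
    have hm := Measure.restrict_mono (μ := (volume : Measure (Pt N))) hρU le_rfl
    exact ⟨ρ, hρ, hρU, (hfm n).mono_measure hm, (hgm n).mono_measure hm,
      h2.wGrad_comp h1 (hg.mono_measure hm) (contDiff_const_mul_sin n) (hf1 n) (hf2 n)⟩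
  have hwa : ∀ n, WGrad U (fun x => f n (v x) - a n) (fun x => deriv (f n) (v x) • g x) := by
    intro n
    refine WGrad.of_local hU fun x hx => ?_
    obtain ⟨ρ, hρ, hρU, h1, h2⟩ := hv x hx
    have hm := Measure.restrict_mono (μ := (volume : Measure (Pt N))) hρU le_rfl
    have hds : ∀ t, deriv (fun t => f n t - a n) t = deriv (f n) t := fun t =>
      deriv_sub_const _
    have h3 := h2.wGrad_comp (f := fun t => f n t - a n) h1 (hg.mono_measure hm)
      ((contDiff_const_mul_sin n).sub contDiff_const) (fun t => by rw [hds]; exact hf1 n t)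
      (fun s t => by rw [hds, hds]; exact hf2 n s t)
    simp only [hds] at h3
    exact ⟨ρ, hρ, hρU, ((hfm n).sub (memLp_const _)).mono_measure hm, (hgm n).mono_measure hm, h3⟩
  have hUpos : volume.real U ≠ 0 :=
    (ENNReal.toReal_pos (hU.measure_pos volume hUc.nonempty).ne' hUt).ne'
  -- Poincaré's inequality bounds the deviation from the mean uniformly in `n`, because truncation
  -- does not increase the gradient.
  have hbound : ∀ n, eLpNorm (fun x => f n (v x) - a n) 2 (volume.restrict U) ≤
      ENNReal.ofReal C * eLpNorm g 2 (volume.restrict U) := by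
    intro n
    have hm : MemLp (fun x => f n (v x) - a n) 2 (volume.restrict U) :=
      (hfm n).sub (memLp_const _)
    have hwg : HasWeakGrad (hm.toLp _) ((hgm n).toLp _) := by
      intro k φ hφ
      have e1 := hwa n k φ hφ
      refine Eq.trans ?_ (e1.trans ?_)
      · exact integral_congr_ae ((hgm n).coeFn_toLp.mono fun x hx => by simp only [hx])
      · rw [neg_inj]
        exact integral_congr_ae (hm.coeFn_toLp.mono fun x hx => by simp only [hx])
    have h0 : ∫ x in U, hm.toLp _ x = 0 := by
      rw [integral_congr_ae hm.coeFn_toLp,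
        integral_sub ((hfm n).integrable (by norm_num)) (integrable_const _)]
      simp only [a, setAverage_eq, integral_const, smul_eq_mul]
      simp only [measureReal_restrict_apply_univ]
      field_simp
      ring
    have h2 := hP _ _ hwg h0
    have h3 : ‖(hgm n).toLp _‖ₑ ≤ eLpNorm g 2 (volume.restrict U) := by
      rw [Lp.enorm_toLp]
      refine eLpNorm_mono fun x => ?_
      rw [norm_smul]
      exact mul_le_of_le_one_left (norm_nonneg _) (hf1 n _)
    calc _ = ‖hm.toLp _‖ₑ := by rw [Lp.enorm_toLp]
      _ ≤ ENNReal.ofReal (C * ‖(hgm n).toLp _‖) := by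
          rw [← ofReal_norm]; exact ENNReal.ofReal_le_ofReal h2
      _ = ENNReal.ofReal C * ‖(hgm n).toLp _‖ₑ := by
          rw [ENNReal.ofReal_mul hC.le, ofReal_norm]
      _ ≤ _ := by gcongr
  set D := ENNReal.ofReal C * eLpNorm g 2 (volume.restrict U) with hD
  have hDt : D ≠ ⊤ := ENNReal.mul_ne_top ENNReal.ofReal_ne_top hg.2.ne
  set E := eLpNorm v 2 (volume.restrict B) with hE
  have hEt : E ≠ ⊤ := hvB.2.ne
  have hBle := Measure.restrict_mono (μ := (volume : Measure (Pt N))) hrU le_rfl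
  -- The means themselves are bounded: on the ball `B` the truncations are dominated by `v`, which
  -- is square-integrable there, and their deviations from the means are bounded by `D`.
  have hconst : ∀ n, eLpNorm (fun _ : Pt N => a n) 2 (volume.restrict B) ≤ E + D := by
    intro n
    have h1 : (fun _ : Pt N => a n) = (fun x => f n (v x)) - fun x => f n (v x) - a n := by
      ext x; simp
    rw [h1]
    refine (eLpNorm_sub_le ((hfm n).1.mono_measure hBle)
      (((hfm n).sub (memLp_const _)).1.mono_measure hBle) (by norm_num)).trans (add_le_add ?_ ?_)
    · exact eLpNorm_mono fun x => hf3 n _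
    · exact (eLpNorm_mono_measure _ hBle).trans (hbound n)
  have hBpos : volume B ≠ 0 := (Metric.measure_ball_pos _ _ hr).ne'
  have hBt : volume B ≠ ⊤ := measure_ball_lt_top.ne
  have hconstU : ∀ n, eLpNorm (fun _ : Pt N => a n) 2 (volume.restrict U) ≤
      (E + D) * ((volume B) ^ (1 / 2 : ℝ))⁻¹ * (volume U) ^ (1 / 2 : ℝ) := by
    intro n
    have h1 := hconst n
    rw [eLpNorm_const' _ (by norm_num) (by norm_num)] at h1 ⊢
    simp only [Measure.restrict_apply_univ, ENNReal.toReal_ofNat] at h1 ⊢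
    gcongr
    rw [← div_eq_mul_inv, ENNReal.le_div_iff_mul_le]
    · exact h1
    · left; simp [hBpos]
    · left; simp [hBt]
  have hfb : ∀ n, eLpNorm (fun x => f n (v x)) 2 (volume.restrict U) ≤
      D + (E + D) * ((volume B) ^ (1 / 2 : ℝ))⁻¹ * (volume U) ^ (1 / 2 : ℝ) := by
    intro n
    have h1 : (fun x => f n (v x)) = (fun x => f n (v x) - a n) + fun _ : Pt N => a n := by
      ext x; simp
    rw [h1]
    exact (eLpNorm_add_le ((hfm n).sub (memLp_const _)).1 aestronglyMeasurable_const
      (by norm_num)).trans (add_le_add (hbound n) (hconstU n))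
  refine ⟨hvm, ?_⟩
  -- Fatou's lemma carries the uniform bound from the truncations to `v`.
  refine (Lp.eLpNorm_lim_le_liminf_eLpNorm (fun n => (hfm n).1) v
    (ae_of_all _ fun x => tendsto_const_mul_sin (v x))).trans_lt ?_
  refine (liminf_le_of_le (a := D + (E + D) * ((volume B) ^ (1 / 2 : ℝ))⁻¹ *
    (volume U) ^ (1 / 2 : ℝ)) (by isBoundedDefault) fun b hb => ?_).trans_lt ?_
  · obtain ⟨n, hn⟩ := hb.exists
    exact hn.trans (hfb n)
  · have h1 : ((volume B) ^ (1 / 2 : ℝ))⁻¹ ≠ ⊤ := by simp [hBpos]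
    have h2 : (volume U) ^ (1 / 2 : ℝ) ≠ ⊤ := by simp [hUt]
    exact (ENNReal.add_ne_top.2 ⟨hDt, ENNReal.mul_ne_top (ENNReal.mul_ne_top
      (ENNReal.add_ne_top.2 ⟨hEt, hDt⟩) h1) h2⟩).lt_top

theorem HasWeakGrad.of_wGrad {U : Set (Pt N)} {u : Pt N → ℝ} {g : L2 U (Pt N)}
    (hu : MemLp u 2 (volume.restrict U)) (h : WGrad U u g) : HasWeakGrad (hu.toLp u) g := by
  intro k φ hφ
  rw [h k φ hφ, neg_inj]
  exact integral_congr_ae (hu.coeFn_toLp.mono fun x hx => by simp only [hx])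

/-- Square-integrable weakly curl-free fields on a simply connected domain with compact embedding
of `H¹` into `L²` have square-integrable potentials, with a norm estimate. -/
theorem exists_potential_norm_le {U : Set (Pt N)} (hU : IsOpen U) (hsc : IsSimplyConnected U)
    (hUt : volume U ≠ ⊤)
    (hK : IsCompact (closure {u : L2 U ℝ | ∃ g : L2 U (Pt N),
      HasWeakGrad u g ∧ ‖u‖ ^ 2 + ‖g‖ ^ 2 ≤ 1})) :
    ∃ C > 0, ∀ g : L2 U (Pt N), CurlFree U g →
      ∃ u : L2 U ℝ, HasWeakGrad u g ∧ ‖u‖ ≤ C * ‖g‖ := by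
  have hUc : IsConnected U := hsc.isPathConnected.isConnected
  have hfin : IsFiniteMeasure (volume.restrict U) := ⟨by simpa using hUt.lt_top⟩
  obtain ⟨C, hC, hP⟩ := exists_poincare hU hUc hUt hK
  refine ⟨C, hC, fun g hg => ?_⟩
  obtain ⟨v, hv⟩ := exists_potential hU hsc (Lp.memLp g) hg
  have hvm := memLp_of_gradApprox hU hUc hUt hK (Lp.memLp g) hv
  let a := ⨍ x in U, v x
  have hwm : MemLp (fun x => v x - a) 2 (volume.restrict U) := hvm.sub (memLp_const _)
  have hw : WGrad U (fun x => v x - a) g := by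
    refine WGrad.of_local hU fun x hx => ?_
    obtain ⟨ρ, hρ, hρU, h1, h2⟩ := hv x hx
    have hm := Measure.restrict_mono (μ := (volume : Measure (Pt N))) hρU le_rfl
    refine ⟨ρ, hρ, hρU, hwm.mono_measure hm, (Lp.memLp g).mono_measure hm, ?_⟩
    exact (h2.congr_add_const (c := -a) (ae_of_all _ fun x => sub_eq_add_neg _ _)).wGrad
      (hwm.mono_measure hm) ((Lp.memLp g).mono_measure hm)
  have h1 := HasWeakGrad.of_wGrad hwm hw
  refine ⟨_, h1, hP _ _ h1 ?_⟩
  have hUpos : volume.real U ≠ 0 :=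
    (ENNReal.toReal_pos (hU.measure_pos volume hUc.nonempty).ne' hUt).ne'
  rw [integral_congr_ae hwm.coeFn_toLp,
    integral_sub (hvm.integrable (by norm_num)) (integrable_const _)]
  simp only [a, setAverage_eq, integral_const, smul_eq_mul]
  simp only [measureReal_restrict_apply_univ]
  field_simp
  ring

/-! ### Korn's inequality on slices -/

/-- The `m`-th row of a tensor. -/
def rowL (m : Fin N) : Ten N →L[ℝ] Pt N :=
  LinearMap.toContinuousLinearMap
    { toFun := fun A => WithLp.toLp 2 fun k => A (m, k)
      map_add' := fun A B => by ext p; simp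
      map_smul' := fun a A => by ext p; simp }

@[simp] theorem rowL_apply (m k : Fin N) (A : Ten N) : rowL m A k = A (m, k) := rfl

theorem HasWeakCurl.curlFree_row {U : Set (Pt N)} {T : L2 U (Ten N)} (h : HasWeakCurl T 0)
    (m : Fin N) : CurlFree U fun x => rowL m (T x) := by
  have hz : ∀ (i j : Fin N), i < j → ∀ φ : Pt N → ℝ, IsTest U φ →
      ∫ x in U, T x (m, j) * pd i φ x = ∫ x in U, T x (m, i) * pd j φ x := by
    intro i j hij φ hφ
    have h1 := h m ⟨(i, j), hij⟩ φ hφ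
    have h0 : ∫ x in U, (0 : L2 U (Rot N)) x (m, ⟨(i, j), hij⟩) * φ x = 0 := by
      rw [integral_eq_zero_of_ae]
      filter_upwards [Lp.coeFn_zero (Rot N) 2 (volume.restrict U)] with x hx
      rw [hx]; simp
    have h2 : ∫ x in U, (T x (m, j) * pd i φ x - T x (m, i) * pd j φ x) =
        (∫ x in U, T x (m, j) * pd i φ x) - ∫ x in U, T x (m, i) * pd j φ x :=
      integral_sub ((MemLp.coord (Lp.memLp T) _).integrable_mul ((hφ.pd i).memLp 2 U))
        ((MemLp.coord (Lp.memLp T) _).integrable_mul ((hφ.pd j).memLp 2 U))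
    rw [h0] at h1
    change 0 = -∫ x in U, (T x (m, j) * pd i φ x - T x (m, i) * pd j φ x) at h1
    rw [h2] at h1
    linarith
  intro i j φ hφ
  simp only [rowL_apply]
  rcases lt_trichotomy i j with hij | rfl | hij
  · exact hz i j hij φ hφ
  · rfl
  · exact (hz j i hij φ hφ).symm

theorem CurlFree.congr {U : Set (Pt N)} {g g' : Pt N → Pt N} (h : CurlFree U g)
    (hg : g =ᵐ[volume.restrict U] g') : CurlFree U g' := by
  intro i j φ hφ
  have := h i j φ hφ
  rwa [integral_congr_ae (hg.mono fun x hx => by simp only [hx] :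
      (fun x => g x j * pd i φ x) =ᵐ[volume.restrict U] fun x => g' x j * pd i φ x),
    integral_congr_ae (hg.mono fun x hx => by simp only [hx] :
      (fun x => g x i * pd j φ x) =ᵐ[volume.restrict U] fun x => g' x i * pd j φ x)] at this

theorem symF_sub {Ω : Set (Pt N)} (S T : L2 Ω (Ten N)) : symF (S - T) = symF S - symF T :=
  map_sub ((symL N).compLpL 2 (volume.restrict Ω)) S T

theorem symF_smul {Ω : Set (Pt N)} (a : ℝ) (T : L2 Ω (Ten N)) : symF (a • T) = a • symF T :=
  map_smul ((symL N).compLpL 2 (volume.restrict Ω)) a T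

theorem symF_add {Ω : Set (Pt N)} (S T : L2 Ω (Ten N)) : symF (S + T) = symF S + symF T :=
  map_add ((symL N).compLpL 2 (volume.restrict Ω)) S T

theorem continuous_symF {Ω : Set (Pt N)} : Continuous fun T : L2 Ω (Ten N) => symF T :=
  ((symL N).compLpL 2 (volume.restrict Ω)).continuous

/-- On a simply connected domain with the Korn property, bounded sequences of curl-free tensor
fields whose symmetric parts tend to zero have convergent subsequences. -/
theorem KP.exists_subseq {U : Set (Pt N)} (hK : KP U) (hU : IsOpen U)
    (hsc : IsSimplyConnected U) (hUt : volume U ≠ ⊤) {R : ℕ → L2 U (Ten N)}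
    (hR : ∀ n, HasWeakCurl (R n) 0) {M : ℝ} (hM : ∀ n, ‖R n‖ ≤ M)
    (hs : Tendsto (fun n => symF (R n)) atTop (𝓝 0)) :
    ∃ θ : ℕ → ℕ, StrictMono θ ∧ CauchySeq fun n => R (θ n) := by
  obtain ⟨C, hC, hpot⟩ := exists_potential_norm_le hU hsc hUt hK.2
  obtain ⟨⟨c, hc, hkorn⟩, hcomp⟩ := hK
  let row : Fin N → L2 U (Ten N) →L[ℝ] L2 U (Pt N) := fun m => (rowL m).compLpL 2 _
  have hrow : ∀ m T, row m T =ᵐ[volume.restrict U] fun x => rowL m (T x) := fun m T =>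
    (rowL m).coeFn_compLpL T
  have hp : ∀ n m, ∃ u : L2 U ℝ, HasWeakGrad u (row m (R n)) ∧ ‖u‖ ≤ C * ‖row m (R n)‖ :=
    fun n m => hpot _ (((hR n).curlFree_row m).congr (hrow m (R n)).symm)
  choose u hu hun using hp
  have hM0 : 0 ≤ M := (norm_nonneg _).trans (hM 0)
  let Q := ∑ m, ‖row m‖
  have hrn : ∀ n m, ‖row m (R n)‖ ≤ Q * M := fun n m => by
    refine ((row m).le_opNorm _).trans ?_
    gcongr
    · exact Finset.single_le_sum (f := fun m => ‖row m‖) (fun _ _ => norm_nonneg _)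
        (Finset.mem_univ m)
    · exact hM n
  obtain ⟨v, θ, hθ, hv⟩ := exists_subseq_of_bounded_grad hcomp hu (M := max (C * (Q * M)) (Q * M))
    (fun n m => ((hun n m).trans (by gcongr; exact hrn n m)).trans (le_max_left _ _))
    (fun n m => (hrn n m).trans (le_max_right _ _))
  let emb : Fin N → L2 U ℝ →L[ℝ] L2 U (Pt N) := fun m =>
    ((ContinuousLinearMap.id ℝ ℝ).smulRight (EuclideanSpace.single m (1 : ℝ) : Pt N)).compLpL 2 _
  have hemb : ∀ m w, emb m w =ᵐ[volume.restrict U]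
      fun x => w x • (EuclideanSpace.single m (1 : ℝ) : Pt N) := fun m w =>
    ((ContinuousLinearMap.id ℝ ℝ).smulRight (EuclideanSpace.single m (1 : ℝ) : Pt N)).coeFn_compLpL w
  -- The potentials of the rows are the components of a vector field with Jacobian `R n`.
  let V : ℕ → L2 U (Pt N) := fun n => ∑ m, emb m (u n m)
  have hVx : ∀ n, ∀ᵐ x ∂volume.restrict U, ∀ m, V n x m = u n m x := by
    intro n
    have h1 : V n =ᵐ[volume.restrict U] fun x => ∑ m, emb m (u n m) x := by
      have := Lp.coeFn_finsetSum (p := 2) (μ := volume.restrict U) Finset.univ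
        (fun m => emb m (u n m))
      filter_upwards [this] with x hx
      rw [hx, Finset.sum_apply]
    filter_upwards [h1, ae_all_iff.2 fun m => hemb m (u n m)] with x hx hx' m
    rw [hx]
    simp [hx', Pi.single_apply]
  have hJ : ∀ n, HasWeakJac (V n) (R n) := by
    intro n m k φ hφ
    have h1 := hu n m k φ hφ
    have e1 : ∫ x in U, row m (R n) x k * φ x = ∫ x in U, R n x (m, k) * φ x :=
      integral_congr_ae ((hrow m (R n)).mono fun x hx => by simp only [hx, rowL_apply])
    have e2 : ∫ x in U, u n m x * pd k φ x = ∫ x in U, V n x m * pd k φ x :=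
      integral_congr_ae ((hVx n).mono fun x hx => by simp only [hx])
    rw [← e1, h1, e2]
  have hVc : CauchySeq fun n => V (θ n) := by
    have : Tendsto (fun n => V (θ n)) atTop (𝓝 (∑ m, emb m (v m))) :=
      tendsto_finsetSum _ fun m _ => ((emb m).continuous.tendsto _).comp (hv m)
    exact this.cauchySeq
  have hsc' : CauchySeq fun n => symF (R (θ n)) := (hs.comp hθ.tendsto_atTop).cauchySeq
  refine ⟨θ, hθ, ?_⟩
  rw [Metric.cauchySeq_iff] at hVc hsc' ⊢
  intro ε hε
  obtain ⟨n₁, h₁⟩ := hVc (c * ε / 2) (by positivity)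
  obtain ⟨n₂, h₂⟩ := hsc' (c * ε / 2) (by positivity)
  refine ⟨max n₁ n₂, fun n hn p hp => ?_⟩
  -- Korn's inequality for differences: the Jacobians inherit the Cauchy property from the fields
  -- and the symmetric parts.
  have h3 := hkorn (V (θ n) - V (θ p)) (R (θ n) - R (θ p))
    ((closedLinear_hasWeakJac U).sub_mem (x := (V (θ n), R (θ n))) (y := (V (θ p), R (θ p)))
      (hJ _) (hJ _))
  have h4 := h₁ n ((le_max_left _ _).trans hn) p ((le_max_left _ _).trans hp)
  have h5 := h₂ n ((le_max_right _ _).trans hn) p ((le_max_right _ _).trans hp)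
  rw [dist_eq_norm] at h4 h5 ⊢
  rw [symF_sub] at h3
  by_contra! hcon
  nlinarith [mul_le_mul_of_nonneg_left hcon hc.le]

/-! ### Gluing along a slicing -/

theorem MemLp.restrict_subset {V : Type} [NormedAddCommGroup V] {Ω U : Set (Pt N)} (hU : U ⊆ Ω)
    (T : L2 Ω V) : MemLp T 2 (volume.restrict U) :=
  (Lp.memLp T).mono_measure (Measure.restrict_mono hU le_rfl)

/-- Restriction of a square-integrable field to a smaller set. -/
def restr {V : Type} [NormedAddCommGroup V] {Ω U : Set (Pt N)} (hU : U ⊆ Ω)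
    (T : L2 Ω V) : L2 U V := (MemLp.restrict_subset hU T).toLp T

theorem coeFn_restr {V : Type} [NormedAddCommGroup V] {Ω U : Set (Pt N)} (hU : U ⊆ Ω)
    (T : L2 Ω V) : restr hU T =ᵐ[volume.restrict U] T := MemLp.coeFn_toLp _

theorem edist_restr {V : Type} [NormedAddCommGroup V] {Ω U : Set (Pt N)} (hU : U ⊆ Ω)
    (S T : L2 Ω V) :
    edist (restr hU S) (restr hU T) = eLpNorm (fun x => (S - T : L2 Ω V) x) 2 (volume.restrict U) := by
  rw [restr, restr, Lp.edist_toLp_toLp]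
  exact (eLpNorm_congr_ae (ae_mono (Measure.restrict_mono hU le_rfl) (Lp.coeFn_sub S T))).symm

theorem norm_restr_le {V : Type} [NormedAddCommGroup V] {Ω U : Set (Pt N)} (hU : U ⊆ Ω)
    (T : L2 Ω V) : ‖restr hU T‖ ≤ ‖T‖ := by
  rw [Lp.norm_def, Lp.norm_def, restr, eLpNorm_congr_ae (MemLp.coeFn_toLp _)]
  exact ENNReal.toReal_mono (Lp.eLpNorm_ne_top T)
    (eLpNorm_mono_measure _ (Measure.restrict_mono hU le_rfl))

theorem symF_restr {Ω U : Set (Pt N)} (hU : U ⊆ Ω) (T : L2 Ω (Ten N)) :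
    symF (restr hU T) = restr hU (symF T) := by
  refine Lp.ext ?_
  have h1 : symF T =ᵐ[volume.restrict U] fun x => symL N (T x) :=
    ae_mono (Measure.restrict_mono hU le_rfl) ((symL N).coeFn_compLp T)
  have h2 : symF (restr hU T) =ᵐ[volume.restrict U] fun x => symL N (restr hU T x) :=
    (symL N).coeFn_compLp _
  filter_upwards [h1, h2, coeFn_restr hU T, coeFn_restr hU (symF T)] with x e1 e2 e3 e4
  rw [e2, e3, e4, e1]

theorem HasWeakCurl.restr {Ω U : Set (Pt N)} (hU : U ⊆ Ω) {T : L2 Ω (Ten N)}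
    (h : HasWeakCurl T 0) : HasWeakCurl (restr hU T) 0 := by
  intro n p φ hφ
  have h1 := h n p φ (hφ.mono hU)
  rw [setIntegral_eq_of_eq_zero hU fun x hx => by rw [hφ.eq_zero hx, mul_zero],
    setIntegral_eq_of_eq_zero hU fun x hx => by
      rw [(hφ.pd _).eq_zero hx, (hφ.pd _).eq_zero hx, mul_zero, mul_zero, sub_zero]] at h1
  have e1 : ∫ x in U, (0 : L2 U (Rot N)) x (n, p) * φ x =
      ∫ x in U, (0 : L2 Ω (Rot N)) x (n, p) * φ x := by
    refine integral_congr_ae ?_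
    filter_upwards [Lp.coeFn_zero (Rot N) 2 (volume.restrict U),
      ae_mono (Measure.restrict_mono hU le_rfl) (Lp.coeFn_zero (Rot N) 2 (volume.restrict Ω))]
      with x hx hx'
    rw [hx, hx']
  rw [e1, h1, neg_inj]
  exact integral_congr_ae ((coeFn_restr hU T).mono fun x hx => by simp only [hx])

/-- Almost everywhere the norm of `f` is at most the sum of its restrictions to the slices, so the
triangle inequality in `L²` applies. -/
theorem eLpNorm_le_sum_slices {V : Type} [NormedAddCommGroup V] {Ω : Set (Pt N)} {J : ℕ}
    {P : Fin J → Set (Pt N)} (hP : ∀ j, IsOpen (P j)) (hPΩ : ∀ j, P j ⊆ Ω)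
    (hΩ : MeasurableSet Ω)
    (hnull : volume (Ω \ ⋃ j, P j) = 0) {f : Pt N → V}
    (hf : AEStronglyMeasurable f (volume.restrict Ω)) :
    eLpNorm f 2 (volume.restrict Ω) ≤ ∑ j, eLpNorm f 2 (volume.restrict (P j)) := by
  have h1 : ∀ᵐ x ∂volume.restrict Ω, x ∈ ⋃ j, P j := by
    rw [ae_restrict_iff' hΩ, ae_iff]
    refine measure_mono_null (fun x hx => ?_) hnull
    simp only [mem_ofPred_eq, Classical.not_imp] at hx
    exact hx
  calc eLpNorm f 2 (volume.restrict Ω)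
      ≤ eLpNorm (∑ j, (P j).indicator fun x => ‖f x‖) 2 (volume.restrict Ω) := by
        refine eLpNorm_mono_ae ?_
        filter_upwards [h1] with x hx
        obtain ⟨j, hj⟩ := mem_iUnion.1 hx
        rw [Finset.sum_apply]
        have h0 : ∀ i, 0 ≤ (P i).indicator (fun x => ‖f x‖) x :=
          fun i => indicator_nonneg (fun _ _ => norm_nonneg _) _
        rw [Real.norm_of_nonneg (Finset.sum_nonneg fun i _ => h0 i)]
        calc ‖f x‖ = (P j).indicator (fun x => ‖f x‖) x := by rw [indicator_of_mem hj]
          _ ≤ _ := Finset.single_le_sum (f := fun i => (P i).indicator (fun x => ‖f x‖) x)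
              (fun i _ => h0 i) (Finset.mem_univ j)
    _ ≤ ∑ j, eLpNorm ((P j).indicator fun x => ‖f x‖) 2 (volume.restrict Ω) :=
        eLpNorm_sum_le (fun j _ => hf.norm.indicator (hP j).measurableSet) (by norm_num)
    _ = _ := by
        refine Finset.sum_congr rfl fun j _ => ?_
        rw [eLpNorm_indicator_eq_eLpNorm_restrict (hP j).measurableSet,
          Measure.restrict_restrict (hP j).measurableSet, inter_eq_self_of_subset_left (hPΩ j),
          eLpNorm_norm]

/-- The subsequence is refined once for each slice, by induction over finite sets of slices; the
Cauchy property on earlier slices survives the refinement. The slicewise moduli of convergence are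
then added. -/
theorem IsSlicing.exists_subseq {Ω Γt : Set (Pt N)} {J : ℕ} {P : Fin J → Set (Pt N)}
    (hP : IsSlicing Ω Γt P) (hΩ : IsOpen Ω) (hΩt : volume Ω ≠ ⊤) {R : ℕ → L2 Ω (Ten N)}
    (hR : ∀ n, HasWeakCurl (R n) 0) {M : ℝ} (hM : ∀ n, ‖R n‖ ≤ M)
    (hs : Tendsto (fun n => symF (R n)) atTop (𝓝 0)) :
    ∃ θ : ℕ → ℕ, StrictMono θ ∧ CauchySeq fun n => R (θ n) := by
  have hfinset : ∀ s : Finset (Fin J), ∃ θ : ℕ → ℕ, StrictMono θ ∧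
      ∀ j ∈ s, CauchySeq fun n => restr (hP.subset j) (R (θ n)) := by
    intro s
    induction s using Finset.induction_on with
    | empty => exact ⟨id, strictMono_id, by simp⟩
    | insert j s hj ih =>
      obtain ⟨θ, hθ, hc⟩ := ih
      have hsym : Tendsto (fun n => symF (restr (hP.subset j) (R (θ n)))) atTop (𝓝 0) := by
        have h1 := tendsto_zero_iff_norm_tendsto_zero.1 (hs.comp hθ.tendsto_atTop)
        rw [tendsto_zero_iff_norm_tendsto_zero]
        refine squeeze_zero (fun _ => norm_nonneg _) (fun n => ?_) h1
        rw [symF_restr]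
        exact norm_restr_le _ _
      obtain ⟨θ', hθ', hc'⟩ := (hP.korn j).exists_subseq (hP.isOpen j) (hP.simplyConnected j)
        (measure_ne_top_of_subset (hP.subset j) hΩt) (fun n => (hR (θ n)).restr (hP.subset j))
        (M := M) (fun n => (norm_restr_le _ _).trans (hM _)) hsym
      refine ⟨θ ∘ θ', hθ.comp hθ', fun i hi => ?_⟩
      rcases Finset.mem_insert.1 hi with rfl | hi
      · exact hc'
      · exact (hc i hi).comp_tendsto hθ'.tendsto_atTop
  obtain ⟨θ, hθ, hc⟩ := hfinset Finset.univ
  refine ⟨θ, hθ, ?_⟩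
  rw [EMetric.cauchySeq_iff_le_tendsto_0] at *
  have hb : ∀ j, ∃ b : ℕ → ℝ≥0∞, (∀ n m k, k ≤ n → k ≤ m →
      edist (restr (hP.subset j) (R (θ n))) (restr (hP.subset j) (R (θ m))) ≤ b k) ∧
      Tendsto b atTop (𝓝 0) := fun j => by
    have := hc j (Finset.mem_univ j)
    rw [EMetric.cauchySeq_iff_le_tendsto_0] at this
    exact this
  choose b hb hbt using hb
  refine ⟨fun k => ∑ j, b j k, fun n m k hn hm => ?_, ?_⟩
  · rw [Lp.edist_def, eLpNorm_congr_ae (Lp.coeFn_sub (R (θ n)) (R (θ m))).symm]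
    refine (eLpNorm_le_sum_slices hP.isOpen hP.subset hΩ.measurableSet hP.null
      (Lp.aestronglyMeasurable _)).trans (Finset.sum_le_sum fun j _ => ?_)
    rw [← edist_restr (hP.subset j)]
    exact hb j n m k hn hm
  · have := tendsto_finsetSum Finset.univ fun j _ => hbt j
    simpa only [Finset.sum_const_zero] using this

/-! ### Smooth fields and their derivatives -/

section Smooth
variable {V W : Type} [NormedAddCommGroup V] [NormedSpace ℝ V] [NormedAddCommGroup W]
  [NormedSpace ℝ W]

theorem pd_clm (L : V →L[ℝ] W) {Φ : Pt N → V} (h : Differentiable ℝ Φ) (k : Fin N) (x : Pt N) :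
    pd k (fun y => L (Φ y)) x = L (pd k Φ x) := by
  have := (L.hasFDerivAt.comp x (h x).hasFDerivAt).fderiv
  simp only [pd]
  rw [show (fun y => L (Φ y)) = L ∘ Φ from rfl, this]
  rfl

theorem pd_coord {ι : Type} [Fintype ι] {Φ : Pt N → EuclideanSpace ℝ ι} (h : Differentiable ℝ Φ)
    (k : Fin N) (x : Pt N) (i : ι) : pd k (fun y => Φ y i) x = pd k Φ x i :=
  pd_clm (EuclideanSpace.proj i : EuclideanSpace ℝ ι →L[ℝ] ℝ) h k x

theorem pd_coord_eq_zero {ι : Type} [Fintype ι] {Φ : Pt N → EuclideanSpace ℝ ι}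
    (h : Differentiable ℝ Φ) {i : ι} (hi : ∀ x, Φ x i = 0) (k : Fin N) (x : Pt N) :
    pd k Φ x i = 0 := by
  rw [← pd_coord h, show (fun y => Φ y i) = fun _ => 0 from funext hi]
  simp [pd]

theorem pd_add {Φ Ψ : Pt N → V} (hΦ : Differentiable ℝ Φ) (hΨ : Differentiable ℝ Ψ) (k : Fin N)
    (x : Pt N) : pd k (fun y => Φ y + Ψ y) x = pd k Φ x + pd k Ψ x := by
  simp only [pd]
  rw [fderiv_fun_add (hΦ x) (hΨ x)]
  rfl

theorem pd_smul {Φ : Pt N → V} (hΦ : Differentiable ℝ Φ) (a : ℝ) (k : Fin N)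
    (x : Pt N) : pd k (fun y => a • Φ y) x = a • pd k Φ x := by
  simp only [pd]
  rw [fderiv_fun_const_smul (hΦ x)]
  rfl

theorem pd_zero (k : Fin N) (x : Pt N) : pd k (fun _ => (0 : V)) x = 0 := by
  simp [pd]

theorem pd_congr {Φ Ψ : Pt N → V} {x : Pt N} (h : Φ =ᶠ[𝓝 x] Ψ) (k : Fin N) :
    pd k Φ x = pd k Ψ x := by
  simp only [pd, h.fderiv_eq]

theorem pd_comm {f : Pt N → V} (hf : ContDiff ℝ (⊤ : ℕ∞) f) (k l : Fin N) (x : Pt N) :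
    pd k (pd l f) x = pd l (pd k f) x := by
  have hd : Differentiable ℝ (fderiv ℝ f) :=
    (hf.fderiv_right (m := (⊤ : ℕ∞)) (by simp)).differentiable (by simp)
  have hsym := (hf.contDiffAt (x := x)).isSymmSndFDerivAt
    (by simp only [minSmoothness_of_isRCLikeNormedField]; exact WithTop.coe_le_coe.2 le_top)
  have h1 : ∀ a b : Fin N, pd a (pd b f) x =
      fderiv ℝ (fderiv ℝ f) x (EuclideanSpace.single a 1) (EuclideanSpace.single b 1) := by
    intro a b
    have := pd_clm (ContinuousLinearMap.apply ℝ V (EuclideanSpace.single b (1 : ℝ) : Pt N)) hd a x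
    exact this
  rw [h1, h1]
  exact hsym _ _

theorem IsSmoothAway.differentiable {Ω Γ : Set (Pt N)} {Φ : Pt N → V} (h : IsSmoothAway Ω Γ Φ) :
    Differentiable ℝ Φ := h.1.differentiable (by simp)

theorem IsSmoothAway.zero {Ω Γ : Set (Pt N)} : IsSmoothAway Ω Γ fun _ : Pt N => (0 : V) :=
  ⟨contDiff_const, HasCompactSupport.zero, 1, one_pos, fun _ _ h => (h rfl).elim⟩

theorem IsSmoothAway.add {Ω Γ : Set (Pt N)} {Φ Ψ : Pt N → V} (hΦ : IsSmoothAway Ω Γ Φ)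
    (hΨ : IsSmoothAway Ω Γ Ψ) : IsSmoothAway Ω Γ fun x => Φ x + Ψ x := by
  obtain ⟨δ, hδ, h⟩ := hΦ.2.2
  obtain ⟨ε, hε, h'⟩ := hΨ.2.2
  refine ⟨hΦ.1.add hΨ.1, hΦ.2.1.add hΨ.2.1, min δ ε, lt_min hδ hε, fun x hx hne y hy => ?_⟩
  by_cases h0 : Φ x = 0
  · exact (min_le_right _ _).trans (h' x hx (fun h1 => hne (by simp only [h0, h1, add_zero])) y hy)
  · exact (min_le_left _ _).trans (h x hx h0 y hy)

theorem IsSmoothAway.comp_clm {Ω Γ : Set (Pt N)} {Φ : Pt N → V} (hΦ : IsSmoothAway Ω Γ Φ)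
    (L : V →L[ℝ] W) : IsSmoothAway Ω Γ fun x => L (Φ x) := by
  obtain ⟨δ, hδ, h⟩ := hΦ.2.2
  refine ⟨L.contDiff.comp hΦ.1, hΦ.2.1.comp_left (g := L) (map_zero L), δ, hδ,
    fun x hx hne y hy => h x hx (fun h0 => hne (by simp only [h0, map_zero])) y hy⟩

theorem IsSmoothAway.smul {Ω Γ : Set (Pt N)} {Φ : Pt N → V} (hΦ : IsSmoothAway Ω Γ Φ)
    (a : ℝ) : IsSmoothAway Ω Γ fun x => a • Φ x :=
  hΦ.comp_clm (a • ContinuousLinearMap.id ℝ V)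

/-- The closure of the graph of a linear operator on smooth fields is linear. -/
theorem closedLinear_closure_graph {Ω : Set (Pt N)} {A : (Pt N → V) → Prop}
    {D : (Pt N → V) → Pt N → W} (h0 : A fun _ => 0) (hD0 : D (fun _ => 0) = fun _ => 0)
    (hadd : ∀ Φ Ψ, A Φ → A Ψ → A (fun x => Φ x + Ψ x) ∧
      D (fun x => Φ x + Ψ x) = fun x => D Φ x + D Ψ x)
    (hsmul : ∀ (a : ℝ) Φ, A Φ → A (fun x => a • Φ x) ∧
      D (fun x => a • Φ x) = fun x => a • D Φ x) :
    ClosedLinear (closure {u : L2 Ω V × L2 Ω W | ∃ Φ, A Φ ∧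
      u.1 =ᵐ[volume.restrict Ω] Φ ∧ u.2 =ᵐ[volume.restrict Ω] D Φ}) := by
  let S : Submodule ℝ (L2 Ω V × L2 Ω W) :=
    { carrier := {u | ∃ Φ, A Φ ∧ u.1 =ᵐ[volume.restrict Ω] Φ ∧ u.2 =ᵐ[volume.restrict Ω] D Φ}
      zero_mem' := ⟨_, h0, Lp.coeFn_zero _ _ _, by rw [hD0]; exact Lp.coeFn_zero _ _ _⟩
      add_mem' := by
        rintro u v ⟨Φ, hΦ, h1, h2⟩ ⟨Ψ, hΨ, h3, h4⟩
        refine ⟨_, (hadd Φ Ψ hΦ hΨ).1, (Lp.coeFn_add _ _).trans (h1.add h3), ?_⟩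
        rw [(hadd Φ Ψ hΦ hΨ).2]
        exact (Lp.coeFn_add _ _).trans (h2.add h4)
      smul_mem' := by
        rintro a u ⟨Φ, hΦ, h1, h2⟩
        refine ⟨_, (hsmul a Φ hΦ).1, (Lp.coeFn_smul _ _).trans (h1.const_smul a), ?_⟩
        rw [(hsmul a Φ hΦ).2]
        exact (Lp.coeFn_smul _ _).trans (h2.const_smul a) }
  exact ⟨S.topologicalClosure, S.topologicalClosure_coe, isClosed_closure⟩

/-- A smooth field that vanishes in `Ω` near the boundary, extended by zero, is a test field. -/
theorem isTest_indicator {Ω : Set (Pt N)} (hΩ : IsOpen Ω) {Φ : Pt N → V}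
    (h : ContDiff ℝ (⊤ : ℕ∞) Φ) (hc : HasCompactSupport Φ)
    (h0 : ∀ x ∈ frontier Ω, ∀ᶠ y in 𝓝 x, y ∈ Ω → Φ y = 0) : IsTest Ω (Ω.indicator Φ) := by
  -- Near any point outside `Ω` the extension vanishes: at the boundary by assumption, off the
  -- closure trivially. This yields smoothness as well as the location of the support.
  have hz : ∀ x ∉ Ω, Ω.indicator Φ =ᶠ[𝓝 x] 0 := by
    intro x hx
    by_cases hxf : x ∈ frontier Ω
    · filter_upwards [h0 x hxf] with y hy
      by_cases hyΩ : y ∈ Ω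
      · rw [indicator_of_mem hyΩ, hy hyΩ]; rfl
      · rw [indicator_of_notMem hyΩ]; rfl
    · have hxc : x ∈ (closure Ω)ᶜ := fun hxc => by
        rw [hΩ.frontier_eq] at hxf
        exact hxf ⟨hxc, hx⟩
      filter_upwards [isClosed_closure.isOpen_compl.mem_nhds hxc] with y hy
      rw [indicator_of_notMem fun hyΩ => hy (subset_closure hyΩ)]; rfl
  refine ⟨contDiff_iff_contDiffAt.2 fun x => ?_, hc.mono' ((support_indicator.trans_subset
    inter_subset_right).trans (subset_tsupport _)), fun x hx => ?_⟩
  · by_cases hx : x ∈ Ω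
    · refine h.contDiffAt.congr_of_eventuallyEq ?_
      filter_upwards [hΩ.mem_nhds hx] with y hy
      rw [indicator_of_mem hy]
    · exact (contDiffAt_const (c := (0 : V))).congr_of_eventuallyEq (hz x hx)
  · by_contra hxΩ
    exact (notMem_tsupport_iff_eventuallyEq.2 (hz x hxΩ)) hx

theorem pd_indicator {Ω : Set (Pt N)} (hΩ : IsOpen Ω) (Φ : Pt N → V) {x : Pt N} (hx : x ∈ Ω)
    (k : Fin N) : pd k (Ω.indicator Φ) x = pd k Φ x :=
  pd_congr (by filter_upwards [hΩ.mem_nhds hx] with y hy; rw [indicator_of_mem hy]) k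

end Smooth

/-! ### Exterior derivative and co-derivative of smooth forms -/

theorem contDiff_coord_pd {ι : Type} [Fintype ι] {Φ : Pt N → EuclideanSpace ℝ ι}
    (h : ContDiff ℝ (⊤ : ℕ∞) Φ) (k : Fin N) (i : ι) :
    ContDiff ℝ (⊤ : ℕ∞) fun x => pd k Φ x i :=
  contDiff_euclidean.1 (contDiff_pd h) i

theorem pd_sum_coord {ι : Type} [Fintype ι] {φ : Pt N → EuclideanSpace ℝ ι}
    (h : ContDiff ℝ (⊤ : ℕ∞) φ) (s : Finset (Fin N)) (c : Fin N → ℝ) (I : Fin N → ι) (k : Fin N)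
    (x : Pt N) : pd k (fun y => ∑ l ∈ s, c l * pd l φ y (I l)) x =
      ∑ l ∈ s, c l * pd k (pd l φ) x (I l) := by
  have hd : ∀ l, DifferentiableAt ℝ (fun y => pd l φ y (I l)) x := fun l =>
    (contDiff_coord_pd h l _).differentiable (by simp) x
  have h1 := fderiv_fun_sum (u := s) fun l _ => (hd l).const_mul (c l)
  rw [pd, h1, sum_apply]
  refine Finset.sum_congr rfl fun l _ => ?_
  rw [fderiv_const_mul (hd l),
    ← pd_coord ((contDiff_pd h (k := l)).differentiable (by simp)) k x (I l)]
  rfl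

theorem contDiff_extD {Φ : Pt N → Form N} (h : ContDiff ℝ (⊤ : ℕ∞) Φ) :
    ContDiff ℝ (⊤ : ℕ∞) (extD Φ) :=
  contDiff_euclidean.2 fun _ => ContDiff.sum fun _ _ => contDiff_const.mul (contDiff_coord_pd h _ _)

theorem contDiff_coD {Φ : Pt N → Form N} (h : ContDiff ℝ (⊤ : ℕ∞) Φ) :
    ContDiff ℝ (⊤ : ℕ∞) (coD Φ) :=
  contDiff_euclidean.2 fun _ => ContDiff.sum fun _ _ => contDiff_const.mul (contDiff_coord_pd h _ _)

theorem extD_eq_zero {Φ : Pt N → Form N} {x : Pt N} (h : ∀ k, pd k Φ x = 0) : extD Φ x = 0 := by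
  ext K; simp [extD, h]

theorem coD_eq_zero {Φ : Pt N → Form N} {x : Pt N} (h : ∀ k, pd k Φ x = 0) : coD Φ x = 0 := by
  ext K; simp [coD, h]

theorem pd_eq_zero_of_notMem_tsupport {V : Type} [NormedAddCommGroup V] [NormedSpace ℝ V]
    {Φ : Pt N → V} {x : Pt N} (h : x ∉ tsupport Φ) (k : Fin N) : pd k Φ x = 0 := by
  rw [pd_congr (notMem_tsupport_iff_eventuallyEq.1 h), show (0 : Pt N → V) = fun _ => 0 from rfl,
    pd_zero]

theorem support_extD_subset (Φ : Pt N → Form N) : Function.support (extD Φ) ⊆ tsupport Φ := by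
  intro x hx
  by_contra h
  exact hx (extD_eq_zero (pd_eq_zero_of_notMem_tsupport h))

theorem support_coD_subset (Φ : Pt N → Form N) : Function.support (coD Φ) ⊆ tsupport Φ := by
  intro x hx
  by_contra h
  exact hx (coD_eq_zero (pd_eq_zero_of_notMem_tsupport h))

theorem IsTest.coD {Ω : Set (Pt N)} {φ : Pt N → Form N} (h : IsTest Ω φ) : IsTest Ω (coD φ) :=
  ⟨contDiff_coD h.1, h.2.1.mono' (support_coD_subset φ),
    (closure_minimal (support_coD_subset φ) (isClosed_tsupport φ)).trans h.2.2⟩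

theorem IsSmoothAway.extD {Ω Γ : Set (Pt N)} (hΩ : IsOpen Ω) {Φ : Pt N → Form N}
    (h : IsSmoothAway Ω Γ Φ) : IsSmoothAway Ω Γ (extD Φ) := by
  obtain ⟨δ, hδ, hd⟩ := h.2.2
  refine ⟨contDiff_extD h.1, h.2.1.mono' (support_extD_subset Φ), δ, hδ, fun x hx hne y hy => ?_⟩
  by_contra! hlt
  refine hne (extD_eq_zero fun k => ?_)
  have : Φ =ᶠ[𝓝 x] fun _ => 0 := by
    have hcont : Continuous fun z : Pt N => dist z y := by fun_prop
    filter_upwards [hΩ.mem_nhds hx, hcont.continuousAt.eventually (gt_mem_nhds hlt)] with z hz hzy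
    by_contra hz0
    exact absurd (hd z hz hz0 y hy) (not_le.2 hzy)
  rw [pd_congr this, pd_zero]

theorem extD_zero : extD (fun _ : Pt N => (0 : Form N)) = fun _ => 0 :=
  funext fun _ => extD_eq_zero fun k => pd_zero k _

theorem extD_add {Φ Ψ : Pt N → Form N} (hΦ : Differentiable ℝ Φ) (hΨ : Differentiable ℝ Ψ) :
    extD (fun x => Φ x + Ψ x) = fun x => extD Φ x + extD Ψ x := by
  funext x
  ext K
  simp [extD, pd_add hΦ hΨ, mul_add, Finset.sum_add_distrib]

theorem extD_smul {Φ : Pt N → Form N} (hΦ : Differentiable ℝ Φ) (a : ℝ) :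
    extD (fun x => a • Φ x) = fun x => a • extD Φ x := by
  funext x
  ext K
  simp [extD, pd_smul hΦ, Finset.mul_sum, mul_left_comm]

theorem sum_sum_eq_zero_of_antisymm {ι : Type*} [Fintype ι] {a : ι → ι → ℝ}
    (h : ∀ k l, a k l = - a l k) : ∑ k, ∑ l, a k l = 0 := by
  have h1 : ∑ k, ∑ l, a k l = - ∑ k, ∑ l, a k l := by
    conv_lhs => rw [Finset.sum_comm]
    rw [← Finset.sum_neg_distrib]
    refine Finset.sum_congr rfl fun k _ => ?_
    rw [← Finset.sum_neg_distrib]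
    exact Finset.sum_congr rfl fun l _ => h l k
  linarith

theorem sgn_insert_of_lt {k l : Fin N} (h : k < l) (J : Finset (Fin N)) (hk : k ∉ J) :
    sgn l (insert k J) = - sgn l J := by
  simp only [sgn, Finset.filter_insert, if_pos h]
  rw [Finset.card_insert_of_notMem (by simp [hk]), pow_succ]
  ring

theorem sgn_insert_of_not_lt {k l : Fin N} (h : ¬ k < l) (J : Finset (Fin N)) :
    sgn l (insert k J) = sgn l J := by
  simp only [sgn, Finset.filter_insert, if_neg h]

/-- Of two distinct indices only the smaller one is counted in the sign of the other, so exchanging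
the order of insertion flips exactly one sign. -/
theorem sgn_mul_sgn_insert {k l : Fin N} (hkl : k ≠ l) {J : Finset (Fin N)} (hk : k ∉ J)
    (hl : l ∉ J) : sgn k J * sgn l (insert k J) = - (sgn l J * sgn k (insert l J)) := by
  rcases lt_or_gt_of_ne hkl with h | h
  · rw [sgn_insert_of_lt h J hk, sgn_insert_of_not_lt h.not_gt]; ring
  · rw [sgn_insert_of_lt h J hl, sgn_insert_of_not_lt h.not_gt]; ring

theorem sgn_mul_sgn_erase {k l : Fin N} (hkl : k ≠ l) {K : Finset (Fin N)} (hk : k ∈ K)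
    (hl : l ∈ K) : sgn k K * sgn l (K.erase k) = - (sgn l K * sgn k (K.erase l)) := by
  set J := (K.erase k).erase l with hJ
  have h1 : K.erase k = insert l J := by
    rw [hJ, Finset.insert_erase]; simp [hkl.symm, hl]
  have h2 : K.erase l = insert k J := by
    rw [hJ, Finset.erase_right_comm, Finset.insert_erase]; simp [hkl, hk]
  have h3 : K = insert k (insert l J) := by rw [← h1, Finset.insert_erase hk]
  have hkJ : k ∉ J := by simp [hJ]
  have hlJ : l ∉ J := by simp [hJ]
  have e1 : sgn k K = sgn k (insert l J) := by
    rw [h3, sgn_insert_of_not_lt (lt_irrefl k)]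
  have e2 : sgn l K = sgn l (insert k J) := by
    rw [h3, Finset.insert_comm, sgn_insert_of_not_lt (lt_irrefl l)]
  rw [h1, h2, e1, e2, sgn_insert_of_not_lt (lt_irrefl l), sgn_insert_of_not_lt (lt_irrefl k)]
  have := sgn_mul_sgn_insert hkl hkJ hlJ
  linarith

/-- Second derivatives are symmetric in the two indices and the signs antisymmetric, so the double
sum cancels. -/
theorem coD_coD {φ : Pt N → Form N} (h : ContDiff ℝ (⊤ : ℕ∞) φ) (x : Pt N) : coD (coD φ) x = 0 := by
  ext J
  have hd : Differentiable ℝ (coD φ) := (contDiff_coD h).differentiable (by simp)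
  have hin : ∀ k (I : Finset (Fin N)), pd k (coD φ) x I =
      ∑ l ∈ Iᶜ, sgn l I * pd k (pd l φ) x (insert l I) := by
    intro k I
    rw [← pd_coord hd]
    have : (fun y => coD φ y I) = fun y => ∑ l ∈ Iᶜ, sgn l I * pd l φ y (insert l I) := rfl
    rw [this]
    exact pd_sum_coord h _ _ _ k x
  have : coD (coD φ) x J = ∑ k, ∑ l, if k ∈ Jᶜ ∧ l ∈ Jᶜ ∧ k ≠ l then
      sgn k J * (sgn l (insert k J) * pd k (pd l φ) x (insert l (insert k J))) else 0 := by
    simp only [coD]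
    rw [← Finset.sum_filter_of_ne (s := Finset.univ) (p := fun k => k ∈ Jᶜ)]
    · rw [Finset.filter_univ_mem]
      refine Finset.sum_congr rfl fun k hk => ?_
      change sgn k J * pd k (coD φ) x (insert k J) = _
      rw [hin, Finset.mul_sum, ← Finset.sum_filter]
      refine Finset.sum_congr ?_ fun _ _ => rfl
      ext l
      simp at hk ⊢
      grind
    · intro k _ hne
      by_contra hk
      exact hne (by simp [hk])
  rw [this]
  refine sum_sum_eq_zero_of_antisymm fun k l => ?_
  by_cases hc : k ∈ Jᶜ ∧ l ∈ Jᶜ ∧ k ≠ l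
  · rw [if_pos hc, if_pos ⟨hc.2.1, hc.1, hc.2.2.symm⟩, pd_comm h, Finset.insert_comm]
    have := sgn_mul_sgn_insert hc.2.2 (Finset.mem_compl.1 hc.1) (Finset.mem_compl.1 hc.2.1)
    linear_combination (pd l (pd k φ) x (insert k (insert l J))) * this
  · rw [if_neg hc, if_neg fun h' => hc ⟨h'.2.1, h'.1, h'.2.2.symm⟩, neg_zero]

theorem extD_extD {φ : Pt N → Form N} (h : ContDiff ℝ (⊤ : ℕ∞) φ) (x : Pt N) :
    extD (extD φ) x = 0 := by
  ext J
  have hd : Differentiable ℝ (extD φ) := (contDiff_extD h).differentiable (by simp)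
  have hin : ∀ k (I : Finset (Fin N)), pd k (extD φ) x I =
      ∑ l ∈ I, sgn l I * pd k (pd l φ) x (I.erase l) := by
    intro k I
    rw [← pd_coord hd]
    have : (fun y => extD φ y I) = fun y => ∑ l ∈ I, sgn l I * pd l φ y (I.erase l) := rfl
    rw [this]
    exact pd_sum_coord h _ _ _ k x
  have : extD (extD φ) x J = ∑ k, ∑ l, if k ∈ J ∧ l ∈ J ∧ k ≠ l then
      sgn k J * (sgn l (J.erase k) * pd k (pd l φ) x ((J.erase k).erase l)) else 0 := by
    simp only [extD]
    rw [← Finset.sum_filter_of_ne (s := Finset.univ) (p := fun k => k ∈ J)]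
    · rw [Finset.filter_univ_mem]
      refine Finset.sum_congr rfl fun k hk => ?_
      change sgn k J * pd k (extD φ) x (J.erase k) = _
      rw [hin, Finset.mul_sum, ← Finset.sum_filter]
      refine Finset.sum_congr ?_ fun _ _ => rfl
      ext l
      simp
      grind
    · intro k _ hne
      by_contra hk
      exact hne (by simp [hk])
  rw [this]
  refine sum_sum_eq_zero_of_antisymm fun k l => ?_
  by_cases hc : k ∈ J ∧ l ∈ J ∧ k ≠ l
  · rw [if_pos hc, if_pos ⟨hc.2.1, hc.1, hc.2.2.symm⟩, pd_comm h, Finset.erase_right_comm]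
    have := sgn_mul_sgn_erase hc.2.2 hc.1 hc.2.1
    linear_combination (pd l (pd k φ) x ((J.erase l).erase k)) * this
  · rw [if_neg hc, if_neg fun h' => hc ⟨h'.2.1, h'.1, h'.2.2.symm⟩, neg_zero]

/-! ### The closed linear spaces of forms -/

theorem closedLinear_hasWeakD (Ω : Set (Pt N)) :
    ClosedLinear {w : L2 Ω (Form N) × L2 Ω (Form N) | HasWeakD w.1 w.2} := by
  have : {w : L2 Ω (Form N) × L2 Ω (Form N) | HasWeakD w.1 w.2} =
      ⋂ (φ : {φ : Pt N → Form N // IsTest Ω φ}), {w |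
        ∫ x in Ω, inner ℝ (w.1 x) (coD φ.1 x) = - ∫ x in Ω, inner ℝ (w.2 x) (φ.1 x)} := by
    ext w; simp [HasWeakD]
  rw [this]
  refine closedLinear_of_forall fun φ => ?_
  obtain ⟨ℓ₁, h1⟩ := exists_inner_functional (φ.2.coD.memLp 2 Ω)
  obtain ⟨ℓ₂, h2⟩ := exists_inner_functional (φ.2.memLp 2 Ω)
  convert closedLinear_eq_zero (f := ℓ₁.comp (ContinuousLinearMap.fst ℝ _ _) +
    ℓ₂.comp (ContinuousLinearMap.snd ℝ _ _)) using 1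
  ext w
  simp only [mem_ofPred_eq, add_apply, ContinuousLinearMap.comp_apply,
    ContinuousLinearMap.coe_fst', ContinuousLinearMap.coe_snd', h1, h2]
  constructor <;> intro h <;> linarith

theorem closedLinear_isQForm (Ω : Set (Pt N)) (q : ℕ) :
    ClosedLinear {E : L2 Ω (Form N) | IsQForm q E} := by
  have : {E : L2 Ω (Form N) | IsQForm q E} =
      ⋂ (I : Finset (Fin N)), ⋂ (_ : I.card ≠ q), {E | ((EuclideanSpace.proj I :
        Form N →L[ℝ] ℝ).compLpL 2 (volume.restrict Ω)) E = 0} := by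
    ext E
    simp only [mem_ofPred_eq, mem_iInter, IsQForm, ae_all_iff]
    refine forall₂_congr fun I hI => ?_
    rw [Lp.eq_zero_iff_ae_eq_zero]
    have h1 := (EuclideanSpace.proj I : Form N →L[ℝ] ℝ).coeFn_compLpL (p := 2) E
    constructor
    · intro h
      filter_upwards [h, h1] with x hx hx1
      rw [hx1]
      exact hx
    · intro h
      filter_upwards [h, h1] with x hx hx1
      rw [hx1] at hx
      exact hx
  rw [this]
  exact closedLinear_of_forall fun I => closedLinear_of_forall fun _ =>
    ⟨LinearMap.ker ((EuclideanSpace.proj I : Form N →L[ℝ] ℝ).compLpL 2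
      (volume.restrict Ω)).toLinearMap, rfl,
      isClosed_eq (ContinuousLinearMap.continuous _) continuous_const⟩

theorem closedLinear_DSpace (Ω Γ : Set (Pt N)) (q : ℕ) : ClosedLinear (DSpace Ω Γ q) := by
  have h1 := closedLinear_closure_graph (Ω := Ω) (D := extD)
    (A := fun Φ : Pt N → Form N => IsSmoothAway Ω Γ Φ ∧ ∀ x I, I.card ≠ q → Φ x I = 0)
    ⟨IsSmoothAway.zero, fun _ _ _ => rfl⟩ extD_zero
    (fun Φ Ψ hΦ hΨ => ⟨⟨hΦ.1.add hΨ.1, fun x I hI => by simp [hΦ.2 x I hI, hΨ.2 x I hI]⟩,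
      extD_add hΦ.1.differentiable hΨ.1.differentiable⟩)
    (fun a Φ hΦ => ⟨⟨hΦ.1.smul a, fun x I hI => by simp [hΦ.2 x I hI]⟩,
      extD_smul hΦ.1.differentiable a⟩)
  have h2 := (((closedLinear_isQForm Ω q).preimage (ContinuousLinearMap.fst ℝ _ _)).inter
    (closedLinear_hasWeakD Ω)).inter h1
  convert h2 using 1
  ext w
  simp only [DSpace, mem_ofPred_eq, mem_inter_iff, mem_preimage, and_assoc]
  rfl

/-- The degree is raised by one on smooth forms, and having a fixed degree is a closed condition. -/
theorem isQForm_snd_of_mem_DSpace {Ω Γ : Set (Pt N)} {q : ℕ}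
    {w : L2 Ω (Form N) × L2 Ω (Form N)} (h : w ∈ DSpace Ω Γ q) : IsQForm (q + 1) w.2 := by
  have hc := ((closedLinear_isQForm Ω (q + 1)).preimage
    (ContinuousLinearMap.snd ℝ (L2 Ω (Form N)) (L2 Ω (Form N)))).isClosed
  refine closure_minimal ?_ hc h.2.2
  rintro u ⟨Φ, hΦ, hq, -, h2⟩
  change IsQForm (q + 1) u.2
  filter_upwards [h2] with x hx I hI
  rw [hx]
  refine Finset.sum_eq_zero fun k hk => ?_
  rw [pd_coord_eq_zero hΦ.differentiable (fun y => hq y _ ?_), mul_zero]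
  have := Finset.card_erase_add_one hk
  omega

/-- The weak condition follows from `δ δ = 0` on test forms, the approximation from `d d = 0` on
smooth forms; `d` keeps the distance of the support to the boundary part. -/
theorem exact_mem_DSpace {Ω Γ : Set (Pt N)} (hΩ : IsOpen Ω) {q : ℕ}
    {w : L2 Ω (Form N) × L2 Ω (Form N)} (h : w ∈ DSpace Ω Γ q) :
    ((w.2, 0) : L2 Ω (Form N) × L2 Ω (Form N)) ∈ DSpace Ω Γ (q + 1) := by
  refine ⟨isQForm_snd_of_mem_DSpace h, fun φ hφ => ?_, ?_⟩
  · have h1 := h.2.1 (coD φ) hφ.coD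
    have h2 : ∫ x in Ω, inner ℝ (w.1 x) (coD (coD φ) x) = 0 := by
      simp [coD_coD hφ.1]
    have h3 : ∫ x in Ω, inner ℝ ((0 : L2 Ω (Form N)) x) (φ x) = 0 := by
      refine integral_eq_zero_of_ae ?_
      filter_upwards [Lp.coeFn_zero (Form N) 2 (volume.restrict Ω)] with x hx
      rw [hx]; simp
    change ∫ x in Ω, inner ℝ (w.2 x) (coD φ x) = -∫ x in Ω, inner ℝ ((0 : L2 Ω (Form N)) x) (φ x)
    rw [h3]
    linarith
  · have hcont : Continuous fun u : L2 Ω (Form N) × L2 Ω (Form N) =>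
      ((u.2, 0) : L2 Ω (Form N) × L2 Ω (Form N)) := by fun_prop
    refine map_mem_closure (f := fun u : L2 Ω (Form N) × L2 Ω (Form N) =>
      ((u.2, 0) : L2 Ω (Form N) × L2 Ω (Form N))) hcont h.2.2 ?_
    rintro u ⟨Φ, hΦ, hq, -, h2⟩
    refine ⟨extD Φ, hΦ.extD hΩ, fun x I hI => ?_, h2, ?_⟩
    · refine Finset.sum_eq_zero fun k hk => ?_
      rw [pd_coord_eq_zero hΦ.differentiable (fun y => hq y _ ?_), mul_zero]
      have := Finset.card_erase_add_one hk
      omega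
    · rw [show extD (extD Φ) = fun _ => 0 from funext (extD_extD hΦ.1)]
      exact Lp.coeFn_zero _ _ _

/-! ### Orthogonal splitting, Maxwell estimate and closed range of the exterior derivative -/

theorem ClosedLinear.exists_orthogonal {H : Type*} [NormedAddCommGroup H] [InnerProductSpace ℝ H]
    [CompleteSpace H] {s : Set H} (hs : ClosedLinear s) (x : H) :
    ∃ y ∈ s, ∀ z ∈ s, inner ℝ (x - y) z = 0 := by
  obtain ⟨S, rfl, hS⟩ := hs
  have : CompleteSpace S := hS.completeSpace_coe
  refine ⟨S.starProjection x, S.starProjection_apply_mem x, fun z hz => ?_⟩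
  exact S.starProjection_inner_eq_zero x z hz

theorem closedLinear_closed_forms (Ω Γ : Set (Pt N)) (q : ℕ) :
    ClosedLinear {E : L2 Ω (Form N) | ((E, 0) : L2 Ω (Form N) × L2 Ω (Form N)) ∈ DSpace Ω Γ q} :=
  (closedLinear_DSpace Ω Γ q).preimage (ContinuousLinearMap.inl ℝ _ _)

/-- Maxwell estimate. -/
theorem exists_norm_le_of_orthogonal {Ω Γt : Set (Pt N)} (hΩ : IsOpen Ω) (hmcp : MCP Ω Γt)
    (hmap : MAP Ω Γt) :
    ∃ C > 0, ∀ w ∈ {w | w ∈ DSpace Ω Γt 1 ∧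
        ∀ z, ((z, 0) : L2 Ω (Form N) × L2 Ω (Form N)) ∈ DSpace Ω Γt 1 → inner ℝ w.1 z = 0},
      ‖w.1‖ ≤ C * ‖w.2‖ := by
  have hcl := closedLinear_DSpace Ω Γt 1
  refine exists_le_mul_of_seq (p := fun w : L2 Ω (Form N) × L2 Ω (Form N) => ‖w.1‖)
    (q := fun w => ‖w.2‖) ?_ (fun a w => by simp [norm_smul]) (fun a w => by simp [norm_smul])
    (fun w => norm_nonneg _) ?_
  · rintro a w ⟨hw, hz⟩
    exact ⟨hcl.smul_mem a hw, fun z hz' => by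
      rw [Prod.smul_fst, real_inner_smul_left, hz z hz', mul_zero]⟩
  intro w hw hp hq
  obtain ⟨M, hM⟩ := hq.bddAbove_range
  have hM0 : 0 ≤ M := (norm_nonneg _).trans (hM (mem_range_self 0))
  -- Exact forms are closed, so `(w n).1` is orthogonal to them; the approximation property makes it
  -- co-closed with vanishing normal trace, and the co-derivative contributes nothing to the norm in
  -- `MCP`.
  have hco : ∀ (a : ℝ) n, ((a • (w n).1, 0) : L2 Ω (Form N) × L2 Ω (Form N)) ∈
      CoDSpace Ω (gammaN Ω Γt) 1 := by
    intro a n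
    have : a • (w n).1 ∈ {H : L2 Ω (Form N) | (H, 0) ∈ CoDSpace Ω (gammaN Ω Γt) 1} := by
      rw [(hmap 1).2]
      refine ⟨(closedLinear_isQForm Ω 1).smul_mem a (hw n).1.1, fun r hr u hu => ?_⟩
      obtain rfl : r = 0 := by omega
      rw [real_inner_smul_left, (hw n).2 _ (exact_mem_DSpace hΩ hu), mul_zero]
    exact this
  have ha : 0 < 2 * (M + 1) := by positivity
  obtain ⟨v, θ, hθ, hv⟩ := exists_subseq_tendsto_of_compact (ι := Unit) (hmcp 1)
    (inv_pos.2 ha).ne' (u := fun n _ => (w n).1) (fun n _ => subset_closure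
      ⟨(2 * (M + 1))⁻¹ • (w n).2, 0, hcl.smul_mem (x := w n) _ (hw n).1, hco _ n, by
        have hb : ∀ t : ℝ, 0 ≤ t → t ≤ M + 1 → ((2 * (M + 1))⁻¹ * t) ^ 2 ≤ 1 / 4 := by
          intro t ht htM
          have h1 : (2 * (M + 1))⁻¹ * t ≤ 1 / 2 := by
            rw [inv_mul_le_iff₀ ha]
            linarith
          have h0 : 0 ≤ (2 * (M + 1))⁻¹ * t := by positivity
          nlinarith
        have h2 : ‖(w n).1‖ = 1 := hp n
        have h3 : ‖(w n).2‖ ≤ M := hM (mem_range_self n)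
        rw [norm_smul, norm_smul, Real.norm_of_nonneg (inv_pos.2 ha).le, norm_zero]
        linarith [hb _ (norm_nonneg _) (h2.le.trans (by linarith)),
          hb _ (norm_nonneg _) (h3.trans (by linarith))]⟩)
  have hlim : Tendsto (fun n => w (θ n)) atTop (𝓝 (v (), 0)) :=
    (hv ()).prodMk_nhds (tendsto_zero_iff_norm_tendsto_zero.2 (hq.comp hθ.tendsto_atTop))
  have hmem := hcl.isClosed.mem_of_tendsto hlim (Eventually.of_forall fun n => (hw _).1)
  have hnorm : ‖v ()‖ = 1 :=
    tendsto_nhds_unique (hv ()).norm ((tendsto_const_nhds (x := (1 : ℝ))).congr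
      fun n => (hp _).symm)
  -- The limit is closed, so every member of the sequence is orthogonal to it, and therefore the
  -- limit is orthogonal to itself.
  have h0 : inner ℝ (v ()) (v ()) = (0 : ℝ) :=
    tendsto_nhds_unique ((hv ()).inner tendsto_const_nhds)
      (tendsto_const_nhds.congr fun n => ((hw (θ n)).2 _ hmem).symm)
  rw [inner_self_eq_zero] at h0
  rw [h0, norm_zero] at hnorm
  exact zero_ne_one hnorm

theorem exists_closed_part {Ω Γt : Set (Pt N)} {w : L2 Ω (Form N) × L2 Ω (Form N)}
    (hw : w ∈ DSpace Ω Γt 1) :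
    ∃ E : L2 Ω (Form N), ((E, 0) : L2 Ω (Form N) × L2 Ω (Form N)) ∈ DSpace Ω Γt 1 ∧
      (w.1 - E, w.2) ∈ {w | w ∈ DSpace Ω Γt 1 ∧
        ∀ z, ((z, 0) : L2 Ω (Form N) × L2 Ω (Form N)) ∈ DSpace Ω Γt 1 → inner ℝ w.1 z = 0} := by
  obtain ⟨E, hE, hE'⟩ := (closedLinear_closed_forms Ω Γt 1).exists_orthogonal w.1
  refine ⟨E, hE, ?_, fun z hz => hE' z hz⟩
  have := (closedLinear_DSpace Ω Γt 1).sub_mem hw hE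
  rwa [show w - (E, 0) = (w.1 - E, w.2) by ext1 <;> simp] at this

/-- Linear operators whose inverse is bounded have closed range. -/
theorem ClosedLinear.closedLinear_range {X Y : Type*} [NormedAddCommGroup X] [NormedSpace ℝ X]
    [CompleteSpace X] [NormedAddCommGroup Y] [NormedSpace ℝ Y] {s t : Set (X × Y)}
    (hs : ClosedLinear s) (hts : t ⊆ s) (hsub : ∀ v ∈ t, ∀ w ∈ t, v - w ∈ t)
    {C : ℝ} (hC : 0 < C) (hest : ∀ w ∈ t, ‖w.1‖ ≤ C * ‖w.2‖)
    (hex : ∀ w ∈ s, ∃ E, (E, w.2) ∈ t) : ClosedLinear {F | ∃ E, (E, F) ∈ s} := by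
  have hcl := hs.isClosed
  obtain ⟨S, hS, -⟩ := hs
  refine ⟨S.map (LinearMap.snd ℝ _ _), ?_, ?_⟩
  · ext F
    simp [← hS]
  · refine isClosed_of_closure_subset fun F hF => ?_
    obtain ⟨f, hf, hlim⟩ := mem_closure_iff_seq_limit.1 hF
    choose E' hE' using hf
    choose E hE using fun n => hex _ (hE' n)
    have hcau : CauchySeq E := by
      have hfc := hlim.cauchySeq
      rw [Metric.cauchySeq_iff] at hfc ⊢
      intro ε hε
      obtain ⟨n₀, hn₀⟩ := hfc (ε / C) (by positivity)
      refine ⟨n₀, fun n hn m hm => ?_⟩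
      have h1 := hn₀ n hn m hm
      rw [dist_eq_norm] at h1 ⊢
      have h2 := hest _ (hsub _ (hE n) _ (hE m))
      rw [lt_div_iff₀ hC, mul_comm] at h1
      exact h2.trans_lt h1
    obtain ⟨G, hG⟩ := cauchySeq_tendsto_of_complete hcau
    exact ⟨G, hcl.mem_of_tendsto (hG.prodMk_nhds hlim) (Eventually.of_forall fun n => hts (hE n))⟩

/-- Subtracting the closed part of `E` keeps `d E`, and for the remainder the Maxwell estimate
bounds the form by its derivative; a bounded inverse gives closed range. -/
theorem closedLinear_exact_forms {Ω Γt : Set (Pt N)} (hΩ : IsOpen Ω) (hmcp : MCP Ω Γt)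
    (hmap : MAP Ω Γt) :
    ClosedLinear {F : L2 Ω (Form N) | ∃ E : L2 Ω (Form N), (E, F) ∈ DSpace Ω Γt 1} := by
  obtain ⟨C, hC, hest⟩ := exists_norm_le_of_orthogonal hΩ hmcp hmap
  have hcl := closedLinear_DSpace Ω Γt 1
  refine hcl.closedLinear_range (fun w hw => hw.1) (fun v hv w hw => ?_) hC hest fun w hw => ?_
  · refine ⟨hcl.sub_mem hv.1 hw.1, fun z hz => ?_⟩
    rw [Prod.fst_sub, inner_sub_left, hv.2 z hz, hw.2 z hz, sub_zero]
  · obtain ⟨E, -, hE⟩ := exists_closed_part hw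
    exact ⟨_, hE⟩

theorem IsSmoothAway.eventually_eq_zero {V : Type} [NormedAddCommGroup V] [NormedSpace ℝ V]
    {Ω Γ : Set (Pt N)} {Φ : Pt N → V} (h : IsSmoothAway Ω Γ Φ) {x : Pt N} (hx : x ∈ Γ) :
    ∀ᶠ y in 𝓝 x, y ∈ Ω → Φ y = 0 := by
  obtain ⟨δ, hδ, hd⟩ := h.2.2
  filter_upwards [Metric.ball_mem_nhds x hδ] with y hy hyΩ
  by_contra h0
  exact absurd (hd y hyΩ h0 x hx) (not_le.2 (Metric.mem_ball.1 hy))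

/-- Forms with weak exterior derivative and forms with vanishing normal trace. -/
theorem HasWeakD.inner_add_inner {Ω : Set (Pt N)} (hΩ : IsOpen Ω) {E F : L2 Ω (Form N)}
    (h : HasWeakD E F) {q : ℕ} {w : L2 Ω (Form N) × L2 Ω (Form N)}
    (hw : w ∈ CoDSpace Ω (gammaN Ω ∅) q) : inner ℝ F w.1 + inner ℝ E w.2 = (0 : ℝ) := by
  have hg : gammaN Ω ∅ = frontier Ω := by simp [gammaN]
  have hc : IsClosed {w : L2 Ω (Form N) × L2 Ω (Form N) |
      inner ℝ F w.1 + inner ℝ E w.2 = (0 : ℝ)} :=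
    isClosed_eq (by fun_prop) continuous_const
  refine closure_minimal ?_ hc hw.2.2
  rintro u ⟨Φ, hΦ, -, h1, h2⟩
  rw [hg] at hΦ
  -- The normal trace vanishes on the whole boundary, so the approximants extended by zero are
  -- admissible in the weak definition.
  have ht := isTest_indicator hΩ hΦ.1 hΦ.2.1 fun x hx => hΦ.eventually_eq_zero hx
  have h3 := h _ ht
  have e1 : ∫ x in Ω, inner ℝ (E x) (coD (Ω.indicator Φ) x) = inner ℝ E u.2 := by
    rw [L2.inner_def]
    refine integral_congr_ae ?_
    filter_upwards [h2, ae_restrict_mem hΩ.measurableSet] with x hx hxΩ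
    rw [hx]
    congr 1
    simp only [coD, pd_indicator hΩ Φ hxΩ]
  have e2 : ∫ x in Ω, inner ℝ (F x) (Ω.indicator Φ x) = inner ℝ F u.1 := by
    rw [L2.inner_def]
    refine integral_congr_ae ?_
    filter_upwards [h1, ae_restrict_mem hΩ.measurableSet] with x hx hxΩ
    rw [hx, indicator_of_mem hxΩ]
  rw [e1, e2] at h3
  change inner ℝ F u.1 + inner ℝ E u.2 = (0 : ℝ)
  rw [h3]; ring

/-- Weak equals strong when no boundary condition is imposed. Project `F` onto the closed space of
exact forms: the remainder is co-closed with vanishing normal trace, hence orthogonal to `F` by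
partial integration, hence zero. Then `E` differs from a strong potential of `F` by a weakly closed
form, which the approximation property recognises as strongly closed. -/
theorem HasWeakD.mem_DSpace {Ω : Set (Pt N)} (hΩ : IsOpen Ω) (hmcp : MCP Ω ∅)
    (hmap : MAP Ω ∅) {E F : L2 Ω (Form N)} (h : HasWeakD E F) (hE : IsQForm 1 E)
    (hF : IsQForm 2 F) : (E, F) ∈ DSpace Ω ∅ 1 := by
  obtain ⟨F1, ⟨E1, hE1⟩, hperp⟩ := (closedLinear_exact_forms hΩ hmcp hmap).exists_orthogonal F
  have hco : F - F1 ∈ {H : L2 Ω (Form N) | (H, 0) ∈ CoDSpace Ω (gammaN Ω ∅) 2} := by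
    rw [(hmap 2).2]
    refine ⟨(closedLinear_isQForm Ω 2).sub_mem hF (isQForm_snd_of_mem_DSpace hE1),
      fun r hr u hu => ?_⟩
    obtain rfl : r = 1 := by omega
    exact hperp _ ⟨u.1, hu⟩
  have h1 := h.inner_add_inner hΩ hco
  have h2 := hperp F1 ⟨E1, hE1⟩
  have h3 : inner ℝ (F - F1) (F - F1) = (0 : ℝ) := by
    dsimp only at h1
    rw [inner_zero_right, add_zero, real_inner_comm] at h1
    rw [inner_sub_right, h1, h2, sub_zero]
  rw [inner_self_eq_zero, sub_eq_zero] at h3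
  subst h3
  have hd : HasWeakD (E - E1) 0 := by
    have := (closedLinear_hasWeakD Ω).sub_mem (x := (E, F)) (y := (E1, F)) h hE1.2.1
    simpa using this
  have h4 : E - E1 ∈ {E : L2 Ω (Form N) | (E, 0) ∈ DSpace Ω ∅ 1} := by
    rw [(hmap 1).1]
    refine ⟨(closedLinear_isQForm Ω 1).sub_mem hE hE1.1, fun w hw => ?_⟩
    have := hd.inner_add_inner hΩ hw
    rwa [inner_zero_left, zero_add] at this
  have := (closedLinear_DSpace Ω ∅ 1).add_mem h4 hE1
  simpa using this

/-! ### Rows of tensor fields as differential forms -/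

/-- The `1`-form given by the `m`-th row of a tensor. -/
def rowForm (m : Fin N) : Ten N →L[ℝ] Form N :=
  LinearMap.toContinuousLinearMap
    { toFun := fun A => WithLp.toLp 2 fun I => ∑ k, if I = {k} then A (m, k) else 0
      map_add' := fun A B => by
        ext I; simp only [PiLp.add_apply, ← Finset.sum_add_distrib]
        exact Finset.sum_congr rfl fun k _ => by split_ifs <;> simp
      map_smul' := fun a A => by
        ext I; simp only [PiLp.smul_apply, Finset.smul_sum, RingHom.id_apply]
        exact Finset.sum_congr rfl fun k _ => by split_ifs <;> simp }

/-- The `2`-form given by the `m`-th row of a rotation. -/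
def rowRot (m : Fin N) : Rot N →L[ℝ] Form N :=
  LinearMap.toContinuousLinearMap
    { toFun := fun C => WithLp.toLp 2 fun I => ∑ p : {p : Fin N × Fin N // p.1 < p.2},
        if I = {p.1.1, p.1.2} then C (m, p) else 0
      map_add' := fun A B => by
        ext I; simp only [PiLp.add_apply, ← Finset.sum_add_distrib]
        exact Finset.sum_congr rfl fun k _ => by split_ifs <;> simp
      map_smul' := fun a A => by
        ext I; simp only [PiLp.smul_apply, Finset.smul_sum, RingHom.id_apply]
        exact Finset.sum_congr rfl fun k _ => by split_ifs <;> simp }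

/-- The tensor whose `m`-th row is given by the `1`-form part of a form. -/
def formRow (m : Fin N) : Form N →L[ℝ] Ten N :=
  LinearMap.toContinuousLinearMap
    { toFun := fun E => WithLp.toLp 2 fun q => if q.1 = m then E {q.2} else 0
      map_add' := fun A B => by ext q; simp only [PiLp.add_apply]; split_ifs <;> simp
      map_smul' := fun a A => by
        ext q; simp only [PiLp.smul_apply, RingHom.id_apply]; split_ifs <;> simp }

theorem rowForm_apply (m : Fin N) (A : Ten N) (I : Finset (Fin N)) :
    rowForm m A I = ∑ k, if I = {k} then A (m, k) else 0 := rfl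

theorem rowRot_apply (m : Fin N) (C : Rot N) (I : Finset (Fin N)) :
    rowRot m C I = ∑ p : {p : Fin N × Fin N // p.1 < p.2},
      if I = {p.1.1, p.1.2} then C (m, p) else 0 := rfl

theorem formRow_apply (m : Fin N) (E : Form N) (q : Fin N × Fin N) :
    formRow m E q = if q.1 = m then E {q.2} else 0 := rfl

@[simp] theorem rowForm_singleton (m k : Fin N) (A : Ten N) : rowForm m A {k} = A (m, k) := by
  simp [rowForm_apply]

theorem pair_inj {p q : {p : Fin N × Fin N // p.1 < p.2}} :
    ({p.1.1, p.1.2} : Finset (Fin N)) = {q.1.1, q.1.2} ↔ p = q := by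
  refine ⟨fun h => ?_, fun h => by rw [h]⟩
  obtain ⟨⟨a, b⟩, hp⟩ := p
  obtain ⟨⟨c, d⟩, hq⟩ := q
  simp only [Finset.ext_iff, Finset.mem_insert, Finset.mem_singleton] at h
  have h1 := (h a).1 (Or.inl rfl)
  have h2 := (h b).1 (Or.inr rfl)
  simp only at hp hq
  rcases h1 with rfl | rfl <;> rcases h2 with rfl | rfl
  · exact absurd hp (lt_irrefl _)
  · rfl
  · exact absurd hp hq.not_gt
  · exact absurd hp (lt_irrefl _)

@[simp] theorem rowRot_pair (m : Fin N) (C : Rot N) (p : {p : Fin N × Fin N // p.1 < p.2}) :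
    rowRot m C {p.1.1, p.1.2} = C (m, p) := by
  simp [rowRot_apply, pair_inj]

theorem rowForm_eq_zero (m : Fin N) (A : Ten N) {I : Finset (Fin N)} (h : I.card ≠ 1) :
    rowForm m A I = 0 := by
  rw [rowForm_apply]
  refine Finset.sum_eq_zero fun k _ => if_neg fun h' => h ?_
  rw [h', Finset.card_singleton]

theorem rowRot_eq_zero (m : Fin N) (C : Rot N) {I : Finset (Fin N)} (h : I.card ≠ 2) :
    rowRot m C I = 0 := by
  rw [rowRot_apply]
  refine Finset.sum_eq_zero fun p _ => if_neg fun h' => h ?_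
  rw [h', Finset.card_pair p.2.ne]

theorem inner_rowForm (m : Fin N) (A : Ten N) (ψ : Form N) :
    inner ℝ (rowForm m A) ψ = ∑ k, A (m, k) * ψ {k} := by
  simp only [PiLp.inner_apply, rowForm_apply, RCLike.inner_apply, conj_trivial, Finset.mul_sum]
  rw [Finset.sum_comm]
  refine Finset.sum_congr rfl fun k _ => ?_
  simp [mul_comm]

theorem inner_rowRot (m : Fin N) (C : Rot N) (ψ : Form N) :
    inner ℝ (rowRot m C) ψ =
      ∑ p : {p : Fin N × Fin N // p.1 < p.2}, C (m, p) * ψ {p.1.1, p.1.2} := by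
  simp only [PiLp.inner_apply, rowRot_apply, RCLike.inner_apply, conj_trivial, Finset.mul_sum]
  rw [Finset.sum_comm]
  refine Finset.sum_congr rfl fun k _ => ?_
  simp [mul_comm]

/-- Every off-diagonal position comes from exactly one increasing pair, read in one of two orders.
-/
theorem sum_sum_compl_singleton (f : Fin N → Fin N → ℝ) :
    ∑ k, ∑ l ∈ {k}ᶜ, f k l =
      ∑ p : {p : Fin N × Fin N // p.1 < p.2}, (f p.1.2 p.1.1 + f p.1.1 p.1.2) := by
  have h1 : ∑ p : {p : Fin N × Fin N // p.1 < p.2}, (f p.1.2 p.1.1 + f p.1.1 p.1.2) =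
      ∑ i, ∑ j, if i < j then f j i + f i j else 0 := by
    rw [← Fintype.sum_prod_type' (f := fun i j => if i < j then f j i + f i j else 0),
      ← Finset.sum_filter]
    exact (Finset.sum_subtype (Finset.univ.filter fun p : Fin N × Fin N => p.1 < p.2) (by simp)
      fun p => f p.2 p.1 + f p.1 p.2).symm
  have h2 : ∀ k, ∑ l ∈ {k}ᶜ, f k l =
      (∑ l, if l < k then f k l else 0) + ∑ l, if k < l then f k l else 0 := by
    intro k
    rw [← Finset.sum_add_distrib, ← Finset.sum_filter_of_ne (s := Finset.univ)
      (p := fun l => l ≠ k)]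
    · refine Finset.sum_congr (by ext; simp) fun l hl => ?_
      have hl' : l ≠ k := by simpa using hl
      rcases lt_or_gt_of_ne hl' with h | h
      · simp [h, h.not_gt]
      · simp [h, h.not_gt]
    · rintro l - hne rfl
      simp at hne
  rw [h1, Finset.sum_congr rfl fun k _ => h2 k, Finset.sum_add_distrib, Finset.sum_comm,
    ← Finset.sum_add_distrib]
  refine Finset.sum_congr rfl fun i _ => ?_
  rw [← Finset.sum_add_distrib]
  refine Finset.sum_congr rfl fun j _ => ?_
  split_ifs <;> simp

theorem sgn_singleton_of_lt {i j : Fin N} (h : i < j) : sgn i {j} = 1 := by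
  simp [sgn, Finset.filter_singleton, h.not_gt]

theorem sgn_singleton_of_gt {i j : Fin N} (h : i < j) : sgn j {i} = -1 := by
  simp [sgn, Finset.filter_singleton, h]

/-- For `i < j` the signs of `i` at `{j}` and `j` at `{i}` are `1` and `-1`, so the pairing
reproduces the antisymmetrised integrand of the weak rotation. This identifies row-wise rotation
with the exterior derivative of 1-forms. -/
theorem inner_rowForm_coD (m : Fin N) (A : Ten N) (φ : Pt N → Form N) (x : Pt N) :
    inner ℝ (rowForm m A) (coD φ x) =
      ∑ p : {p : Fin N × Fin N // p.1 < p.2}, (A (m, p.1.2) * pd p.1.1 φ x {p.1.1, p.1.2} -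
        A (m, p.1.1) * pd p.1.2 φ x {p.1.1, p.1.2}) := by
  have h1 : inner ℝ (rowForm m A) (coD φ x) =
      ∑ k, ∑ l ∈ {k}ᶜ, A (m, k) * (sgn l {k} * pd l φ x (insert l {k})) := by
    rw [inner_rowForm]
    exact Finset.sum_congr rfl fun k _ => by rw [← Finset.mul_sum]; rfl
  rw [h1, sum_sum_compl_singleton]
  refine Finset.sum_congr rfl fun p _ => ?_
  rw [sgn_singleton_of_lt p.2, sgn_singleton_of_gt p.2, Finset.pair_comm p.1.2 p.1.1]
  ring

/-- Only sets of two elements contribute; erasing one element leaves the singleton that carries the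
entry, with signs `1` and `-1`. -/
theorem extD_rowForm (m : Fin N) {Φ : Pt N → Ten N} (h : Differentiable ℝ Φ) (x : Pt N) :
    extD (fun y => rowForm m (Φ y)) x = rowRot m (curlS Φ x) := by
  ext K
  have h1 : extD (fun y => rowForm m (Φ y)) x K =
      ∑ k ∈ K, sgn k K * rowForm m (pd k Φ x) (K.erase k) := by
    simp only [extD, pd_clm _ h]
  rw [h1]
  by_cases hK : K.card = 2
  · obtain ⟨p, rfl⟩ : ∃ p : {p : Fin N × Fin N // p.1 < p.2}, K = {p.1.1, p.1.2} := by
      obtain ⟨a, b, hab, rfl⟩ := Finset.card_eq_two.1 hK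
      rcases lt_or_gt_of_ne hab with h | h
      · exact ⟨⟨(a, b), h⟩, rfl⟩
      · exact ⟨⟨(b, a), h⟩, Finset.pair_comm a b⟩
    obtain ⟨⟨i, j⟩, hij⟩ := p
    have hij' : i < j := hij
    rw [rowRot_pair, Finset.sum_pair hij'.ne]
    have e1 : ({i, j} : Finset (Fin N)).erase i = {j} := by
      ext a; simp; grind
    have e2 : ({i, j} : Finset (Fin N)).erase j = {i} := by
      ext a; simp; grind
    have e3 : sgn i {i, j} = 1 := by
      rw [sgn_insert_of_not_lt (lt_irrefl i), sgn_singleton_of_lt hij']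
    have e4 : sgn j {i, j} = -1 := by
      rw [Finset.pair_comm, sgn_insert_of_not_lt (lt_irrefl j), sgn_singleton_of_gt hij']
    rw [e1, e2, e3, e4, rowForm_singleton, rowForm_singleton]
    change _ = pd i Φ x (m, j) - pd j Φ x (m, i)
    ring
  · rw [rowRot_eq_zero m _ hK]
    refine Finset.sum_eq_zero fun k hk => ?_
    rw [rowForm_eq_zero, mul_zero]
    have := Finset.card_erase_add_one hk
    omega

theorem IsTest.coord {ι : Type} [Fintype ι] {Ω : Set (Pt N)} {φ : Pt N → EuclideanSpace ℝ ι}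
    (h : IsTest Ω φ) (i : ι) : IsTest Ω fun x => φ x i := by
  have hs : Function.support (fun x => φ x i) ⊆ Function.support φ := fun x hx h0 => hx (by
    change φ x i = 0
    rw [show φ x = 0 from h0]; rfl)
  exact ⟨contDiff_euclidean.1 h.1 i, h.2.1.mono hs, (closure_mono hs).trans h.2.2⟩

theorem HasWeakCurl.hasWeakD {Ω : Set (Pt N)} {T : L2 Ω (Ten N)} {C : L2 Ω (Rot N)}
    (h : HasWeakCurl T C) (m : Fin N) :
    HasWeakD ((rowForm m).compLpL 2 (volume.restrict Ω) T)
      ((rowRot m).compLpL 2 (volume.restrict Ω) C) := by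
  intro φ hφ
  have hint : ∀ (q : Fin N × Fin N) (k : Fin N) (I : Finset (Fin N)),
      Integrable (fun x => T x q * pd k φ x I) (volume.restrict Ω) := fun q k I =>
    (MemLp.coord (Lp.memLp T) q).integrable_mul (((hφ.pd k).coord I).memLp 2 Ω)
  have hint2 : ∀ (q : _) (I : Finset (Fin N)),
      Integrable (fun x => C x q * φ x I) (volume.restrict Ω) := fun q I =>
    (MemLp.coord (Lp.memLp C) q).integrable_mul ((hφ.coord I).memLp 2 Ω)
  have e1 : ∫ x in Ω, inner ℝ ((rowForm m).compLpL 2 (volume.restrict Ω) T x) (coD φ x) =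
      ∑ p : {p : Fin N × Fin N // p.1 < p.2},
        ∫ x in Ω, (T x (m, p.1.2) * pd p.1.1 φ x {p.1.1, p.1.2} -
          T x (m, p.1.1) * pd p.1.2 φ x {p.1.1, p.1.2}) := by
    refine Eq.trans ?_ (integral_finsetSum Finset.univ fun p _ => (hint _ _ _).sub (hint _ _ _))
    refine integral_congr_ae ?_
    filter_upwards [(rowForm m).coeFn_compLpL (p := 2) T] with x hx
    rw [hx, inner_rowForm_coD]
  have e2 : ∫ x in Ω, inner ℝ ((rowRot m).compLpL 2 (volume.restrict Ω) C x) (φ x) =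
      ∑ p : {p : Fin N × Fin N // p.1 < p.2}, ∫ x in Ω, C x (m, p) * φ x {p.1.1, p.1.2} := by
    refine Eq.trans ?_ (integral_finsetSum Finset.univ fun p _ => hint2 _ _)
    refine integral_congr_ae ?_
    filter_upwards [(rowRot m).coeFn_compLpL (p := 2) C] with x hx
    rw [hx, inner_rowRot]
  rw [e1, e2, ← Finset.sum_neg_distrib]
  refine Finset.sum_congr rfl fun p _ => ?_
  rw [h m p _ (hφ.coord _), neg_neg]
  simp only [pd_coord (hφ.1.differentiable (by simp))]

theorem IsTest.smul_single {Ω : Set (Pt N)} {φ : Pt N → ℝ} (h : IsTest Ω φ)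
    (I : Finset (Fin N)) :
    IsTest Ω fun x => φ x • (EuclideanSpace.single I 1 : Form N) := by
  have hs : Function.support (fun x => φ x • (EuclideanSpace.single I 1 : Form N)) ⊆
      Function.support φ := fun x hx h0 => hx (by
    simp only [show φ x = 0 from h0, zero_smul])
  exact ⟨h.1.smul contDiff_const, h.2.1.mono hs, (closure_mono hs).trans h.2.2⟩

/-- Testing with a scalar function times one basis 2-form isolates a single entry of the rotation.
-/
theorem hasWeakCurl_zero_of_rows {Ω : Set (Pt N)} {T : L2 Ω (Ten N)}
    (h : ∀ m, HasWeakD ((rowForm m).compLpL 2 (volume.restrict Ω) T) 0) : HasWeakCurl T 0 := by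
  intro m p φ hφ
  have h1 := h m _ (hφ.smul_single {p.1.1, p.1.2})
  have h0 : ∫ x in Ω, inner ℝ ((0 : L2 Ω (Form N)) x)
      (φ x • (EuclideanSpace.single {p.1.1, p.1.2} 1 : Form N)) = 0 := by
    refine integral_eq_zero_of_ae ?_
    filter_upwards [Lp.coeFn_zero (Form N) 2 (volume.restrict Ω)] with x hx
    rw [hx]; simp
  have h0' : ∫ x in Ω, (0 : L2 Ω (Rot N)) x (m, p) * φ x = 0 := by
    refine integral_eq_zero_of_ae ?_
    filter_upwards [Lp.coeFn_zero (Rot N) 2 (volume.restrict Ω)] with x hx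
    rw [hx]; simp
  rw [h0, neg_zero] at h1
  rw [h0', zero_eq_neg, ← h1]
  refine integral_congr_ae ?_
  filter_upwards [(rowForm m).coeFn_compLpL (p := 2) T] with x hx
  have hpd : ∀ k (I : Finset (Fin N)),
      pd k (fun x => φ x • (EuclideanSpace.single {p.1.1, p.1.2} 1 : Form N)) x I =
        if I = {p.1.1, p.1.2} then pd k φ x else 0 := by
    intro k I
    have := pd_clm ((ContinuousLinearMap.id ℝ ℝ).smulRight
      (EuclideanSpace.single {p.1.1, p.1.2} (1 : ℝ) : Form N)) (hφ.1.differentiable (by simp)) k x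
    simp only [ContinuousLinearMap.smulRight_apply, ContinuousLinearMap.id_apply] at this
    rw [this]
    simp
  rw [hx, inner_rowForm_coD, Finset.sum_eq_single p]
  · simp [hpd]
  · intro q _ hq
    simp only [hpd, if_neg fun h => hq (pair_inj.1 h), mul_zero, sub_zero]
  · simp

theorem isQForm_rowForm {Ω : Set (Pt N)} (T : L2 Ω (Ten N)) (m : Fin N) :
    IsQForm 1 ((rowForm m).compLpL 2 (volume.restrict Ω) T) := by
  filter_upwards [(rowForm m).coeFn_compLpL (p := 2) T] with x hx I hI
  rw [hx, rowForm_eq_zero m _ hI]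

theorem isQForm_rowRot {Ω : Set (Pt N)} (C : L2 Ω (Rot N)) (m : Fin N) :
    IsQForm 2 ((rowRot m).compLpL 2 (volume.restrict Ω) C) := by
  filter_upwards [(rowRot m).coeFn_compLpL (p := 2) C] with x hx I hI
  rw [hx, rowRot_eq_zero m _ hI]

theorem row_mem_DSpace {Ω Γ : Set (Pt N)} {w : L2 Ω (Ten N) × L2 Ω (Rot N)}
    (hw : w ∈ HCurlVanish Ω Γ) (m : Fin N) :
    ((rowForm m).compLpL 2 (volume.restrict Ω) w.1,
      (rowRot m).compLpL 2 (volume.restrict Ω) w.2) ∈ DSpace Ω Γ 1 := by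
  refine ⟨isQForm_rowForm _ m, hw.1.hasWeakD m, ?_⟩
  refine map_mem_closure (f := fun u : L2 Ω (Ten N) × L2 Ω (Rot N) =>
    ((rowForm m).compLpL 2 (volume.restrict Ω) u.1,
      (rowRot m).compLpL 2 (volume.restrict Ω) u.2)) (by fun_prop) hw.2 ?_
  rintro u ⟨Φ, hΦ, h1, h2⟩
  refine ⟨fun x => rowForm m (Φ x), hΦ.comp_clm _, fun x I hI => rowForm_eq_zero m _ hI, ?_, ?_⟩
  · filter_upwards [(rowForm m).coeFn_compLpL (p := 2) u.1, h1] with x hx hx'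
    rw [hx, hx']
  · filter_upwards [(rowRot m).coeFn_compLpL (p := 2) u.2, h2] with x hx hx'
    rw [hx, hx', extD_rowForm m hΦ.differentiable]

theorem sum_formRow_rowForm {Ω : Set (Pt N)} (T : L2 Ω (Ten N)) :
    ∑ m, (formRow m).compLpL 2 (volume.restrict Ω) ((rowForm m).compLpL 2 (volume.restrict Ω) T) =
      T := by
  refine Lp.ext ?_
  filter_upwards [Lp.coeFn_finsetSum (p := 2) (μ := volume.restrict Ω) Finset.univ
    (fun m => (formRow m).compLpL 2 (volume.restrict Ω)
      ((rowForm m).compLpL 2 (volume.restrict Ω) T)),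
    ae_all_iff.2 fun m => (formRow m).coeFn_compLpL (p := 2)
      ((rowForm m).compLpL 2 (volume.restrict Ω) T),
    ae_all_iff.2 fun m => (rowForm m).coeFn_compLpL (p := 2) T] with x h1 h2 h3
  rw [h1, Finset.sum_apply]
  ext q
  have (m : Fin N) : (formRow m).compLpL 2 (volume.restrict Ω)
      ((rowForm m).compLpL 2 (volume.restrict Ω) T) x q = if q.1 = m then T x (m, q.2) else 0 := by
    rw [h2, h3, formRow_apply, rowForm_singleton]
  simp [this]

theorem rowForm_sum_formRow {Ω : Set (Pt N)} {E : Fin N → L2 Ω (Form N)}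
    (hE : ∀ m, IsQForm 1 (E m)) (m : Fin N) :
    (rowForm m).compLpL 2 (volume.restrict Ω)
      (∑ n, (formRow n).compLpL 2 (volume.restrict Ω) (E n)) = E m := by
  refine Lp.ext ?_
  filter_upwards [(rowForm m).coeFn_compLpL (p := 2)
      (∑ n, (formRow n).compLpL 2 (volume.restrict Ω) (E n)),
    Lp.coeFn_finsetSum (p := 2) (μ := volume.restrict Ω) Finset.univ
      (fun n => (formRow n).compLpL 2 (volume.restrict Ω) (E n)),
    ae_all_iff.2 fun n => (formRow n).coeFn_compLpL (p := 2) (E n), hE m] with x h1 h2 h3 h4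
  rw [h1]
  ext I
  by_cases hI : I.card = 1
  · obtain ⟨k, rfl⟩ := Finset.card_eq_one.1 hI
    rw [rowForm_singleton, h2, Finset.sum_apply]
    have (n : Fin N) : (formRow n).compLpL 2 (volume.restrict Ω) (E n) x (m, k) =
        if m = n then E n x {k} else 0 := by
      rw [h3, formRow_apply]
    simp [this]
  · rw [rowForm_eq_zero m _ hI, h4 I hI]

/-! ### From the Maxwell estimate for forms to tensor fields -/

theorem exists_norm_sub_sum_le {ι X Y Z : Type*} [Fintype ι] [NormedAddCommGroup X] [NormedSpace ℝ X]
    [NormedAddCommGroup Y] [NormedSpace ℝ Y] [NormedAddCommGroup Z] [NormedSpace ℝ Z]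
    {f : ι → X →L[ℝ] Y} {g : ι → Y →L[ℝ] X} (hsum : ∀ x, ∑ m, g m (f m x) = x)
    (h : ι → Z →L[ℝ] Y) {C : ℝ} (hC : 0 < C) :
    ∃ K > 0, ∀ (x : X) (z : Z) (E : ι → Y), (∀ m, ‖f m x - E m‖ ≤ C * ‖h m z‖) →
      ‖x - ∑ m, g m (E m)‖ ≤ K * ‖z‖ := by
  -- The summand `1` makes the constant positive even if the sum is zero.
  refine ⟨(∑ m, ‖g m‖ * (C * ‖h m‖)) + 1, by positivity, fun x z E hE => ?_⟩
  have h1 : x - ∑ m, g m (E m) = ∑ m, g m (f m x - E m) := by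
    simp only [map_sub, Finset.sum_sub_distrib, hsum]
  rw [h1, add_mul, Finset.sum_mul]
  refine (norm_sum_le _ _).trans ((Finset.sum_le_sum fun m _ => ?_).trans
    (le_add_of_nonneg_right (by positivity)))
  calc ‖g m (f m x - E m)‖ ≤ ‖g m‖ * ‖f m x - E m‖ := (g m).le_opNorm _
    _ ≤ ‖g m‖ * (C * (‖h m‖ * ‖z‖)) := by
        gcongr
        refine (hE m).trans ?_
        gcongr
        exact (h m).le_opNorm z
    _ = _ := by ring

/-- The distance of a `1`-form to the closed forms is controlled by its exterior derivative. -/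
theorem exists_closed_form_norm_sub_le {Ω Γt : Set (Pt N)} (hΩ : IsOpen Ω) (hmcp : MCP Ω Γt)
    (hmap : MAP Ω Γt) :
    ∃ C > 0, ∀ E F : L2 Ω (Form N), (E, F) ∈ DSpace Ω Γt 1 →
      ∃ E₀ : L2 Ω (Form N), IsQForm 1 E₀ ∧ HasWeakD E₀ 0 ∧ ‖E - E₀‖ ≤ C * ‖F‖ := by
  obtain ⟨C, hC, hest⟩ := exists_norm_le_of_orthogonal hΩ hmcp hmap
  refine ⟨C, hC, fun E F h => ?_⟩
  obtain ⟨E₀, hE, hE'⟩ := exists_closed_part h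
  exact ⟨E₀, hE.1, hE.2.1, hest (E - E₀, F) hE'⟩

/-- Maxwell estimate for tensor fields: the distance to the curl-free fields is controlled by the
rotation. -/
theorem exists_curlFree_part {Ω Γt : Set (Pt N)} (hΩ : IsOpen Ω) (hmcp : MCP Ω Γt)
    (hmap : MAP Ω Γt) :
    ∃ C > 0, ∀ w : L2 Ω (Ten N) × L2 Ω (Rot N),
      (∀ m, ((rowForm m).compLpL 2 (volume.restrict Ω) w.1,
        (rowRot m).compLpL 2 (volume.restrict Ω) w.2) ∈ DSpace Ω Γt 1) →
      ∃ R : L2 Ω (Ten N), HasWeakCurl R 0 ∧ ‖w.1 - R‖ ≤ C * ‖w.2‖ := by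
  obtain ⟨C, hC, hest⟩ := exists_closed_form_norm_sub_le hΩ hmcp hmap
  obtain ⟨K, hK, hKE⟩ := exists_norm_sub_sum_le (sum_formRow_rowForm (Ω := Ω))
    (fun m => (rowRot m).compLpL 2 (volume.restrict Ω)) hC
  refine ⟨K, hK, fun w hw => ?_⟩
  choose E hE hE' hE'' using fun m => hest _ _ (hw m)
  refine ⟨∑ m, (formRow m).compLpL 2 (volume.restrict Ω) (E m),
    hasWeakCurl_zero_of_rows fun m => ?_, hKE w.1 w.2 E hE''⟩
  rw [rowForm_sum_formRow hE]
  exact hE' m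

/-! ### Curl-free skew-symmetric tensor fields -/

theorem symL_apply (A : Ten N) (i j : Fin N) : symL N A (i, j) = (A (i, j) + A (j, i)) / 2 := rfl

theorem skewL_apply (A : Ten N) (i j : Fin N) : skewL N A (i, j) = (A (i, j) - A (j, i)) / 2 := by
  change A (i, j) - symL N A (i, j) = _
  rw [symL_apply]; ring

theorem isSkew_iff_symL {A : Ten N} : IsSkew A ↔ symL N A = 0 := by
  constructor
  · intro h
    ext ⟨i, j⟩
    rw [symL_apply, h i j]
    simp
  · intro h i j
    have : symL N A (i, j) = 0 := by rw [h]; rfl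
    rw [symL_apply] at this
    linarith

theorem isSkew_skewL (A : Ten N) : IsSkew (skewL N A) := fun i j => by
  rw [skewL_apply, skewL_apply]; ring

theorem IsSkew.sub {A B : Ten N} (hA : IsSkew A) (hB : IsSkew B) : IsSkew (A - B) := fun i j => by
  rw [PiLp.sub_apply, PiLp.sub_apply, hA i j, hB i j]; ring

/-- Skew-symmetric curl-free tensor fields are constant. -/
theorem exists_ae_const_of_isSkew_of_curlFree {B : Set (Pt N)} (hB : IsOpen B)
    (hBc : IsPreconnected B) {T : Pt N → Ten N} (hT : MemLp T 2 (volume.restrict B))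
    (hskew : ∀ᵐ x ∂volume.restrict B, IsSkew (T x))
    (hcurl : ∀ m, CurlFree B fun x => rowL m (T x)) :
    ∃ A : Ten N, IsSkew A ∧ ∀ᵐ x ∂volume.restrict B, T x = A := by
  rcases B.eq_empty_or_nonempty with rfl | hne
  · exact ⟨0, fun i j => by simp, by simp⟩
  have hz : ∀ n j, WGrad B (fun x => T x (n, j)) 0 := by
    intro n j i φ hφ
    have hsym : ∀ n j i, ∫ x in B, T x (n, j) * pd i φ x = ∫ x in B, T x (n, i) * pd j φ x :=
      fun n j i => hcurl n i j φ hφ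
    have hsk : ∀ n j i, ∫ x in B, T x (n, j) * pd i φ x = - ∫ x in B, T x (j, n) * pd i φ x := by
      intro n j i
      rw [← integral_neg]
      refine integral_congr_ae ?_
      filter_upwards [hskew] with x hx
      rw [hx n j, neg_mul]
    -- Alternating symmetry in the last two indices with skewness in the first two returns to the
    -- start after six moves, three of which change the sign.
    have h0 : ∫ x in B, T x (n, j) * pd i φ x = 0 := by
      linarith [hsym n j i, hsk n i j, hsym i n j, hsk i j n, hsym j i n, hsk j n i]
    rw [h0]
    simp
  have hc : ∀ q : Fin N × Fin N, ∃ c : ℝ, ∀ᵐ x ∂volume.restrict B, T x q = c := fun q =>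
    ae_const_of_wGrad_zero hB hBc (fun x hx => by
      obtain ⟨r, hr, hrB⟩ := Metric.isOpen_iff.1 hB x hx
      exact ⟨r, hr, hrB, (MemLp.coord hT q).mono_measure (Measure.restrict_mono hrB le_rfl)⟩)
      (hz q.1 q.2)
  choose c hc using hc
  have hA : ∀ᵐ x ∂volume.restrict B, T x = WithLp.toLp 2 c := by
    filter_upwards [ae_all_iff.2 hc] with x hx
    ext q
    exact hx q
  refine ⟨WithLp.toLp 2 c, ?_, hA⟩
  obtain ⟨x, h1, h2⟩ := exists_of_ae_restrict hB hne (hskew.and hA)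
  rwa [h2] at h1

theorem isSkew_ae_of_symF_eq_zero {Ω : Set (Pt N)} {T : L2 Ω (Ten N)} (h : symF T = 0) :
    ∀ᵐ x ∂volume.restrict Ω, IsSkew (T x) := by
  have h1 := (symL N).coeFn_compLp T
  rw [← symF, h] at h1
  filter_upwards [h1, Lp.coeFn_zero (Ten N) 2 (volume.restrict Ω)] with x hx hx'
  rw [isSkew_iff_symL, ← hx, hx']
  rfl

theorem exists_const_of_kernel {Ω : Set (Pt N)} (hΩ : IsOpen Ω) (hΩc : IsPreconnected Ω)
    {T : L2 Ω (Ten N)} (hs : symF T = 0) (hc : HasWeakCurl T 0) :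
    ∃ A : Ten N, IsSkew A ∧ T =ᵐ[volume.restrict Ω] fun _ => A :=
  exists_ae_const_of_isSkew_of_curlFree hΩ hΩc (Lp.memLp T) (isSkew_ae_of_symF_eq_zero hs)
    hc.curlFree_row

/-! ### Tensor fields with vanishing tangential trace -/

theorem curlS_apply (Φ : Pt N → Ten N) (x : Pt N) (m : Fin N)
    (p : {p : Fin N × Fin N // p.1 < p.2}) :
    curlS Φ x (m, p) = pd p.1.1 Φ x (m, p.1.2) - pd p.1.2 Φ x (m, p.1.1) := rfl

theorem closedLinear_HCurl (Ω : Set (Pt N)) : ClosedLinear (HCurl Ω) := by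
  have : HCurl Ω = ⋂ (n : Fin N), ⋂ (p : {p : Fin N × Fin N // p.1 < p.2}),
      ⋂ (φ : {φ : Pt N → ℝ // IsTest Ω φ}), {w |
        ∫ x in Ω, w.2 x (n, p) * φ.1 x = - ((∫ x in Ω, w.1 x (n, p.1.2) * pd p.1.1 φ.1 x) -
          ∫ x in Ω, w.1 x (n, p.1.1) * pd p.1.2 φ.1 x)} := by
    ext w
    simp only [HCurl, HasWeakCurl, mem_ofPred_eq, mem_iInter, Subtype.forall (p := IsTest Ω)]
    refine forall₄_congr fun n p φ hφ => ?_
    have h1 : ∫ x in Ω, (w.1 x (n, p.1.2) * pd p.1.1 φ x - w.1 x (n, p.1.1) * pd p.1.2 φ x) =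
        (∫ x in Ω, w.1 x (n, p.1.2) * pd p.1.1 φ x) - ∫ x in Ω, w.1 x (n, p.1.1) * pd p.1.2 φ x :=
      integral_sub ((MemLp.coord (Lp.memLp w.1) _).integrable_mul ((hφ.pd _).memLp 2 Ω))
        ((MemLp.coord (Lp.memLp w.1) _).integrable_mul ((hφ.pd _).memLp 2 Ω))
    rw [h1]
  rw [this]
  refine closedLinear_of_forall fun n => closedLinear_of_forall fun p =>
    closedLinear_of_forall fun φ => ?_
  obtain ⟨ℓ₁, h1⟩ := exists_coord_functional ((φ.2.pd p.1.1).memLp 2 Ω) (n, p.1.2)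
  obtain ⟨ℓ₂, h2⟩ := exists_coord_functional ((φ.2.pd p.1.2).memLp 2 Ω) (n, p.1.1)
  obtain ⟨ℓ₃, h3⟩ := exists_coord_functional (φ.2.memLp 2 Ω) (n, p)
  convert closedLinear_eq_zero (f := (ℓ₁ - ℓ₂).comp (ContinuousLinearMap.fst ℝ _ _) +
    ℓ₃.comp (ContinuousLinearMap.snd ℝ _ _)) using 1
  ext w
  simp only [mem_ofPred_eq, add_apply, sub_apply, ContinuousLinearMap.comp_apply,
    ContinuousLinearMap.coe_fst', ContinuousLinearMap.coe_snd', h1, h2, h3]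
  constructor <;> intro h <;> linarith

theorem closedLinear_HCurlVanish (Ω Γ : Set (Pt N)) : ClosedLinear (HCurlVanish Ω Γ) := by
  refine (closedLinear_HCurl Ω).inter (closedLinear_closure_graph (Ω := Ω) (D := curlS)
    (A := fun Φ : Pt N → Ten N => IsSmoothAway Ω Γ Φ) IsSmoothAway.zero ?_
    (fun Φ Ψ hΦ hΨ => ⟨hΦ.add hΨ, ?_⟩) (fun a Φ hΦ => ⟨hΦ.smul a, ?_⟩)) <;>
  · funext x
    ext ⟨m, p⟩
    first
    | (simp only [curlS_apply, pd_zero]; simp; done)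
    | (simp only [PiLp.add_apply, curlS_apply, pd_add hΦ.differentiable hΨ.differentiable]; ring)
    | (simp only [PiLp.smul_apply, curlS_apply, pd_smul hΦ.differentiable, smul_eq_mul]; ring)

theorem integral_pd_eq_zero {Ω : Set (Pt N)} {φ : Pt N → ℝ} (hφ : IsTest Ω φ) (k : Fin N) :
    ∫ x in Ω, pd k φ x = 0 := by
  have h1 := integral_mul_pd (f := fun _ => (1 : ℝ)) contDiff_const
    (hφ.1.of_le (by simp)) hφ.2.1 k
  have h2 := setIntegral_eq_of_eq_zero (subset_univ Ω) fun x hx => (hφ.pd k).eq_zero hx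
  rw [Measure.restrict_univ] at h2
  rw [← h2]
  simpa [pd] using h1

/-- Partial integration for functions that vanish near a part of the boundary. -/
theorem integral_mul_pd_of_eventually_eq_zero {Ω B : Set (Pt N)} (hΩ : IsOpen Ω)
    {f φ : Pt N → ℝ} (hf : ContDiff ℝ (⊤ : ℕ∞) f) (hφ : IsTest B φ)
    (h0 : ∀ x ∈ B ∩ frontier Ω, ∀ᶠ y in 𝓝 x, y ∈ Ω → f y = 0) (k : Fin N) :
    ∫ x in Ω, f x * pd k φ x = - ∫ x in Ω, pd k f x * φ x := by
  -- At every boundary point either `f` vanishes nearby in `Ω` or `φ` does, so the product extends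
  -- by zero and its derivative has integral zero.
  have ht : IsTest Ω (Ω.indicator fun x => f x * φ x) := by
    refine isTest_indicator hΩ (hf.mul hφ.1) hφ.2.1.mul_left fun x hx => ?_
    by_cases hxB : x ∈ B
    · filter_upwards [h0 x ⟨hxB, hx⟩] with y hy hyΩ
      rw [hy hyΩ, zero_mul]
    · have := notMem_tsupport_iff_eventuallyEq.1 fun h => hxB (hφ.2.2 h)
      filter_upwards [this] with y hy _
      rw [hy]; simp
  have h1 := integral_pd_eq_zero ht k
  have hpf : Continuous (pd k f) := (contDiff_pd hf).continuous
  have hpφ : Continuous (pd k φ) := (contDiff_pd hφ.1).continuous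
  have hi1 : Integrable (fun x => f x * pd k φ x) (volume.restrict Ω) :=
    ((hf.continuous.mul hpφ).integrable_of_hasCompactSupport (hφ.pd k).2.1.mul_left).restrict
  have hi2 : Integrable (fun x => pd k f x * φ x) (volume.restrict Ω) :=
    ((hpf.mul hφ.1.continuous).integrable_of_hasCompactSupport hφ.2.1.mul_left).restrict
  have h2 : ∫ x in Ω, pd k (Ω.indicator fun x => f x * φ x) x =
      ∫ x in Ω, (f x * pd k φ x + pd k f x * φ x) := by
    refine setIntegral_congr_fun hΩ.measurableSet fun x hx => ?_
    rw [pd_indicator hΩ _ hx]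
    simp only [pd]
    rw [fderiv_fun_mul (hf.differentiable (by simp) x) (hφ.1.differentiable (by simp) x)]
    simp [mul_comm]
  rw [h2, integral_add hi1 hi2] at h1
  linarith

/-- Test functions may reach across `Γ`: the smooth approximants vanish near it, so partial
integration has no boundary term, and the identity is closed in the graph norm. -/
theorem integral_curl_of_mem_HCurlVanish {Ω Γ B : Set (Pt N)} (hΩ : IsOpen Ω)
    (hB : B ∩ frontier Ω ⊆ Γ) {w : L2 Ω (Ten N) × L2 Ω (Rot N)} (hw : w ∈ HCurlVanish Ω Γ)
    (n : Fin N) (p : {p : Fin N × Fin N // p.1 < p.2}) {φ : Pt N → ℝ} (hφ : IsTest B φ) :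
    ∫ x in Ω, w.2 x (n, p) * φ x = - ((∫ x in Ω, w.1 x (n, p.1.2) * pd p.1.1 φ x) -
      ∫ x in Ω, w.1 x (n, p.1.1) * pd p.1.2 φ x) := by
  obtain ⟨ℓ₁, h1⟩ := exists_coord_functional ((hφ.pd p.1.1).memLp 2 Ω) (n, p.1.2)
  obtain ⟨ℓ₂, h2⟩ := exists_coord_functional ((hφ.pd p.1.2).memLp 2 Ω) (n, p.1.1)
  obtain ⟨ℓ₃, h3⟩ := exists_coord_functional (φ := φ) (hφ.memLp 2 Ω) (n, p)
  have hc : IsClosed {w : L2 Ω (Ten N) × L2 Ω (Rot N) | ℓ₃ w.2 = - (ℓ₁ w.1 - ℓ₂ w.1)} :=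
    isClosed_eq (by fun_prop) (by fun_prop)
  have := closure_minimal (fun u hu => ?_) hc hw.2
  · simpa only [mem_ofPred_eq, h1, h2, h3] using this
  obtain ⟨Φ, hΦ, e1, e2⟩ := hu
  simp only [mem_ofPred_eq, h1, h2, h3]
  have hcd : ∀ q, ContDiff ℝ (⊤ : ℕ∞) fun x => Φ x q := contDiff_euclidean.1 hΦ.1
  have hpart : ∀ q k, ∫ x in Ω, u.1 x q * pd k φ x = - ∫ x in Ω, pd k Φ x q * φ x := by
    intro q k
    have h4 : ∫ x in Ω, u.1 x q * pd k φ x = ∫ x in Ω, Φ x q * pd k φ x :=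
      integral_congr_ae (e1.mono fun x hx => by simp only [hx])
    rw [h4, integral_mul_pd_of_eventually_eq_zero hΩ (hcd q) hφ (fun x hx => ?_) k]
    · simp only [pd_coord hΦ.differentiable]
    · filter_upwards [hΦ.eventually_eq_zero (hB hx)] with y hy hyΩ
      rw [hy hyΩ]; rfl
  have hint : ∀ q k, Integrable (fun x => pd k Φ x q * φ x) (volume.restrict Ω) := fun q k =>
    (((contDiff_coord_pd hΦ.1 k q).continuous.mul
      hφ.1.continuous).integrable_of_hasCompactSupport hφ.2.1.mul_left).restrict
  rw [hpart, hpart, integral_congr_ae (e2.mono fun x hx => by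
    simp only [hx, curlS_apply, sub_mul] : (fun x => u.2 x (n, p) * φ x) =ᵐ[volume.restrict Ω]
      fun x => pd p.1.1 Φ x (n, p.1.2) * φ x - pd p.1.2 Φ x (n, p.1.1) * φ x),
    integral_sub (hint _ _) (hint _ _)]
  ring

theorem eq_zero_of_mem_HCurlVanish {Ω Γt : Set (Pt N)} (hΩ : IsOpen Ω) (hΩc : IsPreconnected Ω)
    (hΓt : ∃ U, IsOpen U ∧ Γt = U ∩ frontier Ω) (hext : (Γt ∩ closure (closure Ω)ᶜ).Nonempty)
    {w : L2 Ω (Ten N) × L2 Ω (Rot N)} (hw : w ∈ HCurlVanish Ω Γt) (hw2 : w.2 = 0)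
    (hs : symF w.1 = 0) : w.1 = 0 := by
  have hcurl : HasWeakCurl w.1 0 := hw2 ▸ hw.1
  obtain ⟨A, hA, hTA⟩ := exists_const_of_kernel hΩ hΩc hs hcurl
  obtain ⟨U, hU, rfl⟩ := hΓt
  obtain ⟨x₀, ⟨hxU, hxf⟩, hxe⟩ := hext
  obtain ⟨r, hr, hrU⟩ := Metric.isOpen_iff.1 hU x₀ hxU
  set B := Metric.ball x₀ r
  have hfin : IsFiniteMeasure (volume.restrict B) := ⟨by simp [B, measure_ball_lt_top]⟩
  -- The field extended by zero to the ball `B`. The vanishing tangential trace makes it curl-free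
  -- across the boundary, so it is a.e. equal to a single constant in `B`.
  let T' : Pt N → Ten N := Ω.indicator fun _ => A
  have hint : ∀ q k (φ : Pt N → ℝ), IsTest B φ →
      ∫ x in B, T' x q * pd k φ x = ∫ x in Ω, w.1 x q * pd k φ x := by
    intro q k φ hφ
    have hz : ∀ x ∉ B ∩ Ω, T' x q * pd k φ x = 0 := by
      intro x hx
      by_cases hxB : x ∈ B
      · simp [T', indicator_of_notMem fun hxΩ => hx ⟨hxB, hxΩ⟩]
      · rw [(hφ.pd k).eq_zero hxB, mul_zero]
    rw [setIntegral_eq_of_eq_zero inter_subset_left hz,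
      ← setIntegral_eq_of_eq_zero inter_subset_right hz]
    refine integral_congr_ae ?_
    filter_upwards [hTA, ae_restrict_mem hΩ.measurableSet] with x hx hxΩ
    rw [hx]
    simp [T', hxΩ]
  have hcf : ∀ m i j, i < j → ∀ φ : Pt N → ℝ, IsTest B φ →
      ∫ x in B, T' x (m, j) * pd i φ x = ∫ x in B, T' x (m, i) * pd j φ x := by
    intro m i j hij φ hφ
    have h1 := integral_curl_of_mem_HCurlVanish hΩ (inter_subset_inter_left _ hrU) hw m
      ⟨(i, j), hij⟩ hφ
    have h0 : ∫ x in Ω, w.2 x (m, ⟨(i, j), hij⟩) * φ x = 0 := by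
      rw [hw2]
      refine integral_eq_zero_of_ae ?_
      filter_upwards [Lp.coeFn_zero (Rot N) 2 (volume.restrict Ω)] with x hx
      rw [hx]; simp
    rw [h0, ← hint _ _ φ hφ, ← hint _ _ φ hφ] at h1
    linarith
  obtain ⟨A', -, hA'⟩ := exists_ae_const_of_isSkew_of_curlFree (T := T') Metric.isOpen_ball
    (convex_ball x₀ r).isPreconnected ((memLp_const A).indicator hΩ.measurableSet)
    (ae_of_all _ fun x => by
      by_cases hx : x ∈ Ω
      · simpa [T', hx] using hA
      · intro i j; simp [T', hx])
    (fun m i j φ hφ => by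
      simp only [rowL_apply]
      rcases lt_trichotomy i j with hij | rfl | hij
      · exact hcf m i j hij φ hφ
      · rfl
      · exact (hcf m j i hij φ hφ).symm)
  -- The ball contains an open piece of the exterior, where the extension is zero.
  have hA0 : A' = 0 := by
    have hne : (B ∩ (closure Ω)ᶜ).Nonempty :=
      mem_closure_iff.1 hxe B Metric.isOpen_ball (Metric.mem_ball_self hr)
    have hae : ∀ᵐ x ∂volume.restrict (B ∩ (closure Ω)ᶜ), T' x = A' :=
      ae_mono (Measure.restrict_mono inter_subset_left le_rfl) hA'
    have hop : IsOpen (B ∩ (closure Ω)ᶜ) := Metric.isOpen_ball.inter isClosed_closure.isOpen_compl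
    obtain ⟨x, h1, h2⟩ := exists_of_ae_restrict hop hne
      (hae.and (ae_restrict_mem hop.measurableSet))
    rw [← h1]
    exact indicator_of_notMem (fun h => h2.2 (subset_closure h)) fun _ : Pt N => A
  -- The ball also meets `Ω`, where the extension equals `A`.
  have hA1 : A = 0 := by
    have hne : (B ∩ Ω).Nonempty := mem_closure_iff.1 (frontier_subset_closure hxf) B
      Metric.isOpen_ball (Metric.mem_ball_self hr)
    have hae : ∀ᵐ x ∂volume.restrict (B ∩ Ω), T' x = A' :=
      ae_mono (Measure.restrict_mono inter_subset_left le_rfl) hA'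
    have hop : IsOpen (B ∩ Ω) := Metric.isOpen_ball.inter hΩ
    obtain ⟨x, h1, h2⟩ := exists_of_ae_restrict hop hne
      (hae.and (ae_restrict_mem hop.measurableSet))
    rw [← hA0, ← h1]
    exact (indicator_of_mem h2.2 fun _ : Pt N => A).symm
  rw [Lp.eq_zero_iff_ae_eq_zero]
  filter_upwards [hTA] with x hx
  rw [hx, hA1]; rfl

/-! ### The estimate on closed subspaces without kernel -/

theorem norm_symF_le {Ω : Set (Pt N)} (T : L2 Ω (Ten N)) : ‖symF T‖ ≤ ‖symL N‖ * ‖T‖ :=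
  (symL N).norm_compLp_le T

/-- The core compactness argument. The two boundary situations enter only through `hrow`, which
feeds the Maxwell estimate, and through the trivial kernel `hker`. -/
theorem exists_norm_le_symCurlNorm {Ω Γt : Set (Pt N)} (hΩ : IsOpen Ω) (hΩt : volume Ω ≠ ⊤)
    (hadm : Admissible Ω Γt) {W : Set (L2 Ω (Ten N) × L2 Ω (Rot N))} (hW : ClosedLinear W)
    (hrow : ∀ w ∈ W, ∀ m, ((rowForm m).compLpL 2 (volume.restrict Ω) w.1,
      (rowRot m).compLpL 2 (volume.restrict Ω) w.2) ∈ DSpace Ω Γt 1)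
    (hker : ∀ w ∈ W, w.2 = 0 → symF w.1 = 0 → w.1 = 0) :
    ∃ c > 0, ∀ w ∈ W, ‖w.1‖ ≤ c * symCurlNorm w := by
  obtain ⟨C, hC, hR⟩ := exists_curlFree_part hΩ hadm.mcp hadm.map
  obtain ⟨J, P, hP⟩ := hadm.sliceable
  refine exists_le_mul_of_seq (p := fun w : L2 Ω (Ten N) × L2 Ω (Rot N) => ‖w.1‖)
    (q := symCurlNorm) (fun a w hw => hW.smul_mem a hw) (fun a w => by simp [norm_smul])
    (fun a w => by simp [symCurlNorm, symF_smul, norm_smul, mul_add])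
    (fun w => add_nonneg (norm_nonneg _) (norm_nonneg _)) ?_
  intro w hw hp hq
  choose R hRc hRn using fun n => hR (w n) (hrow _ (hw n))
  have hs0 : Tendsto (fun n => symF (w n).1) atTop (𝓝 0) :=
    tendsto_zero_iff_norm_tendsto_zero.2 (squeeze_zero (fun _ => norm_nonneg _)
      (fun n => le_add_of_nonneg_right (norm_nonneg _)) hq)
  have hc0 : Tendsto (fun n => (w n).2) atTop (𝓝 0) :=
    tendsto_zero_iff_norm_tendsto_zero.2 (squeeze_zero (fun _ => norm_nonneg _)
      (fun n => le_add_of_nonneg_left (norm_nonneg _)) hq)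
  have hd0 : Tendsto (fun n => (w n).1 - R n) atTop (𝓝 0) := by
    refine tendsto_zero_iff_norm_tendsto_zero.2 (squeeze_zero (fun _ => norm_nonneg _) hRn ?_)
    simpa using (tendsto_zero_iff_norm_tendsto_zero.1 hc0).const_mul C
  have hsR : Tendsto (fun n => symF (R n)) atTop (𝓝 0) := by
    have h1 := hs0.sub ((continuous_symF.tendsto _).comp hd0)
    have h2 : symF (0 : L2 Ω (Ten N)) = 0 := by simpa using symF_smul (0 : ℝ) (0 : L2 Ω (Ten N))
    rw [h2, sub_zero] at h1
    refine h1.congr fun n => ?_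
    simp only [Function.comp_apply, symF_sub]
    abel
  obtain ⟨M, hM⟩ := (tendsto_zero_iff_norm_tendsto_zero.1 hd0).bddAbove_range
  -- Each `R n` differs from a field of norm one by a null sequence, so the sequence is bounded, as
  -- needed for the compact embedding.
  have hRb : ∀ n, ‖R n‖ ≤ 1 + M := fun n => by
    have h1 : ‖(w n).1 - R n‖ ≤ M := hM (mem_range_self n)
    have h2 := norm_sub_le (w n).1 ((w n).1 - R n)
    rw [sub_sub_cancel] at h2
    have h3 : ‖(w n).1‖ = 1 := hp n
    linarith
  obtain ⟨θ, hθ, hcau⟩ := hP.exists_subseq hΩ hΩt hRc hRb hsR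
  obtain ⟨T, hT⟩ := cauchySeq_tendsto_of_complete hcau
  have hlim1 : Tendsto (fun n => (w (θ n)).1) atTop (𝓝 T) := by
    have := (hd0.comp hθ.tendsto_atTop).add hT
    rw [zero_add] at this
    refine this.congr fun n => ?_
    simp
  have hlim : Tendsto (fun n => w (θ n)) atTop (𝓝 (T, 0)) :=
    hlim1.prodMk_nhds (hc0.comp hθ.tendsto_atTop)
  have hmem := hW.isClosed.mem_of_tendsto hlim (Eventually.of_forall fun n => hw _)
  have hsT : symF T = 0 := tendsto_nhds_unique ((continuous_symF.tendsto _).comp hlim1)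
    (hs0.comp hθ.tendsto_atTop)
  -- The limit has zero symmetric part and, as `W` is closed, lies in `W` with rotation zero.
  have hT0 : T = 0 := hker _ hmem rfl hsT
  have hnorm : ‖T‖ = 1 :=
    tendsto_nhds_unique hlim1.norm ((tendsto_const_nhds (x := (1 : ℝ))).congr
      fun n => (hp _).symm)
  rw [hT0, norm_zero] at hnorm
  exact zero_ne_one hnorm

/-- Definiteness and the lower bound come from the estimate; the upper bound only needs that `sym`
is bounded. -/
theorem isEquivNormOn_symCurlNorm {Ω : Set (Pt N)} {W : Set (L2 Ω (Ten N) × L2 Ω (Rot N))}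
    {c : ℝ} (hc : 0 < c) (h : ∀ w ∈ W, ‖w.1‖ ≤ c * symCurlNorm w) :
    IsEquivNormOn W symCurlNorm hCurlNorm where
  nonneg w _ := add_nonneg (norm_nonneg _) (norm_nonneg _)
  definite w hw h0 := by
    have h1 := h w hw
    rw [h0, mul_zero] at h1
    have h2 : ‖w.2‖ ≤ 0 := by
      rw [← h0]
      exact le_add_of_nonneg_left (norm_nonneg _)
    ext1
    · exact norm_le_zero_iff.1 h1
    · exact norm_le_zero_iff.1 h2
  smul a w _ := by simp [symCurlNorm, symF_smul, norm_smul, mul_add]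
  add v _ w _ := by
    simp only [symCurlNorm, Prod.fst_add, Prod.snd_add, symF_add]
    linarith [norm_add_le (symF v.1) (symF w.1), norm_add_le v.2 w.2]
  equiv := by
    refine ⟨(c + 1)⁻¹, ‖symL N‖ + 1, by positivity, by positivity, fun w hw => ⟨?_, ?_⟩⟩
    · rw [inv_mul_le_iff₀ (by positivity), hCurlNorm, Real.sqrt_le_iff]
      have h1 := h w hw
      have h2 : ‖w.2‖ ≤ symCurlNorm w := le_add_of_nonneg_left (norm_nonneg _)
      have h3 : 0 ≤ symCurlNorm w := (norm_nonneg _).trans h2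
      have h4 : ‖w.1‖ + ‖w.2‖ ≤ (c + 1) * symCurlNorm w := by linarith
      refine ⟨by positivity, ?_⟩
      calc ‖w.1‖ ^ 2 + ‖w.2‖ ^ 2 ≤ (‖w.1‖ + ‖w.2‖) ^ 2 := by
            nlinarith [mul_nonneg (norm_nonneg w.1) (norm_nonneg w.2)]
        _ ≤ _ := by gcongr
    · have h1 : ‖w.1‖ ≤ hCurlNorm w := Real.le_sqrt_of_sq_le (by linarith [sq_nonneg ‖w.2‖])
      have h2 : ‖w.2‖ ≤ hCurlNorm w := Real.le_sqrt_of_sq_le (by linarith [sq_nonneg ‖w.1‖])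
      rw [symCurlNorm, add_mul, one_mul]
      refine add_le_add ((norm_symF_le _).trans ?_) h2
      gcongr

/-! ### Constant skew-symmetric tensor fields -/

theorem closedLinear_perpSoN (Ω : Set (Pt N)) :
    ClosedLinear {w : L2 Ω (Ten N) × L2 Ω (Rot N) | w ∈ HCurl Ω ∧ PerpSoN w.1} := by
  refine (closedLinear_HCurl Ω).inter (t := {w | PerpSoN w.1}) ?_
  have : {w : L2 Ω (Ten N) × L2 Ω (Rot N) | PerpSoN w.1} = ⋂ (S : L2 Ω (Ten N)),
      ⋂ (_ : S ∈ soN Ω), {w | ((innerSL ℝ S).comp (ContinuousLinearMap.fst ℝ _ _)) w = 0} := by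
    ext w
    simp only [PerpSoN, mem_ofPred_eq, mem_iInter, ContinuousLinearMap.comp_apply,
      ContinuousLinearMap.coe_fst', innerSL_apply_apply]
    exact forall₂_congr fun S _ => by rw [real_inner_comm]
  rw [this]
  exact closedLinear_of_forall fun S => closedLinear_of_forall fun _ => closedLinear_eq_zero

theorem soN_sub {Ω : Set (Pt N)} {S S' : L2 Ω (Ten N)} (hS : S ∈ soN Ω) (hS' : S' ∈ soN Ω) :
    S - S' ∈ soN Ω := by
  obtain ⟨A, hA, hSA⟩ := hS
  obtain ⟨B, hB, hSB⟩ := hS'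
  refine ⟨A - B, hA.sub hB, ?_⟩
  filter_upwards [Lp.coeFn_sub S S', hSA, hSB] with x h1 h2 h3
  rw [h1, Pi.sub_apply, h2, h3]

theorem symF_eq_zero_of_mem_soN {Ω : Set (Pt N)} {S : L2 Ω (Ten N)} (hS : S ∈ soN Ω) :
    symF S = 0 := by
  obtain ⟨A, hA, hSA⟩ := hS
  rw [Lp.eq_zero_iff_ae_eq_zero]
  filter_upwards [(symL N).coeFn_compLp S, hSA] with x h1 h2
  rw [symF, h1, h2, isSkew_iff_symL.1 hA]
  rfl

theorem hasWeakCurl_zero_of_mem_soN {Ω : Set (Pt N)} {S : L2 Ω (Ten N)} (hS : S ∈ soN Ω) :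
    HasWeakCurl S 0 := by
  obtain ⟨A, hA, hSA⟩ := hS
  intro n p φ hφ
  have h0 : ∫ x in Ω, (0 : L2 Ω (Rot N)) x (n, p) * φ x = 0 := by
    refine integral_eq_zero_of_ae ?_
    filter_upwards [Lp.coeFn_zero (Rot N) 2 (volume.restrict Ω)] with x hx
    rw [hx]; simp
  have hi : ∀ k, Integrable (pd k φ) (volume.restrict Ω) := fun k =>
    memLp_one_iff_integrable.1 ((hφ.pd k).memLp 1 Ω)
  have h1 : ∫ x in Ω, (S x (n, p.1.2) * pd p.1.1 φ x - S x (n, p.1.1) * pd p.1.2 φ x) =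
      ∫ x in Ω, (A (n, p.1.2) * pd p.1.1 φ x - A (n, p.1.1) * pd p.1.2 φ x) :=
    integral_congr_ae (hSA.mono fun x hx => by simp only [hx])
  rw [h0, h1, integral_sub ((hi _).const_mul _) ((hi _).const_mul _), integral_const_mul,
    integral_const_mul, integral_pd_eq_zero hφ, integral_pd_eq_zero hφ]
  simp

theorem inner_symL_of_isSkew (A : Ten N) {B : Ten N} (hB : IsSkew B) :
    inner ℝ B (symL N A) = (0 : ℝ) := by
  have h1 : inner ℝ B (symL N A) = ∑ i, ∑ j, symL N A (i, j) * B (i, j) := by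
    rw [← Fintype.sum_prod_type' (f := fun i j => symL N A (i, j) * B (i, j))]
    simp [PiLp.inner_apply]
  rw [h1]
  refine sum_sum_eq_zero_of_antisymm fun i j => ?_
  rw [hB i j, symL_apply, symL_apply]
  ring

/-- Testing with a constant `B` only sees the mean `A` of `T`, and `A - skew A = sym A` is
orthogonal to skew matrices. -/
theorem perpSoN_sub_average {Ω : Set (Pt N)} (hΩt : volume Ω ≠ ⊤) (hΩ0 : volume Ω ≠ 0)
    (T S : L2 Ω (Ten N)) (hS : ∀ᵐ x ∂volume.restrict Ω, S x = skewL N (⨍ y in Ω, T y)) :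
    PerpSoN (T - S) := by
  have hfin : IsFiniteMeasure (volume.restrict Ω) := ⟨by simpa using hΩt.lt_top⟩
  rintro S' ⟨B, hB, hSB⟩
  have hpos : volume.real Ω ≠ 0 := (ENNReal.toReal_pos hΩ0 hΩt).ne'
  have hTi : Integrable T (volume.restrict Ω) := (Lp.memLp T).integrable (by norm_num)
  set A := ⨍ y in Ω, T y with hA
  have hint : ∫ y in Ω, T y = volume.real Ω • A := by
    rw [hA, setAverage_eq, smul_smul, mul_inv_cancel₀ hpos, one_smul]
  have h1 : inner ℝ (T - S) S' = ∫ x in Ω, inner ℝ B (T x - skewL N A) := by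
    rw [L2.inner_def]
    refine integral_congr_ae ?_
    filter_upwards [Lp.coeFn_sub T S, hS, hSB] with x e1 e2 e3
    rw [e1, Pi.sub_apply, e2, e3, real_inner_comm]
  have h3 : ∫ x in Ω, inner ℝ B (T x - skewL N A) = inner ℝ B (∫ x in Ω, (T x - skewL N A)) :=
    integral_inner (hTi.sub (integrable_const _)) B
  rw [h1, h3, integral_sub hTi (integrable_const _),
    hint, integral_const, measureReal_restrict_apply_univ, ← smul_sub, inner_smul_right]
  have h2 : A - skewL N A = symL N A := by
    change A - (A - symL N A) = _
    abel
  rw [h2, inner_symL_of_isSkew A hB, mul_zero]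

theorem eq_of_perpSoN {Ω : Set (Pt N)} {T S S' : L2 Ω (Ten N)} (hS : S ∈ soN Ω)
    (hS' : S' ∈ soN Ω) (h : PerpSoN (T - S)) (h' : PerpSoN (T - S')) : S' = S := by
  have h1 := h _ (soN_sub hS' hS)
  have h2 := h' _ (soN_sub hS' hS)
  have h3 : inner ℝ (S' - S) (S' - S) = (0 : ℝ) := by
    have : S' - S = (T - S) - (T - S') := by abel
    rw [this, inner_sub_left, ← this, h1, h2, sub_zero]
  rwa [inner_self_eq_zero, sub_eq_zero] at h3

theorem zero_mem_soN (Ω : Set (Pt N)) : (0 : L2 Ω (Ten N)) ∈ soN Ω :=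
  ⟨0, fun i j => by simp, Lp.coeFn_zero _ _ _⟩

theorem exists_skew_average {Ω : Set (Pt N)} (hΩt : volume Ω ≠ ⊤) (T : L2 Ω (Ten N)) :
    ∃ S ∈ soN Ω, ∀ᵐ x ∂volume.restrict Ω, S x = skewL N (⨍ y in Ω, T y) := by
  have hfin : IsFiniteMeasure (volume.restrict Ω) := ⟨by simpa using hΩt.lt_top⟩
  have h := (memLp_const (p := 2) (μ := volume.restrict Ω) (skewL N (⨍ y in Ω, T y))).coeFn_toLp
  exact ⟨_, ⟨_, isSkew_skewL _, h⟩, h⟩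

/-- The estimate orthogonal to the constant skew-symmetric tensor fields. -/
theorem exists_norm_le_of_perpSoN {Ω : Set (Pt N)} (hΩ : IsOpen Ω) (hΩc : IsPreconnected Ω)
    (hΩt : volume Ω ≠ ⊤) (hadm : Admissible Ω ∅) :
    ∃ c > 0, ∀ w ∈ {w : L2 Ω (Ten N) × L2 Ω (Rot N) | w ∈ HCurl Ω ∧ PerpSoN w.1},
      ‖w.1‖ ≤ c * symCurlNorm w := by
  refine exists_norm_le_symCurlNorm hΩ hΩt hadm (closedLinear_perpSoN Ω) (fun w hw m => ?_)
    fun w hw h2 hs => ?_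
  · exact (hw.1.hasWeakD m).mem_DSpace hΩ hadm.mcp hadm.map (isQForm_rowForm _ m)
      (isQForm_rowRot _ m)
  · have hc : HasWeakCurl w.1 0 := h2 ▸ hw.1
    -- A kernel element is itself a constant skew field, so it is orthogonal to itself.
    have h0 := hw.2 _ (exists_const_of_kernel hΩ hΩc hs hc)
    rwa [inner_self_eq_zero] at h0

theorem exists_norm_le_of_mem_HCurlVanish {Ω Γt : Set (Pt N)} (hΩ : IsOpen Ω)
    (hΩc : IsPreconnected Ω) (hΩt : volume Ω ≠ ⊤) (hΓt : ∃ U, IsOpen U ∧ Γt = U ∩ frontier Ω)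
    (hext : (Γt ∩ closure (closure Ω)ᶜ).Nonempty) (hadm : Admissible Ω Γt) :
    ∃ c > 0, ∀ w ∈ HCurlVanish Ω Γt, ‖w.1‖ ≤ c * symCurlNorm w :=
  exists_norm_le_symCurlNorm hΩ hΩt hadm (closedLinear_HCurlVanish Ω Γt)
    (fun _ hw m => row_mem_DSpace hw m)
    fun _ hw h2 hs => eq_zero_of_mem_HCurlVanish hΩ hΩc hΓt hext hw h2 hs

end

end KornMaxwell

/-! ### Assembly of the cases -/

theorem theorem1 (N : ℕ) (Ω Γt : Set (KornMaxwell.Pt N))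
    (hΩ_open : IsOpen Ω) (hΩ_conn : IsConnected Ω) (hΩ_bdd : Bornology.IsBounded Ω)
    (hΓt : ∃ U, IsOpen U ∧ Γt = U ∩ frontier Ω)
    (hext : Γt.Nonempty → (Γt ∩ closure (closure Ω)ᶜ).Nonempty)
    (hadm : KornMaxwell.Admissible Ω Γt) :
    ∃ c₁ : ℝ, 0 < c₁ ∧
      -- (i)
      (Γt.Nonempty →
        (∀ w ∈ KornMaxwell.HCurlVanish Ω Γt, ‖w.1‖ ≤ c₁ * (‖KornMaxwell.symF w.1‖ + ‖w.2‖)) ∧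
        KornMaxwell.IsEquivNormOn (KornMaxwell.HCurlVanish Ω Γt)
          KornMaxwell.symCurlNorm KornMaxwell.hCurlNorm) ∧
      -- (ii)
      (Γt = ∅ →
        ∀ (J : ℕ) (P : Fin J → Set (KornMaxwell.Pt N)), KornMaxwell.IsSlicing Ω Γt P →
          ∃ c₂ : ℝ, c₁ ≤ c₂ ∧ ∀ w ∈ KornMaxwell.HCurl Ω,
            ∃ S : KornMaxwell.L2 Ω (KornMaxwell.Ten N),
              (∀ j, ∃ A : KornMaxwell.Ten N, KornMaxwell.IsSkew A ∧
                ∀ᵐ x ∂MeasureTheory.volume.restrict (P j), S x = A) ∧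
              ‖w.1 - S‖ ≤ c₂ * (‖KornMaxwell.symF w.1‖ + ‖w.2‖)) ∧
      -- (ii')
      (Γt = ∅ → IsSimplyConnected Ω →
        (∀ w ∈ KornMaxwell.HCurl Ω,
          ∃ S ∈ KornMaxwell.soN Ω,
            (∀ᵐ x ∂MeasureTheory.volume.restrict Ω,
              S x = KornMaxwell.skewL N (⨍ y in Ω, w.1 y)) ∧
            ‖w.1 - S‖ ≤ c₁ * (‖KornMaxwell.symF w.1‖ + ‖w.2‖) ∧
            (S, 0) ∈ KornMaxwell.HCurl Ω ∧
            (w.1 - S, w.2) ∈ KornMaxwell.HCurl Ω ∧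
            KornMaxwell.PerpSoN (w.1 - S) ∧
            (∀ S' ∈ KornMaxwell.soN Ω, KornMaxwell.PerpSoN (w.1 - S') → S' = S) ∧
            (S = 0 ↔ KornMaxwell.PerpSoN w.1)) ∧
        (∀ w ∈ KornMaxwell.HCurl Ω, KornMaxwell.PerpSoN w.1 →
          ‖w.1‖ ≤ c₁ * (‖KornMaxwell.symF w.1‖ + ‖w.2‖)) ∧
        KornMaxwell.IsEquivNormOn {w ∈ KornMaxwell.HCurl Ω | KornMaxwell.PerpSoN w.1}
          KornMaxwell.symCurlNorm KornMaxwell.hCurlNorm) := by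
  have hpre := hΩ_conn.isPreconnected
  have hvol : volume Ω ≠ ⊤ := hΩ_bdd.measure_lt_top.ne
  have hvol0 : volume Ω ≠ 0 := (hΩ_open.measure_pos volume hΩ_conn.nonempty).ne'
  rcases Γt.eq_empty_or_nonempty with rfl | hne
  · obtain ⟨c, hc, h⟩ := KornMaxwell.exists_norm_le_of_perpSoN hΩ_open hpre hvol hadm
    -- Subtracting a constant skew field changes neither the symmetric part nor the rotation, so the
    -- estimate for the orthogonal part is expressed by `w` itself.
    have hest : ∀ w ∈ KornMaxwell.HCurl Ω, ∀ S ∈ KornMaxwell.soN Ω,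
        KornMaxwell.PerpSoN (w.1 - S) → (w.1 - S, w.2) ∈ KornMaxwell.HCurl Ω ∧
          ‖w.1 - S‖ ≤ c * (‖KornMaxwell.symF w.1‖ + ‖w.2‖) := by
      intro w hw S hS hperp
      have hmem : (w.1 - S, w.2) ∈ KornMaxwell.HCurl Ω := by
        have := (KornMaxwell.closedLinear_HCurl Ω).sub_mem (y := (S, 0)) hw
          (KornMaxwell.hasWeakCurl_zero_of_mem_soN hS)
        rwa [show w - (S, 0) = (w.1 - S, w.2) by ext1 <;> simp] at this
      refine ⟨hmem, ?_⟩
      have := h _ ⟨hmem, hperp⟩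
      rwa [KornMaxwell.symCurlNorm, KornMaxwell.symF_sub,
        KornMaxwell.symF_eq_zero_of_mem_soN hS, sub_zero] at this
    refine ⟨c, hc, fun h0 => absurd h0 Set.not_nonempty_empty, fun _ J P hP => ?_,
      fun _ _ => ⟨fun w hw => ?_, fun w hw hperp => h w ⟨hw, hperp⟩,
        KornMaxwell.isEquivNormOn_symCurlNorm hc h⟩⟩
    -- One skew tensor, the skew part of the mean over `Ω`, is constant on every slice at once, so
    -- `c₂ = c₁` works.
    · refine ⟨c, le_rfl, fun w hw => ?_⟩
      obtain ⟨S, hS, hSx⟩ := KornMaxwell.exists_skew_average hvol w.1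
      refine ⟨S, fun j => ?_,
        (hest w hw S hS (KornMaxwell.perpSoN_sub_average hvol hvol0 _ _ hSx)).2⟩
      exact ⟨_, KornMaxwell.isSkew_skewL _,
        ae_mono (Measure.restrict_mono (hP.subset j) le_rfl) hSx⟩
    · obtain ⟨S, hS, hSx⟩ := KornMaxwell.exists_skew_average hvol w.1
      have hperp := KornMaxwell.perpSoN_sub_average hvol hvol0 _ _ hSx
      refine ⟨S, hS, hSx, (hest w hw S hS hperp).2, KornMaxwell.hasWeakCurl_zero_of_mem_soN hS,
        (hest w hw S hS hperp).1, hperp,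
        fun S' hS' h' => KornMaxwell.eq_of_perpSoN hS hS' hperp h', fun h0 => ?_, fun h0 => ?_⟩
      · rwa [h0, sub_zero] at hperp
      · exact (KornMaxwell.eq_of_perpSoN hS (KornMaxwell.zero_mem_soN Ω) hperp
          (by rwa [sub_zero])).symm
  · obtain ⟨c, hc, h⟩ := KornMaxwell.exists_norm_le_of_mem_HCurlVanish hΩ_open hpre hvol hΓt
      (hext hne) hadm
    exact ⟨c, hc, fun _ => ⟨h, KornMaxwell.isEquivNormOn_symCurlNorm hc h⟩,
      fun h0 => absurd h0 hne.ne_empty, fun h0 => absurd h0 hne.ne_empty⟩
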